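/- A \emph{small double category} $\mathbb{X}=(\mathbb{X}_0,\mathbb{X}_1)$ is a category object in the category $\mathbf{Cat}$ of small categories; $\mathbb{X}_0$ is the category of objects and vertical morphisms, $\mathbb{X}_1$ the category of horizontal morphisms and squares (composed vertically), and double functors are the internal functors. For a double functor $F\colon\mathbb{A}\to\mathbb{B}$ let $\mathsf{iso}(\mathbb{B})_1\subseteq\mathbb{B}_1$ be the subcategory of horizontally invertible horizontal morphisms and horizontally invertible squares, with horizontal source and target functors $s,t\colon\mathsf{iso}(\mathbb{B})_1\to\mathbb{B}_0$, let $(\mathbb{P}_F)_0=\mathbb{A}_0\times_{\mathbb{B}_0}\mathsf{iso}(\mathbb{B})_1$ be the pullback of $F_0$ and $t$, and let $\overline{F}_0\colon(\mathbb{P}_F)_0\to\mathsf{iso}(\mathbb{B})_1$ be the projection. Let $\tau'$ be the Grothendieck topology on $\mathbf{Cat}$ in which a sieve is covering iff it contains a functor that is surjective on objects and full. A functor is \emph{$\tau'$-epi} if the Yoneda embedding followed by sheafification sends it to an epimorphism of sheaves. A double functor $F$ is a \emph{weak equivalence} of the $\tau'$-model structure if the square formed by $F_1$, $F_0\times F_0$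 and the functors $(s,t)$ is a pullback in $\mathbf{Cat}$ and $s\circ\overline{F}_0\colon(\mathbb{P}_F)_0\to\mathbb{B}_0$ is $\tau'$-epi; it is a \emph{fibration} if the functor $(t,F)\colon\mathsf{iso}(\mathbb{A})_1\to(\mathbb{P}_F)_0$ is $\tau'$-epi; it is a \emph{cofibration} if it has the left lifting property with respect to all double functors that are both fibrations and weak equivalences. A double category $\mathbb{X}$ is \emph{cofibrant} if $\emptyset\to\mathbb{X}$ is a cofibration. Let $M$ be the free category monad on the category $\mathbf{Graph}$ of (non-reflexive) directed graphs, and $\overline{M}$ the induced 2-monad on the 2-category $\mathsf{Cat}(\mathbf{Graph})$ of internal categories in $\mathbf{Graph}$; double categories are the strict $\overline{M}$-algebras, the action being composition of vertical paths. The inclusion of strict algebras with strict morphisms into strict algebras with pseudo morphisms has a left 2-adjoint $A\mapsto A'$, and $A$ is \emph{flexible} if the counit $q\colon A'\to A$ has a section that is a strict morphism. \textbf{Corollary.} The cofibrant objects of the $\tau'$-model structure on the category of small double categories are precisely the flexible double categories: a double category $\mathbb{X}$ is cofibrant if and only if it is flexible as an $\overline{M}$-algebra. In particular, a double category $\mathbb{X}$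 is flexible if and only if $\mathbb{X}_0$ is (isomorphic to) the free category on a directed graph. -/

import Mathlib

open CategoryTheory

universe u

namespace DoubleCat

/-! ### Directed graphs and small categories, presented by sets and functions -/

/-- A (non-reflexive) directed graph with set of vertices `V` and set of edges `E`. -/
structure Gph (V E : Type u) where
  src : E → V
  tgt : E → V

/-- A morphism of directed graphs. -/
structure Gph.IsHom {V E V' E' : Type u} (G : Gph V E) (H : Gph V' E')
    (f₀ : V → V') (f₁ : E → E') : Prop where
  src : ∀ e, H.src (f₁ e) = f₀ (G.src e)
  tgt : ∀ e, H.tgt (f₁ e) = f₀ (G.tgt e)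

/-- The structure of a small category with set of objects `O` and set of arrows `A`.
Composition is written in diagrammatic order and is defined on composable pairs. -/
structure CatStr (O A : Type u) extends Gph O A where
  one : O → A
  src_one : ∀ x, src (one x) = x
  tgt_one : ∀ x, tgt (one x) = x
  comp : ∀ f g : A, tgt f = src g → A
  src_comp : ∀ f g (h : tgt f = src g), src (comp f g h) = src f
  tgt_comp : ∀ f g (h : tgt f = src g), tgt (comp f g h) = tgt g
  one_comp : ∀ f (h : tgt (one (src f)) = src f), comp (one (src f)) f h = f
  comp_one : ∀ f (h : tgt f = src (one (tgt f))), comp f (one (tgt f)) h = f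
  assoc : ∀ f g k (h₁ : tgt f = src g) (h₂ : tgt (comp f g h₁) = src k)
    (h₃ : tgt g = src k) (h₄ : tgt f = src (comp g k h₃)),
    comp (comp f g h₁) k h₂ = comp f (comp g k h₃) h₄

namespace CatStr

variable {O A O' A' O'' A'' : Type u}

theorem comp_congr (C : CatStr O A) {f f' g g' : A} (hf : f = f') (hg : g = g')
    (h : C.tgt f = C.src g) (h' : C.tgt f' = C.src g') : C.comp f g h = C.comp f' g' h' := by
  subst hf; subst hg; rfl

theorem one_comp' (C : CatStr O A) {x : O} {f : A} (hx : C.src f = x)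
    (h : C.tgt (C.one x) = C.src f) : C.comp (C.one x) f h = f := by
  subst hx; exact C.one_comp _ _

theorem comp_one' (C : CatStr O A) {x : O} {f : A} (hx : C.tgt f = x)
    (h : C.tgt f = C.src (C.one x)) : C.comp f (C.one x) h = f := by
  subst hx; exact C.comp_one _ _

/-- The pair of functions `f₀`, `f₁` is a functor from `C` to `D`. -/
structure IsFunctor (C : CatStr O A) (D : CatStr O' A') (f₀ : O → O') (f₁ : A → A') : Prop where
  src : ∀ a, D.src (f₁ a) = f₀ (C.src a)
  tgt : ∀ a, D.tgt (f₁ a) = f₀ (C.tgt a)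
  one : ∀ x, f₁ (C.one x) = D.one (f₀ x)
  comp : ∀ a b (h : C.tgt a = C.src b) (h' : D.tgt (f₁ a) = D.src (f₁ b)),
    f₁ (C.comp a b h) = D.comp (f₁ a) (f₁ b) h'

theorem IsFunctor.id (C : CatStr O A) : IsFunctor C C (fun x => x) (fun a => a) :=
  ⟨fun _ => rfl, fun _ => rfl, fun _ => rfl, fun _ _ _ _ => rfl⟩

theorem IsFunctor.comp' {C : CatStr O A} {D : CatStr O' A'} {E : CatStr O'' A''}
    {f₀ : O → O'} {f₁ : A → A'} {g₀ : O' → O''} {g₁ : A' → A''}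
    (hf : IsFunctor C D f₀ f₁) (hg : IsFunctor D E g₀ g₁) :
    IsFunctor C E (fun x => g₀ (f₀ x)) (fun a => g₁ (f₁ a)) where
  src a := by rw [hg.src, hf.src]
  tgt a := by rw [hg.tgt, hf.tgt]
  one x := by rw [hf.one, hg.one]
  comp a b h h' := by
    have e : D.tgt (f₁ a) = D.src (f₁ b) := by rw [hf.tgt, hf.src, h]
    rw [hf.comp a b h e, hg.comp _ _ e h']

theorem IsFunctor.tgt_eq_src {C : CatStr O A} {D : CatStr O' A'} {f₀ : O → O'} {f₁ : A → A'}
    (hf : IsFunctor C D f₀ f₁) {a b : A} (h : C.tgt a = C.src b) :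
    D.tgt (f₁ a) = D.src (f₁ b) := by rw [hf.tgt, hf.src, h]

theorem IsFunctor.map_comp {C : CatStr O A} {D : CatStr O' A'} {f₀ : O → O'} {f₁ : A → A'}
    (hf : IsFunctor C D f₀ f₁) (a b : A) (h : C.tgt a = C.src b) :
    f₁ (C.comp a b h) = D.comp (f₁ a) (f₁ b) (hf.tgt_eq_src h) := hf.comp a b h _

/-- An arrow is invertible if it has a two-sided inverse. -/
def IsInv (C : CatStr O A) (f : A) : Prop :=
  ∃ (g : A) (h : C.tgt f = C.src g) (h' : C.tgt g = C.src f),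
    C.comp f g h = C.one (C.src f) ∧ C.comp g f h' = C.one (C.tgt f)

theorem IsFunctor.isInv {C : CatStr O A} {D : CatStr O' A'} {f₀ : O → O'} {f₁ : A → A'}
    (hf : IsFunctor C D f₀ f₁) {a : A} (ha : C.IsInv a) : D.IsInv (f₁ a) := by
  obtain ⟨b, h, h', e, e'⟩ := ha
  have k : D.tgt (f₁ a) = D.src (f₁ b) := by rw [hf.tgt, hf.src, h]
  have k' : D.tgt (f₁ b) = D.src (f₁ a) := by rw [hf.tgt, hf.src, h']
  exact ⟨f₁ b, k, k', by rw [← hf.comp a b h k, e, hf.one, hf.src],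
    by rw [← hf.comp b a h' k', e', hf.one, hf.tgt]⟩

/-- The set of objects of `C`, as a type on which the category structure can be registered. -/
def El (_C : CatStr O A) : Type u := O

instance (C : CatStr O A) : Category.{u} C.El where
  Hom x y := { f : A // C.src f = x ∧ C.tgt f = y }
  id x := ⟨C.one x, C.src_one x, C.tgt_one x⟩
  comp f g := ⟨C.comp f.1 g.1 (f.2.2.trans g.2.1.symm),
    (C.src_comp _ _ _).trans f.2.1, (C.tgt_comp _ _ _).trans g.2.2⟩
  id_comp f := Subtype.ext (C.one_comp' f.2.1 _)
  comp_id f := Subtype.ext (C.comp_one' f.2.2 _)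
  assoc _ _ _ := Subtype.ext (C.assoc _ _ _ _ _ _ _)

/-- The object of Mathlib's category `Cat` given by `C`. -/
def toCat (C : CatStr O A) : Cat.{u, u} := Cat.of C.El

/-- The morphism of `Cat` given by a functor between categories presented by sets. -/
def IsFunctor.toCatHom {C : CatStr O A} {D : CatStr O' A'} {f₀ : O → O'} {f₁ : A → A'}
    (hf : IsFunctor C D f₀ f₁) : C.toCat ⟶ D.toCat :=
  Functor.toCatHom (C := C.El) (D := D.El)
    { obj := f₀
      map := fun a => ⟨f₁ a.1, (hf.src _).trans (congrArg f₀ a.2.1),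
        (hf.tgt _).trans (congrArg f₀ a.2.2)⟩
      map_id := fun x => Subtype.ext (hf.one x)
      map_comp := fun _ _ => Subtype.ext (hf.comp _ _ _ _) }

/-- The pullback (in the category of small categories) of two functors with common target. -/
def pullback {C : CatStr O A} {D : CatStr O' A'} {E : CatStr O'' A''}
    {f₀ : O → O''} {f₁ : A → A''} {g₀ : O' → O''} {g₁ : A' → A''}
    (hf : IsFunctor C E f₀ f₁) (hg : IsFunctor D E g₀ g₁) :
    CatStr { p : O × O' // f₀ p.1 = g₀ p.2 } { p : A × A' // f₁ p.1 = g₁ p.2 } where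
  src p := ⟨(C.src p.1.1, D.src p.1.2), by
    have h := congrArg E.src p.2
    rwa [hf.src, hg.src] at h⟩
  tgt p := ⟨(C.tgt p.1.1, D.tgt p.1.2), by
    have h := congrArg E.tgt p.2
    rwa [hf.tgt, hg.tgt] at h⟩
  one x := ⟨(C.one x.1.1, D.one x.1.2), by
    change f₁ (C.one _) = g₁ (D.one _)
    rw [hf.one, hg.one, x.2]⟩
  src_one x := Subtype.ext (Prod.ext (C.src_one _) (D.src_one _))
  tgt_one x := Subtype.ext (Prod.ext (C.tgt_one _) (D.tgt_one _))
  comp p q h := ⟨(C.comp p.1.1 q.1.1 (congrArg (fun z => z.1.1) h),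
      D.comp p.1.2 q.1.2 (congrArg (fun z => z.1.2) h)), by
    have h₁ : C.tgt p.1.1 = C.src q.1.1 := congrArg (fun z => z.1.1) h
    have h₂ : D.tgt p.1.2 = D.src q.1.2 := congrArg (fun z => z.1.2) h
    have k₁ : E.tgt (f₁ p.1.1) = E.src (f₁ q.1.1) := by rw [hf.tgt, hf.src, h₁]
    have k₂ : E.tgt (g₁ p.1.2) = E.src (g₁ q.1.2) := by rw [hg.tgt, hg.src, h₂]
    change f₁ (C.comp _ _ h₁) = g₁ (D.comp _ _ h₂)
    rw [hf.comp _ _ h₁ k₁, hg.comp _ _ h₂ k₂]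
    exact E.comp_congr p.2 q.2 _ _⟩
  src_comp p q h := Subtype.ext (Prod.ext (C.src_comp _ _ _) (D.src_comp _ _ _))
  tgt_comp p q h := Subtype.ext (Prod.ext (C.tgt_comp _ _ _) (D.tgt_comp _ _ _))
  one_comp p h := Subtype.ext (Prod.ext (C.one_comp _ _) (D.one_comp _ _))
  comp_one p h := Subtype.ext (Prod.ext (C.comp_one _ _) (D.comp_one _ _))
  assoc p q r h₁ h₂ h₃ h₄ :=
    Subtype.ext (Prod.ext (C.assoc _ _ _ _ _ _ _) (D.assoc _ _ _ _ _ _ _))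

end CatStr

/-! ### Double categories and double functors -/

/-- A small double category: a category object in the category of small categories.
The category of objects is `v₀` (objects and vertical morphisms, under vertical composition) and
the category of arrows is `v₁` (horizontal morphisms and squares, under vertical composition).
Horizontal sources, targets, identities and composition are those of `h₀` and `h₁`; the last
fields say that they are functors. A square `α` has left side `h₁.src α`, right side `h₁.tgt α`,
top `v₁.src α` and bottom `v₁.tgt α`. -/
structure DblCat : Type (u + 1) where
  Obj : Type u
  Hor : Type u
  Ver : Type u
  Sq : Type u
  v₀ : CatStr Obj Ver
  v₁ : CatStr Hor Sq
  h₀ : CatStr Obj Hor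
  h₁ : CatStr Ver Sq
  hsrc : CatStr.IsFunctor v₁ v₀ h₀.src h₁.src
  htgt : CatStr.IsFunctor v₁ v₀ h₀.tgt h₁.tgt
  hone : CatStr.IsFunctor v₀ v₁ h₀.one h₁.one
  vsrc : CatStr.IsFunctor h₁ h₀ v₀.src v₁.src
  vtgt : CatStr.IsFunctor h₁ h₀ v₀.tgt v₁.tgt
  vone : CatStr.IsFunctor h₀ h₁ v₀.one v₁.one
  interchange : ∀ α β γ δ (hαβ : h₁.tgt α = h₁.src β) (hγδ : h₁.tgt γ = h₁.src δ)
    (hαγ : v₁.tgt α = v₁.src γ) (hβδ : v₁.tgt β = v₁.src δ)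
    (h : v₁.tgt (h₁.comp α β hαβ) = v₁.src (h₁.comp γ δ hγδ))
    (h' : h₁.tgt (v₁.comp α γ hαγ) = h₁.src (v₁.comp β δ hβδ)),
    v₁.comp (h₁.comp α β hαβ) (h₁.comp γ δ hγδ) h =
      h₁.comp (v₁.comp α γ hαγ) (v₁.comp β δ hβδ) h'

namespace DblCat

/-- A double functor: it preserves all sources, targets, identities and compositions. -/
@[ext]
structure Hom (X Y : DblCat.{u}) where
  obj : X.Obj → Y.Obj
  hor : X.Hor → Y.Hor
  ver : X.Ver → Y.Ver
  sq : X.Sq → Y.Sq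
  map_v₀ : CatStr.IsFunctor X.v₀ Y.v₀ obj ver
  map_v₁ : CatStr.IsFunctor X.v₁ Y.v₁ hor sq
  map_h₀ : CatStr.IsFunctor X.h₀ Y.h₀ obj hor
  map_h₁ : CatStr.IsFunctor X.h₁ Y.h₁ ver sq

instance : Category DblCat.{u} where
  Hom := Hom
  id X := ⟨fun x => x, fun f => f, fun j => j, fun α => α,
    CatStr.IsFunctor.id _, CatStr.IsFunctor.id _, CatStr.IsFunctor.id _, CatStr.IsFunctor.id _⟩
  comp F G := ⟨fun x => G.obj (F.obj x), fun f => G.hor (F.hor f), fun j => G.ver (F.ver j),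
    fun α => G.sq (F.sq α), F.map_v₀.comp' G.map_v₀, F.map_v₁.comp' G.map_v₁,
    F.map_h₀.comp' G.map_h₀, F.map_h₁.comp' G.map_h₁⟩

/-- The category with no objects. -/
def emptyCat : CatStr PEmpty.{u + 1} PEmpty.{u + 1} where
  src := PEmpty.elim
  tgt := PEmpty.elim
  one := PEmpty.elim
  src_one := nofun
  tgt_one := nofun
  comp f := f.elim
  src_comp := nofun
  tgt_comp := nofun
  one_comp := nofun
  comp_one := nofun
  assoc := nofun

/-- The empty double category. -/
def empty : DblCat.{u} where
  Obj := PEmpty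
  Hor := PEmpty
  Ver := PEmpty
  Sq := PEmpty
  v₀ := emptyCat
  v₁ := emptyCat
  h₀ := emptyCat
  h₁ := emptyCat
  hsrc := ⟨nofun, nofun, nofun, nofun⟩
  htgt := ⟨nofun, nofun, nofun, nofun⟩
  hone := ⟨nofun, nofun, nofun, nofun⟩
  vsrc := ⟨nofun, nofun, nofun, nofun⟩
  vtgt := ⟨nofun, nofun, nofun, nofun⟩
  vone := ⟨nofun, nofun, nofun, nofun⟩
  interchange := nofun

/-- The empty double category is initial. -/
def emptyIsInitial : Limits.IsInitial empty.{u} :=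
  Limits.IsInitial.ofUniqueHom
    (fun _ => ⟨PEmpty.elim, PEmpty.elim, PEmpty.elim, PEmpty.elim,
      ⟨nofun, nofun, nofun, nofun⟩, ⟨nofun, nofun, nofun, nofun⟩,
      ⟨nofun, nofun, nofun, nofun⟩, ⟨nofun, nofun, nofun, nofun⟩⟩)
    (fun _ _ => Hom.ext (funext nofun) (funext nofun) (funext nofun) (funext nofun))

instance : Limits.HasInitial DblCat.{u} := emptyIsInitial.hasInitial

/-- The category `X₀` of objects and vertical morphisms of a double category `X`. -/
def objCat (X : DblCat.{u}) : Cat.{u, u} := X.v₀.toCat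

/-! ### Equivalences, fibrations and cofibrations relative to a topology on `Cat` -/

/-- The category `iso(X)₁`: horizontally invertible horizontal morphisms, horizontally
invertible squares, and vertical composition. -/
def isoCat (X : DblCat.{u}) : CatStr { f : X.Hor // X.h₀.IsInv f } { α : X.Sq // X.h₁.IsInv α } where
  src α := ⟨X.v₁.src α.1, X.vsrc.isInv α.2⟩
  tgt α := ⟨X.v₁.tgt α.1, X.vtgt.isInv α.2⟩
  one f := ⟨X.v₁.one f.1, X.vone.isInv f.2⟩
  src_one f := Subtype.ext (X.v₁.src_one _)
  tgt_one f := Subtype.ext (X.v₁.tgt_one _)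
  comp α β h := ⟨X.v₁.comp α.1 β.1 (congrArg Subtype.val h), by
    obtain ⟨α, α', hα, hα', eα, eα'⟩ := α
    obtain ⟨β, β', hβ, hβ', eβ, eβ'⟩ := β
    have hαβ : X.v₁.tgt α = X.v₁.src β := congrArg Subtype.val h
    have iα : X.h₀.comp (X.v₁.tgt α) (X.v₁.tgt α') (by rw [X.vtgt.tgt, X.vtgt.src, hα]) =
        X.h₀.one (X.h₀.src (X.v₁.tgt α)) := by
      rw [← X.vtgt.comp α α' hα, eα, X.vtgt.one, X.vtgt.src]
    have iβ : X.h₀.comp (X.v₁.src β') (X.v₁.src β) (by rw [X.vsrc.tgt, X.vsrc.src, hβ']) =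
        X.h₀.one (X.h₀.tgt (X.v₁.src β)) := by
      rw [← X.vsrc.comp β' β hβ', eβ', X.vsrc.one, X.vsrc.tgt]
    have hαβ' : X.v₁.tgt α' = X.v₁.src β' := by
      have e₁ : X.h₀.tgt (X.v₁.src β') = X.h₀.src (X.v₁.tgt α) := by
        rw [X.vsrc.tgt, hβ', hαβ, ← X.vsrc.src]
      have e₂ : X.h₀.tgt (X.v₁.tgt α) = X.h₀.src (X.v₁.tgt α') := by
        rw [X.vtgt.tgt, hα, ← X.vtgt.src]
      have e₃ : X.h₀.tgt (X.h₀.comp _ _ e₁) = X.h₀.src (X.v₁.tgt α') := by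
        rw [X.h₀.tgt_comp, e₂]
      have e₄ : X.h₀.tgt (X.v₁.src β') = X.h₀.src (X.h₀.comp _ _ e₂) := by
        rw [X.h₀.src_comp, e₁]
      have key := X.h₀.assoc (X.v₁.src β') (X.v₁.tgt α) (X.v₁.tgt α') e₁ e₃ e₂ e₄
      have l : X.h₀.comp _ _ e₁ = X.h₀.one (X.h₀.tgt (X.v₁.src β)) := by
        rw [← iβ]; exact X.h₀.comp_congr rfl hαβ _ _
      rw [X.h₀.comp_congr l rfl e₃ (by rw [X.h₀.tgt_one, ← hαβ, e₂]),
        X.h₀.comp_congr rfl iα e₄ (by rw [X.h₀.src_one, e₁]),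
        X.h₀.one_comp' (by rw [← hαβ, e₂]), X.h₀.comp_one' e₁] at key
      exact key
    have a : X.h₁.tgt (X.v₁.comp α β hαβ) = X.h₁.src (X.v₁.comp α' β' hαβ') := by
      rw [X.htgt.comp α β hαβ (by rw [X.htgt.tgt, X.htgt.src, hαβ]),
        X.hsrc.comp α' β' hαβ' (by rw [X.hsrc.tgt, X.hsrc.src, hαβ'])]
      exact X.v₀.comp_congr hα hβ _ _
    have b : X.h₁.tgt (X.v₁.comp α' β' hαβ') = X.h₁.src (X.v₁.comp α β hαβ) := by
      rw [X.htgt.comp α' β' hαβ' (by rw [X.htgt.tgt, X.htgt.src, hαβ']),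
        X.hsrc.comp α β hαβ (by rw [X.hsrc.tgt, X.hsrc.src, hαβ])]
      exact X.v₀.comp_congr hα' hβ' _ _
    have ks : X.v₀.tgt (X.h₁.src α) = X.v₀.src (X.h₁.src β) := by
      rw [X.hsrc.tgt, X.hsrc.src, hαβ]
    have kt : X.v₀.tgt (X.h₁.tgt α) = X.v₀.src (X.h₁.tgt β) := by
      rw [X.htgt.tgt, X.htgt.src, hαβ]
    refine ⟨X.v₁.comp α' β' hαβ', a, b, ?_, ?_⟩
    · have k : X.v₁.tgt (X.h₁.comp α α' hα) = X.v₁.src (X.h₁.comp β β' hβ) := by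
        rw [eα, eβ, X.hone.tgt, X.hone.src, ks]
      rw [← X.interchange α α' β β' hα hβ hαβ hαβ' k a,
        X.v₁.comp_congr eα eβ k (by rw [X.hone.tgt, X.hone.src, ks]),
        ← X.hone.comp _ _ ks, X.hsrc.comp α β hαβ ks]
    · have k : X.v₁.tgt (X.h₁.comp α' α hα') = X.v₁.src (X.h₁.comp β' β hβ') := by
        rw [eα', eβ', X.hone.tgt, X.hone.src, kt]
      rw [← X.interchange α' α β' β hα' hβ' hαβ' hαβ k b,
        X.v₁.comp_congr eα' eβ' k (by rw [X.hone.tgt, X.hone.src, kt]),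
        ← X.hone.comp _ _ kt, X.htgt.comp α β hαβ kt]⟩
  src_comp α β h := Subtype.ext (X.v₁.src_comp _ _ _)
  tgt_comp α β h := Subtype.ext (X.v₁.tgt_comp _ _ _)
  one_comp α h := Subtype.ext (X.v₁.one_comp _ _)
  comp_one α h := Subtype.ext (X.v₁.comp_one _ _)
  assoc α β γ h₁ h₂ h₃ h₄ := Subtype.ext (X.v₁.assoc _ _ _ _ _ _ _)

/-- The horizontal source functor `iso(X)₁ → X₀`. -/
theorem isoSrc (X : DblCat.{u}) :
    CatStr.IsFunctor X.isoCat X.v₀ (fun f => X.h₀.src f.1) (fun α => X.h₁.src α.1) :=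
  ⟨fun _ => X.hsrc.src _, fun _ => X.hsrc.tgt _, fun _ => X.hsrc.one _,
    fun _ _ _ _ => X.hsrc.comp _ _ _ _⟩

/-- The horizontal target functor `iso(X)₁ → X₀`. -/
theorem isoTgt (X : DblCat.{u}) :
    CatStr.IsFunctor X.isoCat X.v₀ (fun f => X.h₀.tgt f.1) (fun α => X.h₁.tgt α.1) :=
  ⟨fun _ => X.htgt.src _, fun _ => X.htgt.tgt _, fun _ => X.htgt.one _,
    fun _ _ _ _ => X.htgt.comp _ _ _ _⟩

/-- The mapping path category `(P_F)₀`, the pullback of `F₀` along the horizontal target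
functor: its objects are pairs `(a, f : b ≅ F a)`. -/
def pathObject {X Y : DblCat.{u}} (F : X ⟶ Y) :=
  CatStr.pullback F.map_v₀ Y.isoTgt

/-- The functor `(P_F)₀ → Y₀`, `(a, f : b ≅ F a) ↦ b`. -/
theorem pathSrc {X Y : DblCat.{u}} (F : X ⟶ Y) :
    CatStr.IsFunctor (pathObject F) Y.v₀ (fun p => Y.h₀.src p.1.2.1)
      (fun p => Y.h₁.src p.1.2.1) :=
  ⟨fun _ => Y.hsrc.src _, fun _ => Y.hsrc.tgt _, fun _ => Y.hsrc.one _,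
    fun _ _ _ _ => Y.hsrc.comp _ _ _ _⟩

/-- The functor `(r_F)₀ : iso(X)₁ → (P_F)₀`, `f ↦ (target of f, F f)`. -/
theorem pathLift {X Y : DblCat.{u}} (F : X ⟶ Y) :
    CatStr.IsFunctor X.isoCat (pathObject F)
      (fun f => ⟨(X.h₀.tgt f.1, ⟨F.hor f.1, F.map_h₀.isInv f.2⟩), (F.map_h₀.tgt f.1).symm⟩)
      (fun α => ⟨(X.h₁.tgt α.1, ⟨F.sq α.1, F.map_h₁.isInv α.2⟩), (F.map_h₁.tgt α.1).symm⟩) where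
  src _ := Subtype.ext (Prod.ext (X.htgt.src _) (Subtype.ext (F.map_v₁.src _)))
  tgt _ := Subtype.ext (Prod.ext (X.htgt.tgt _) (Subtype.ext (F.map_v₁.tgt _)))
  one _ := Subtype.ext (Prod.ext (X.htgt.one _) (Subtype.ext (F.map_v₁.one _)))
  comp _ _ _ h' := Subtype.ext (Prod.ext
    (X.htgt.comp _ _ _ (congrArg (fun z => z.1.1) h'))
    (Subtype.ext (F.map_v₁.comp _ _ _ (congrArg (fun z => z.1.2.1) h'))))

/-- A functor `p` is a `J`-epimorphism if the associated morphism of sheaves (Yoneda embedding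
followed by sheafification) is an epimorphism. -/
def IsTEpi (J : GrothendieckTopology Cat.{u, u}) {E B : Cat.{u, u}} (p : E ⟶ B) : Prop :=
  Epi ((presheafToSheaf J (Type (u + 1))).map (uliftYoneda.{u + 1}.map p))

/-- A double functor is fully faithful if the square formed by `F₁`, `F₀ × F₀` and the two
functors (horizontal source, horizontal target) is a pullback of categories, that is, if it is a
pullback on objects (horizontal morphisms) and on arrows (squares). -/
structure IsFullyFaithful {X Y : DblCat.{u}} (F : X ⟶ Y) : Prop where
  hor : ∀ (a a' : X.Obj) (f : Y.Hor), Y.h₀.src f = F.obj a → Y.h₀.tgt f = F.obj a' →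
    ∃! g : X.Hor, X.h₀.src g = a ∧ X.h₀.tgt g = a' ∧ F.hor g = f
  sq : ∀ (j k : X.Ver) (α : Y.Sq), Y.h₁.src α = F.ver j → Y.h₁.tgt α = F.ver k →
    ∃! β : X.Sq, X.h₁.src β = j ∧ X.h₁.tgt β = k ∧ F.sq β = α

/-- The `J`-equivalences: fully faithful and essentially `J`-surjective double functors. -/
def we (J : GrothendieckTopology Cat.{u, u}) : MorphismProperty DblCat.{u} :=
  fun _ _ F => IsFullyFaithful F ∧ IsTEpi J (pathSrc F).toCatHom

/-- The `J`-fibrations: double functors `F` for which `(r_F)₀` is a `J`-epimorphism. -/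
def fib (J : GrothendieckTopology Cat.{u, u}) : MorphismProperty DblCat.{u} :=
  fun _ _ F => IsTEpi J (pathLift F).toCatHom

/-- The `J`-cofibrations: double functors with the left lifting property with respect to the
acyclic `J`-fibrations. -/
def cof (J : GrothendieckTopology Cat.{u, u}) : MorphismProperty DblCat.{u} :=
  (fib J ⊓ we J).llp

end DblCat

/-- The strict pullback of two functors, used to see that the categorically surjective functors
are stable under pullback. -/
structure StrictPullback {E Z B : Cat.{u, u}} (p : E ⟶ B) (g : Z ⟶ B) : Type u where
  fst : E
  snd : Z
  w : p.toFunctor.obj fst = g.toFunctor.obj snd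

instance {E Z B : Cat.{u, u}} (p : E ⟶ B) (g : Z ⟶ B) : Category.{u} (StrictPullback p g) where
  Hom x y := { f : (x.fst ⟶ y.fst) × (x.snd ⟶ y.snd) //
    p.toFunctor.map f.1 ≫ eqToHom y.w = eqToHom x.w ≫ g.toFunctor.map f.2 }
  id x := ⟨(𝟙 _, 𝟙 _), by simp⟩
  comp f f' := ⟨(f.1.1 ≫ f'.1.1, f.1.2 ≫ f'.1.2), by
    simp only [Functor.map_comp, Category.assoc]
    rw [f'.2, ← Category.assoc, f.2, Category.assoc]⟩
  id_comp _ := Subtype.ext (Prod.ext (Category.id_comp _) (Category.id_comp _))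
  comp_id _ := Subtype.ext (Prod.ext (Category.comp_id _) (Category.comp_id _))
  assoc _ _ _ := Subtype.ext (Prod.ext (Category.assoc _ _ _) (Category.assoc _ _ _))

/-- A functor is categorically surjective if it is surjective on objects and full. -/
def CatSurj {E B : Cat.{u, u}} (p : E ⟶ B) : Prop :=
  Function.Surjective p.toFunctor.obj ∧ p.toFunctor.Full

/-- The categorically surjective topology `τ'` on `Cat`: a sieve is covering if and only if it
contains a categorically surjective functor. -/
def tauPrime : GrothendieckTopology Cat.{u, u} where
  sieves B := { S | ∃ (E : Cat.{u, u}) (p : E ⟶ B), S p ∧ CatSurj p }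
  top_mem' B := ⟨B, 𝟙 B, trivial, fun x => ⟨x, rfl⟩, ⟨fun f => ⟨f, rfl⟩⟩⟩
  pullback_stable' := by
    rintro B Z S g ⟨E, p, hp, hs, hf⟩
    let fst : StrictPullback p g ⥤ E := { obj := fun x => x.fst, map := fun f => f.1.1 }
    let snd : StrictPullback p g ⥤ Z := { obj := fun x => x.snd, map := fun f => f.1.2 }
    have w : (fst.toCatHom ≫ p : Cat.of (StrictPullback p g) ⟶ B) = snd.toCatHom ≫ g := by
      refine Cat.ext (CategoryTheory.Functor.ext (fun x => x.w) ?_)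
      intro x y f
      have h := f.2
      change p.toFunctor.map f.1.1 = eqToHom x.w ≫ g.toFunctor.map f.1.2 ≫ eqToHom y.w.symm
      rw [← Category.assoc, ← h]
      simp
    refine ⟨Cat.of (StrictPullback p g), snd.toCatHom, ?_, ?_, ⟨?_⟩⟩
    · change S (snd.toCatHom ≫ g)
      rw [← w]
      exact S.downward_closed hp _
    · intro z
      obtain ⟨e, he⟩ := hs (g.toFunctor.obj z)
      exact ⟨⟨e, z, he⟩, rfl⟩
    · intro x y f
      obtain ⟨a, ha⟩ := hf.map_surjective
        (eqToHom x.w ≫ g.toFunctor.map f ≫ eqToHom y.w.symm)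
      exact ⟨⟨(a, f), by rw [ha]; simp⟩, rfl⟩
  transitive' := by
    rintro B S ⟨E, p, hp, hs, hf⟩ R hR
    obtain ⟨D, q, hq, hs', hf'⟩ := hR hp
    exact ⟨D, q ≫ p, hq, hs.comp hs', inferInstanceAs (q.toFunctor ⋙ p.toFunctor).Full⟩

namespace DblCat

/-! The classes of maps of the `τ'`-model structure on double categories. -/

instance : HomotopicalAlgebra.CategoryWithWeakEquivalences DblCat.{u} := ⟨we tauPrime⟩

instance : HomotopicalAlgebra.CategoryWithFibrations DblCat.{u} := ⟨fib tauPrime⟩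

instance : HomotopicalAlgebra.CategoryWithCofibrations DblCat.{u} := ⟨cof tauPrime⟩

end DblCat

/-! ### The free category monad `M` on graphs -/

namespace Gph

variable {V E V' E' V'' E'' : Type u}

/-- `l` is the list of successive edges of a path of `G` that starts at the given vertex. -/
def IsPath (G : Gph V E) : V → List E → Prop
  | _, [] => True
  | v, e :: l => G.src e = v ∧ G.IsPath (G.tgt e) l

/-- The end of the path with given starting vertex and successive edges. -/
def endpt (G : Gph V E) : V → List E → V
  | v, [] => v
  | _, e :: l => G.endpt (G.tgt e) l

/-- A path of a directed graph. -/
@[ext]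
structure Path (G : Gph V E) where
  start : V
  edges : List E
  isPath : G.IsPath start edges

/-- The graph `M G`: same vertices as `G`, and the paths of `G` as edges. -/
def pathGph (G : Gph V E) : Gph V G.Path where
  src p := p.start
  tgt p := G.endpt p.start p.edges

theorem IsHom.isPath {G : Gph V E} {H : Gph V' E'} {f₀ : V → V'} {f₁ : E → E'}
    (hf : IsHom G H f₀ f₁) {v : V} {l : List E} (h : G.IsPath v l) :
    H.IsPath (f₀ v) (l.map f₁) := by
  induction l generalizing v with
  | nil => trivial
  | cons e l ih =>
    refine ⟨by rw [hf.src, h.1], ?_⟩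
    rw [hf.tgt]
    exact ih h.2

theorem IsHom.endpt {G : Gph V E} {H : Gph V' E'} {f₀ : V → V'} {f₁ : E → E'}
    (hf : IsHom G H f₀ f₁) (v : V) (l : List E) :
    H.endpt (f₀ v) (l.map f₁) = f₀ (G.endpt v l) := by
  induction l generalizing v with
  | nil => rfl
  | cons e l ih =>
    change H.endpt (H.tgt (f₁ e)) (l.map f₁) = _
    rw [hf.tgt, ih]
    rfl

theorem isPath_append (G : Gph V E) (v : V) (l l' : List E) :
    G.IsPath v (l ++ l') ↔ G.IsPath v l ∧ G.IsPath (G.endpt v l) l' := by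
  induction l generalizing v with
  | nil => exact ⟨fun h => ⟨trivial, h⟩, fun h => h.2⟩
  | cons e l ih =>
    change (_ ∧ G.IsPath _ (l ++ l')) ↔ (_ ∧ _) ∧ G.IsPath (G.endpt (G.tgt e) l) l'
    rw [ih, and_assoc]

theorem endpt_append (G : Gph V E) (v : V) (l l' : List E) :
    G.endpt v (l ++ l') = G.endpt (G.endpt v l) l' := by
  induction l generalizing v with
  | nil => rfl
  | cons e l ih => exact ih _

/-- The action of `M` on a morphism of graphs. -/
def Path.map {G : Gph V E} {H : Gph V' E'} {f₀ : V → V'} {f₁ : E → E'}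
    (hf : IsHom G H f₀ f₁) (p : G.Path) : H.Path :=
  ⟨f₀ p.start, p.edges.map f₁, hf.isPath p.isPath⟩

theorem IsHom.path {G : Gph V E} {H : Gph V' E'} {f₀ : V → V'} {f₁ : E → E'}
    (hf : IsHom G H f₀ f₁) : IsHom G.pathGph H.pathGph f₀ (Path.map hf) :=
  ⟨fun _ => rfl, fun p => hf.endpt p.start p.edges⟩

/-- The path of length one given by an edge: the unit of `M`. -/
def single (G : Gph V E) (e : E) : G.Path := ⟨G.src e, [e], rfl, trivial⟩

theorem single_isHom (G : Gph V E) : IsHom G G.pathGph (fun v => v) G.single :=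
  ⟨fun _ => rfl, fun _ => rfl⟩

theorem flat_isPath (G : Gph V E) {v : V} {l : List G.Path} (h : G.pathGph.IsPath v l) :
    G.IsPath v (l.flatMap Path.edges) ∧
      G.endpt v (l.flatMap Path.edges) = G.pathGph.endpt v l := by
  induction l generalizing v with
  | nil => exact ⟨trivial, rfl⟩
  | cons p l ih =>
    obtain ⟨h₁, h₂⟩ := h
    change p.start = v at h₁
    subst h₁
    rw [List.flatMap_cons, isPath_append, endpt_append]
    exact ⟨⟨p.isPath, (ih h₂).1⟩, (ih h₂).2⟩

/-- Concatenation of a path of paths: the multiplication of `M`. -/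
def flat (G : Gph V E) (p : G.pathGph.Path) : G.Path :=
  ⟨p.start, p.edges.flatMap Path.edges, (G.flat_isPath p.isPath).1⟩

theorem flat_isHom (G : Gph V E) : IsHom G.pathGph.pathGph G.pathGph (fun v => v) G.flat :=
  ⟨fun _ => rfl, fun p => (G.flat_isPath p.isPath).2⟩

end Gph

namespace CatStr

variable {O A O' A' : Type u}

/-- Componentwise composition of two lists of arrows. -/
def zip (C : CatStr O A) : (l l' : List A) → l.map C.tgt = l'.map C.src → List A
  | [], [], _ => []
  | a :: l, b :: l', h => C.comp a b (List.cons.inj h).1 :: C.zip l l' (List.cons.inj h).2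
  | [], _ :: _, h => nomatch h
  | _ :: _, [], h => nomatch h

theorem zip_congr (C : CatStr O A) {l₁ l₂ l₁' l₂' : List A} (h₁ : l₁ = l₁') (h₂ : l₂ = l₂')
    (h : l₁.map C.tgt = l₂.map C.src) (h' : l₁'.map C.tgt = l₂'.map C.src) :
    C.zip l₁ l₂ h = C.zip l₁' l₂' h' := by
  subst h₁; subst h₂; rfl

theorem map_src_zip (C : CatStr O A) (l l' : List A) (h : l.map C.tgt = l'.map C.src) :
    (C.zip l l' h).map C.src = l.map C.src := by
  induction l generalizing l' with
  | nil => cases l' with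
    | nil => rfl
    | cons b l' => cases h
  | cons a l ih => cases l' with
    | nil => cases h
    | cons b l' => exact congrArg₂ List.cons (C.src_comp _ _ _) (ih _ _)

theorem map_tgt_zip (C : CatStr O A) (l l' : List A) (h : l.map C.tgt = l'.map C.src) :
    (C.zip l l' h).map C.tgt = l'.map C.tgt := by
  induction l generalizing l' with
  | nil => cases l' with
    | nil => rfl
    | cons b l' => cases h
  | cons a l ih => cases l' with
    | nil => cases h
    | cons b l' => exact congrArg₂ List.cons (C.tgt_comp _ _ _) (ih _ _)

theorem one_zip (C : CatStr O A) (l : List A)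
    (h : ((l.map C.src).map C.one).map C.tgt = l.map C.src) :
    C.zip ((l.map C.src).map C.one) l h = l := by
  induction l with
  | nil => rfl
  | cons a l ih => exact congrArg₂ List.cons (C.one_comp _ _) (ih _)

theorem zip_one (C : CatStr O A) (l : List A)
    (h : l.map C.tgt = ((l.map C.tgt).map C.one).map C.src) :
    C.zip l ((l.map C.tgt).map C.one) h = l := by
  induction l with
  | nil => rfl
  | cons a l ih => exact congrArg₂ List.cons (C.comp_one _ _) (ih _)

theorem zip_assoc (C : CatStr O A) (l₁ l₂ l₃ : List A) (h₁ : l₁.map C.tgt = l₂.map C.src)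
    (h₂ : (C.zip l₁ l₂ h₁).map C.tgt = l₃.map C.src) (h₃ : l₂.map C.tgt = l₃.map C.src)
    (h₄ : l₁.map C.tgt = (C.zip l₂ l₃ h₃).map C.src) :
    C.zip (C.zip l₁ l₂ h₁) l₃ h₂ = C.zip l₁ (C.zip l₂ l₃ h₃) h₄ := by
  induction l₁ generalizing l₂ l₃ with
  | nil => cases l₂ with
    | nil => cases l₃ with
      | nil => rfl
      | cons c l₃ => cases h₃
    | cons b l₂ => cases h₁
  | cons a l₁ ih => cases l₂ with
    | nil => cases h₁
    | cons b l₂ => cases l₃ with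
      | nil => cases h₃
      | cons c l₃ => exact congrArg₂ List.cons (C.assoc _ _ _ _ _ _ _) (ih _ _ _ _ _ _)

theorem zip_append (C : CatStr O A) (l₁ l₂ m₁ m₂ : List A) (h₁ : l₁.map C.tgt = m₁.map C.src)
    (h₂ : l₂.map C.tgt = m₂.map C.src) (h : (l₁ ++ l₂).map C.tgt = (m₁ ++ m₂).map C.src) :
    C.zip (l₁ ++ l₂) (m₁ ++ m₂) h = C.zip l₁ m₁ h₁ ++ C.zip l₂ m₂ h₂ := by
  induction l₁ generalizing m₁ with
  | nil => cases m₁ with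
    | nil => rfl
    | cons b m₁ => cases h₁
  | cons a l₁ ih => cases m₁ with
    | nil => cases h₁
    | cons b m₁ => exact congrArg₂ List.cons rfl (ih _ _ _)

theorem IsFunctor.map_tgt_eq {C : CatStr O A} {D : CatStr O' A'} {f₀ : O → O'} {f₁ : A → A'}
    (hf : IsFunctor C D f₀ f₁) {l l' : List A} (h : l.map C.tgt = l'.map C.src) :
    (l.map f₁).map D.tgt = (l'.map f₁).map D.src := by
  have h' := congrArg (List.map f₀) h
  simp only [List.map_map] at h' ⊢
  have e₁ : D.tgt ∘ f₁ = f₀ ∘ C.tgt := funext hf.tgt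
  have e₂ : D.src ∘ f₁ = f₀ ∘ C.src := funext hf.src
  rw [e₁, e₂, h']

theorem IsFunctor.map_zip {C : CatStr O A} {D : CatStr O' A'} {f₀ : O → O'} {f₁ : A → A'}
    (hf : IsFunctor C D f₀ f₁) (l l' : List A) (h : l.map C.tgt = l'.map C.src)
    (h' : (l.map f₁).map D.tgt = (l'.map f₁).map D.src) :
    (C.zip l l' h).map f₁ = D.zip (l.map f₁) (l'.map f₁) h' := by
  induction l generalizing l' with
  | nil => cases l' with
    | nil => rfl
    | cons b l' => cases h
  | cons a l ih => cases l' with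
    | nil => cases h
    | cons b l' => exact congrArg₂ List.cons (hf.comp _ _ _ _) (ih _ _ _)

end CatStr

/-! ### The 2-category of internal categories in graphs -/

/-- An internal category in directed graphs: a double graph with category structures on
(objects, horizontal morphisms) and on (vertical edges, squares), such that vertical sources
and targets are functors. There are no vertical compositions or identities. -/
structure CatGraph : Type (u + 1) where
  Obj : Type u
  Hor : Type u
  Ver : Type u
  Sq : Type u
  v₀ : Gph Obj Ver
  v₁ : Gph Hor Sq
  h₀ : CatStr Obj Hor
  h₁ : CatStr Ver Sq
  vsrc : CatStr.IsFunctor h₁ h₀ v₀.src v₁.src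
  vtgt : CatStr.IsFunctor h₁ h₀ v₀.tgt v₁.tgt

namespace CatGraph

/-- An internal functor between internal categories in directed graphs. -/
@[ext]
structure Hom (X Y : CatGraph.{u}) where
  obj : X.Obj → Y.Obj
  hor : X.Hor → Y.Hor
  ver : X.Ver → Y.Ver
  sq : X.Sq → Y.Sq
  map_v₀ : Gph.IsHom X.v₀ Y.v₀ obj ver
  map_v₁ : Gph.IsHom X.v₁ Y.v₁ hor sq
  map_h₀ : CatStr.IsFunctor X.h₀ Y.h₀ obj hor
  map_h₁ : CatStr.IsFunctor X.h₁ Y.h₁ ver sq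

instance : Category CatGraph.{u} where
  Hom := Hom
  id X := ⟨fun x => x, fun f => f, fun j => j, fun α => α, ⟨fun _ => rfl, fun _ => rfl⟩,
    ⟨fun _ => rfl, fun _ => rfl⟩, CatStr.IsFunctor.id _, CatStr.IsFunctor.id _⟩
  comp F G := ⟨fun x => G.obj (F.obj x), fun f => G.hor (F.hor f), fun j => G.ver (F.ver j),
    fun α => G.sq (F.sq α),
    ⟨fun _ => by rw [G.map_v₀.src, F.map_v₀.src], fun _ => by rw [G.map_v₀.tgt, F.map_v₀.tgt]⟩,
    ⟨fun _ => by rw [G.map_v₁.src, F.map_v₁.src], fun _ => by rw [G.map_v₁.tgt, F.map_v₁.tgt]⟩,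
    F.map_h₀.comp' G.map_h₀, F.map_h₁.comp' G.map_h₁⟩

theorem hsrc (X : CatGraph.{u}) : Gph.IsHom X.v₁ X.v₀ X.h₀.src X.h₁.src :=
  ⟨fun α => (X.vsrc.src α).symm, fun α => (X.vtgt.src α).symm⟩

theorem htgt (X : CatGraph.{u}) : Gph.IsHom X.v₁ X.v₀ X.h₀.tgt X.h₁.tgt :=
  ⟨fun α => (X.vsrc.tgt α).symm, fun α => (X.vtgt.tgt α).symm⟩

theorem hone (X : CatGraph.{u}) : Gph.IsHom X.v₀ X.v₁ X.h₀.one X.h₁.one :=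
  ⟨fun j => X.vsrc.one j, fun j => X.vtgt.one j⟩

/-- A 2-cell of internal categories in graphs, that is, an internal natural transformation: a
morphism of graphs `X₀ → Y₁` with the appropriate horizontal sources and targets, natural with
respect to the horizontal morphisms and the squares of `X`. -/
@[ext]
structure Trans {X Y : CatGraph.{u}} (F G : X ⟶ Y) where
  ob : X.Obj → Y.Hor
  ve : X.Ver → Y.Sq
  isHom : Gph.IsHom X.v₀ Y.v₁ ob ve
  src_ob : ∀ x, Y.h₀.src (ob x) = F.obj x
  tgt_ob : ∀ x, Y.h₀.tgt (ob x) = G.obj x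
  src_ve : ∀ j, Y.h₁.src (ve j) = F.ver j
  tgt_ve : ∀ j, Y.h₁.tgt (ve j) = G.ver j
  naturality_ob : ∀ (f : X.Hor) (h : Y.h₀.tgt (F.hor f) = Y.h₀.src (ob (X.h₀.tgt f)))
    (h' : Y.h₀.tgt (ob (X.h₀.src f)) = Y.h₀.src (G.hor f)),
    Y.h₀.comp (F.hor f) (ob (X.h₀.tgt f)) h = Y.h₀.comp (ob (X.h₀.src f)) (G.hor f) h'
  naturality_ve : ∀ (α : X.Sq) (h : Y.h₁.tgt (F.sq α) = Y.h₁.src (ve (X.h₁.tgt α)))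
    (h' : Y.h₁.tgt (ve (X.h₁.src α)) = Y.h₁.src (G.sq α)),
    Y.h₁.comp (F.sq α) (ve (X.h₁.tgt α)) h = Y.h₁.comp (ve (X.h₁.src α)) (G.sq α) h'

end CatGraph

theorem CatStr.natural_comp {O A O' A' : Type u} {C : CatStr O A} {D : CatStr O' A'}
    (f g k : O → A') (F G K : A → A') (a : A)
    (h₁ : D.tgt (F a) = D.src (f (C.tgt a))) (h₂ : D.tgt (f (C.src a)) = D.src (G a))
    (h₃ : D.tgt (G a) = D.src (g (C.tgt a))) (h₄ : D.tgt (g (C.src a)) = D.src (K a))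
    (e₁ : D.comp _ _ h₁ = D.comp _ _ h₂) (e₂ : D.comp _ _ h₃ = D.comp _ _ h₄)
    (l : ∀ x, D.tgt (f x) = D.src (g x)) (hk : ∀ x, k x = D.comp (f x) (g x) (l x))
    (h : D.tgt (F a) = D.src (k (C.tgt a))) (h' : D.tgt (k (C.src a)) = D.src (K a)) :
    D.comp (F a) (k (C.tgt a)) h = D.comp (k (C.src a)) (K a) h' := by
  have s₁ : D.tgt (D.comp (F a) (f (C.tgt a)) h₁) = D.src (g (C.tgt a)) := by
    rw [D.tgt_comp, l]
  have s₂ : D.tgt (f (C.src a)) = D.src (D.comp (G a) (g (C.tgt a)) h₃) := by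
    rw [D.src_comp, h₂]
  have s₃ : D.tgt (D.comp (f (C.src a)) (G a) h₂) = D.src (g (C.tgt a)) := by
    rw [D.tgt_comp, h₃]
  have s₄ : D.tgt (f (C.src a)) = D.src (D.comp (g (C.src a)) (K a) h₄) := by
    rw [D.src_comp, l]
  rw [D.comp_congr rfl (hk _) h (by rw [D.src_comp, h₁]), ← D.assoc _ _ _ h₁ s₁,
    D.comp_congr e₁ rfl s₁ s₃, D.assoc _ _ _ h₂ s₃ h₃ s₂, D.comp_congr rfl e₂ s₂ s₄,
    D.comp_congr (hk (C.src a)) rfl h' (by rw [D.tgt_comp, h₄]),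
    D.assoc _ _ _ (l _) _ h₄ s₄]

namespace CatGraph
namespace Trans

variable {W X Y Z : CatGraph.{u}} {F G H F' G' : X ⟶ Y}

/-- Transport of a 2-cell along equalities of its source and of its target. -/
def copy (θ : Trans F G) (hF : F = F') (hG : G = G') : Trans F' G' where
  ob := θ.ob
  ve := θ.ve
  isHom := θ.isHom
  src_ob := by subst hF; exact θ.src_ob
  tgt_ob := by subst hG; exact θ.tgt_ob
  src_ve := by subst hF; exact θ.src_ve
  tgt_ve := by subst hG; exact θ.tgt_ve
  naturality_ob := by subst hF; subst hG; exact θ.naturality_ob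
  naturality_ve := by subst hF; subst hG; exact θ.naturality_ve

/-- The identity 2-cell. -/
def id (F : X ⟶ Y) : Trans F F where
  ob x := Y.h₀.one (F.obj x)
  ve j := Y.h₁.one (F.ver j)
  isHom := ⟨fun j => by rw [Y.hone.src, F.map_v₀.src], fun j => by rw [Y.hone.tgt, F.map_v₀.tgt]⟩
  src_ob _ := Y.h₀.src_one _
  tgt_ob _ := Y.h₀.tgt_one _
  src_ve _ := Y.h₁.src_one _
  tgt_ve _ := Y.h₁.tgt_one _
  naturality_ob f h h' := by
    rw [Y.h₀.comp_one' (F.map_h₀.tgt f), Y.h₀.one_comp' (F.map_h₀.src f)]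
  naturality_ve f h h' := by
    rw [Y.h₁.comp_one' (F.map_h₁.tgt f), Y.h₁.one_comp' (F.map_h₁.src f)]

/-- Vertical composition of 2-cells, in diagrammatic order. -/
def comp (θ : Trans F G) (ψ : Trans G H) : Trans F H where
  ob x := Y.h₀.comp (θ.ob x) (ψ.ob x) ((θ.tgt_ob x).trans (ψ.src_ob x).symm)
  ve j := Y.h₁.comp (θ.ve j) (ψ.ve j) ((θ.tgt_ve j).trans (ψ.src_ve j).symm)
  isHom := by
    constructor
    · intro j
      rw [Y.vsrc.comp _ _ _ (by
        rw [θ.isHom.src, ψ.isHom.src, θ.tgt_ob, ψ.src_ob])]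
      exact Y.h₀.comp_congr (θ.isHom.src _) (ψ.isHom.src _) _ _
    · intro j
      rw [Y.vtgt.comp _ _ _ (by
        rw [θ.isHom.tgt, ψ.isHom.tgt, θ.tgt_ob, ψ.src_ob])]
      exact Y.h₀.comp_congr (θ.isHom.tgt _) (ψ.isHom.tgt _) _ _
  src_ob x := by rw [Y.h₀.src_comp, θ.src_ob]
  tgt_ob x := by rw [Y.h₀.tgt_comp, ψ.tgt_ob]
  src_ve x := by rw [Y.h₁.src_comp, θ.src_ve]
  tgt_ve x := by rw [Y.h₁.tgt_comp, ψ.tgt_ve]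
  naturality_ob f h h' := by
    have a₁ : Y.h₀.tgt (F.hor f) = Y.h₀.src (θ.ob (X.h₀.tgt f)) := by
      rw [θ.src_ob, F.map_h₀.tgt]
    have a₂ : Y.h₀.tgt (θ.ob (X.h₀.src f)) = Y.h₀.src (G.hor f) := by
      rw [θ.tgt_ob, G.map_h₀.src]
    have a₃ : Y.h₀.tgt (G.hor f) = Y.h₀.src (ψ.ob (X.h₀.tgt f)) := by
      rw [ψ.src_ob, G.map_h₀.tgt]
    have a₄ : Y.h₀.tgt (ψ.ob (X.h₀.src f)) = Y.h₀.src (H.hor f) := by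
      rw [ψ.tgt_ob, H.map_h₀.src]
    exact CatStr.natural_comp (C := X.h₀) (D := Y.h₀) θ.ob ψ.ob _ F.hor G.hor H.hor f a₁ a₂ a₃ a₄
      (θ.naturality_ob f _ _) (ψ.naturality_ob f _ _)
      (fun x => (θ.tgt_ob x).trans (ψ.src_ob x).symm) (fun _ => rfl) h h'
  naturality_ve f h h' := by
    have a₁ : Y.h₁.tgt (F.sq f) = Y.h₁.src (θ.ve (X.h₁.tgt f)) := by
      rw [θ.src_ve, F.map_h₁.tgt]
    have a₂ : Y.h₁.tgt (θ.ve (X.h₁.src f)) = Y.h₁.src (G.sq f) := by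
      rw [θ.tgt_ve, G.map_h₁.src]
    have a₃ : Y.h₁.tgt (G.sq f) = Y.h₁.src (ψ.ve (X.h₁.tgt f)) := by
      rw [ψ.src_ve, G.map_h₁.tgt]
    have a₄ : Y.h₁.tgt (ψ.ve (X.h₁.src f)) = Y.h₁.src (H.sq f) := by
      rw [ψ.tgt_ve, H.map_h₁.src]
    exact CatStr.natural_comp (C := X.h₁) (D := Y.h₁) θ.ve ψ.ve _ F.sq G.sq H.sq f a₁ a₂ a₃ a₄
      (θ.naturality_ve f _ _) (ψ.naturality_ve f _ _)
      (fun x => (θ.tgt_ve x).trans (ψ.src_ve x).symm) (fun _ => rfl) h h'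

/-- A 2-cell is invertible if it has a two-sided inverse for vertical composition. -/
def IsInvertible (θ : Trans F G) : Prop :=
  ∃ ψ : Trans G F, θ.comp ψ = Trans.id F ∧ ψ.comp θ = Trans.id G

/-- Whiskering of a 2-cell by an internal functor applied first. -/
def whiskerLeft (K : W ⟶ X) (θ : Trans F G) : Trans (K ≫ F) (K ≫ G) where
  ob x := θ.ob (K.obj x)
  ve j := θ.ve (K.ver j)
  isHom := ⟨fun j => by rw [θ.isHom.src, K.map_v₀.src], fun j => by rw [θ.isHom.tgt, K.map_v₀.tgt]⟩
  src_ob x := θ.src_ob _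
  tgt_ob x := θ.tgt_ob _
  src_ve j := θ.src_ve _
  tgt_ve j := θ.tgt_ve _
  naturality_ob f h h' := by
    have k : Y.h₀.tgt (F.hor (K.hor f)) = Y.h₀.src (θ.ob (X.h₀.tgt (K.hor f))) := by
      rw [θ.src_ob, F.map_h₀.tgt]
    have k' : Y.h₀.tgt (θ.ob (X.h₀.src (K.hor f))) = Y.h₀.src (G.hor (K.hor f)) := by
      rw [θ.tgt_ob, G.map_h₀.src]
    exact ((Y.h₀.comp_congr rfl (by rw [K.map_h₀.tgt]) h k).trans
      (θ.naturality_ob (K.hor f) k k')).trans (Y.h₀.comp_congr (by rw [K.map_h₀.src]) rfl k' h')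
  naturality_ve f h h' := by
    have k : Y.h₁.tgt (F.sq (K.sq f)) = Y.h₁.src (θ.ve (X.h₁.tgt (K.sq f))) := by
      rw [θ.src_ve, F.map_h₁.tgt]
    have k' : Y.h₁.tgt (θ.ve (X.h₁.src (K.sq f))) = Y.h₁.src (G.sq (K.sq f)) := by
      rw [θ.tgt_ve, G.map_h₁.src]
    exact ((Y.h₁.comp_congr rfl (by rw [K.map_h₁.tgt]) h k).trans
      (θ.naturality_ve (K.sq f) k k')).trans (Y.h₁.comp_congr (by rw [K.map_h₁.src]) rfl k' h')

/-- Whiskering of a 2-cell by an internal functor applied last. -/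
def whiskerRight (θ : Trans F G) (K : Y ⟶ Z) : Trans (F ≫ K) (G ≫ K) where
  ob x := K.hor (θ.ob x)
  ve j := K.sq (θ.ve j)
  isHom := ⟨fun j => by rw [K.map_v₁.src, θ.isHom.src], fun j => by rw [K.map_v₁.tgt, θ.isHom.tgt]⟩
  src_ob x := by rw [K.map_h₀.src, θ.src_ob]; rfl
  tgt_ob x := by rw [K.map_h₀.tgt, θ.tgt_ob]; rfl
  src_ve x := by rw [K.map_h₁.src, θ.src_ve]; rfl
  tgt_ve x := by rw [K.map_h₁.tgt, θ.tgt_ve]; rfl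
  naturality_ob f h h' := by
    have k : Y.h₀.tgt (F.hor f) = Y.h₀.src (θ.ob (X.h₀.tgt f)) := by
      rw [θ.src_ob, F.map_h₀.tgt]
    have k' : Y.h₀.tgt (θ.ob (X.h₀.src f)) = Y.h₀.src (G.hor f) := by
      rw [θ.tgt_ob, G.map_h₀.src]
    exact ((K.map_h₀.comp _ _ k h).symm.trans (congrArg K.hor (θ.naturality_ob f k k'))).trans
      (K.map_h₀.comp _ _ k' h')
  naturality_ve f h h' := by
    have k : Y.h₁.tgt (F.sq f) = Y.h₁.src (θ.ve (X.h₁.tgt f)) := by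
      rw [θ.src_ve, F.map_h₁.tgt]
    have k' : Y.h₁.tgt (θ.ve (X.h₁.src f)) = Y.h₁.src (G.sq f) := by
      rw [θ.tgt_ve, G.map_h₁.src]
    exact ((K.map_h₁.comp _ _ k h).symm.trans (congrArg K.sq (θ.naturality_ve f k k'))).trans
      (K.map_h₁.comp _ _ k' h')

end Trans
end CatGraph

/-! ### The 2-monad `M̄` on internal categories in graphs -/

namespace CatGraph

theorem zip_isPath (X : CatGraph.{u}) {f g : X.Hor} {l l' : List X.Sq}
    (hl : X.v₁.IsPath f l) (hl' : X.v₁.IsPath g l') (h : X.h₀.tgt f = X.h₀.src g)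
    (hz : l.map X.h₁.tgt = l'.map X.h₁.src) :
    X.v₁.IsPath (X.h₀.comp f g h) (X.h₁.zip l l' hz) := by
  induction l generalizing l' f g with
  | nil => cases l' with
    | nil => trivial
    | cons b l' => cases hz
  | cons a l ih => cases l' with
    | nil => cases hz
    | cons b l' =>
      have hab : X.h₁.tgt a = X.h₁.src b := (List.cons.inj hz).1
      obtain ⟨rfl, h₂⟩ := hl
      obtain ⟨rfl, h₂'⟩ := hl'
      have k : X.h₀.tgt (X.v₁.tgt a) = X.h₀.src (X.v₁.tgt b) := by
        rw [X.vtgt.tgt, X.vtgt.src, hab]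
      refine ⟨X.vsrc.comp a b hab h, ?_⟩
      rw [X.vtgt.comp a b hab k]
      exact ih h₂ h₂' k _

theorem zip_endpt (X : CatGraph.{u}) (f g : X.Hor) (l l' : List X.Sq)
    (h : X.h₀.tgt f = X.h₀.src g) (hz : l.map X.h₁.tgt = l'.map X.h₁.src)
    (k : X.h₀.tgt (X.v₁.endpt f l) = X.h₀.src (X.v₁.endpt g l')) :
    X.v₁.endpt (X.h₀.comp f g h) (X.h₁.zip l l' hz) =
      X.h₀.comp (X.v₁.endpt f l) (X.v₁.endpt g l') k := by
  induction l generalizing l' f g with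
  | nil => cases l' with
    | nil => rfl
    | cons b l' => cases hz
  | cons a l ih => cases l' with
    | nil => cases hz
    | cons b l' =>
      have hab : X.h₁.tgt a = X.h₁.src b := (List.cons.inj hz).1
      have k' : X.h₀.tgt (X.v₁.tgt a) = X.h₀.src (X.v₁.tgt b) := by
        rw [X.vtgt.tgt, X.vtgt.src, hab]
      change X.v₁.endpt (X.v₁.tgt (X.h₁.comp a b hab)) _ = _
      rw [X.vtgt.comp a b hab k']
      exact ih _ _ _ k' _ k

/-- Vertical paths of vertical edges and vertical paths of squares, under componentwise
horizontal composition. -/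
def pathCat (X : CatGraph.{u}) : CatStr X.v₀.Path X.v₁.Path where
  src := Gph.Path.map X.hsrc
  tgt := Gph.Path.map X.htgt
  one := Gph.Path.map X.hone
  src_one p := by
    refine Gph.Path.ext (X.h₀.src_one _) ?_
    change (p.edges.map X.h₁.one).map X.h₁.src = p.edges
    rw [List.map_map, show X.h₁.src ∘ X.h₁.one = _root_.id from funext X.h₁.src_one, List.map_id]
  tgt_one p := by
    refine Gph.Path.ext (X.h₀.tgt_one _) ?_
    change (p.edges.map X.h₁.one).map X.h₁.tgt = p.edges
    rw [List.map_map, show X.h₁.tgt ∘ X.h₁.one = _root_.id from funext X.h₁.tgt_one, List.map_id]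
  comp p q h :=
    ⟨X.h₀.comp p.start q.start (congrArg Gph.Path.start h),
      X.h₁.zip p.edges q.edges (congrArg Gph.Path.edges h), X.zip_isPath p.isPath q.isPath _ _⟩
  src_comp p q h := Gph.Path.ext (X.h₀.src_comp _ _ _) (X.h₁.map_src_zip _ _ _)
  tgt_comp p q h := Gph.Path.ext (X.h₀.tgt_comp _ _ _) (X.h₁.map_tgt_zip _ _ _)
  one_comp p h := Gph.Path.ext (X.h₀.one_comp _ _) (X.h₁.one_zip _ _)
  comp_one p h := Gph.Path.ext (X.h₀.comp_one _ _) (X.h₁.zip_one _ _)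
  assoc p q r h₁ h₂ h₃ h₄ :=
    Gph.Path.ext (X.h₀.assoc _ _ _ _ _ _ _) (X.h₁.zip_assoc _ _ _ _ _ _ _)

/-- `M̄` on objects: the free category monad applied to the graphs of objects and of arrows. -/
def pathObj (X : CatGraph.{u}) : CatGraph.{u} where
  Obj := X.Obj
  Hor := X.Hor
  Ver := X.v₀.Path
  Sq := X.v₁.Path
  v₀ := X.v₀.pathGph
  v₁ := X.v₁.pathGph
  h₀ := X.h₀
  h₁ := X.pathCat
  vsrc := ⟨fun _ => rfl, fun _ => rfl, fun _ => rfl, fun _ _ _ _ => rfl⟩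
  vtgt := ⟨fun p => (X.hsrc.endpt p.start p.edges).symm,
    fun p => (X.htgt.endpt p.start p.edges).symm,
    fun p => X.hone.endpt p.start p.edges,
    fun p q _ h' => X.zip_endpt p.start q.start p.edges q.edges _ _ h'⟩

/-- `M̄` on internal functors. -/
def pathMap {X Y : CatGraph.{u}} (F : X ⟶ Y) : X.pathObj ⟶ Y.pathObj where
  obj := F.obj
  hor := F.hor
  ver := Gph.Path.map F.map_v₀
  sq := Gph.Path.map F.map_v₁
  map_v₀ := F.map_v₀.path
  map_v₁ := F.map_v₁.path
  map_h₀ := F.map_h₀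
  map_h₁ := by
    refine ⟨fun p => ?_, fun p => ?_, fun p => ?_, fun p q h h' => ?_⟩
    · refine Gph.Path.ext (F.map_h₀.src _) ?_
      change (p.edges.map F.sq).map Y.h₁.src = (p.edges.map X.h₁.src).map F.ver
      simp only [List.map_map]
      exact congrArg (fun k => p.edges.map k) (funext F.map_h₁.src)
    · refine Gph.Path.ext (F.map_h₀.tgt _) ?_
      change (p.edges.map F.sq).map Y.h₁.tgt = (p.edges.map X.h₁.tgt).map F.ver
      simp only [List.map_map]
      exact congrArg (fun k => p.edges.map k) (funext F.map_h₁.tgt)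
    · refine Gph.Path.ext (F.map_h₀.one _) ?_
      change (p.edges.map X.h₁.one).map F.sq = (p.edges.map F.ver).map Y.h₁.one
      simp only [List.map_map]
      exact congrArg (fun k => p.edges.map k) (funext F.map_h₁.one)
    · exact Gph.Path.ext (F.map_h₀.comp _ _ _ _) (F.map_h₁.map_zip _ _ _ _)

theorem flat_zip (X : CatGraph.{u}) (l l' : List X.v₁.Path)
    (h : l.map X.pathCat.tgt = l'.map X.pathCat.src)
    (h' : (l.flatMap Gph.Path.edges).map X.h₁.tgt = (l'.flatMap Gph.Path.edges).map X.h₁.src) :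
    (X.pathCat.zip l l' h).flatMap Gph.Path.edges =
      X.h₁.zip (l.flatMap Gph.Path.edges) (l'.flatMap Gph.Path.edges) h' := by
  induction l generalizing l' with
  | nil => cases l' with
    | nil => rfl
    | cons b l' => cases h
  | cons a l ih => cases l' with
    | nil => cases h
    | cons b l' =>
      obtain ⟨hab, hl⟩ := List.cons.inj h
      have e : a.edges.map X.h₁.tgt = b.edges.map X.h₁.src := congrArg Gph.Path.edges hab
      have e' : (l.flatMap Gph.Path.edges).map X.h₁.tgt =
          (l'.flatMap Gph.Path.edges).map X.h₁.src := by
        have h'' := h'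
        rw [List.flatMap_cons, List.flatMap_cons, List.map_append, List.map_append, e] at h''
        exact List.append_cancel_left h''
      exact (congrArg (X.h₁.zip a.edges b.edges e ++ ·) (ih l' hl e')).trans
        (X.h₁.zip_append a.edges _ b.edges _ e e' h').symm

/-- The unit of `M̄`. -/
def pathUnit (X : CatGraph.{u}) : X ⟶ X.pathObj where
  obj x := x
  hor f := f
  ver := X.v₀.single
  sq := X.v₁.single
  map_v₀ := X.v₀.single_isHom
  map_v₁ := X.v₁.single_isHom
  map_h₀ := CatStr.IsFunctor.id _
  map_h₁ := ⟨fun α => Gph.Path.ext (X.vsrc.src α) rfl,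
    fun α => Gph.Path.ext (X.vsrc.tgt α) rfl,
    fun j => Gph.Path.ext (X.vsrc.one j) rfl,
    fun α β h h' => Gph.Path.ext (X.vsrc.comp α β h (congrArg Gph.Path.start h')) rfl⟩

theorem flat_map {V E V' E' : Type u} {G : Gph V E} {H : Gph V' E'} {f₀ : V → V'} {f₁ : E → E'}
    (hf : Gph.IsHom G H f₀ f₁) (p : G.pathGph.Path) :
    H.flat (Gph.Path.map hf.path p) = Gph.Path.map hf (G.flat p) := by
  refine Gph.Path.ext rfl ?_
  change (p.edges.map (Gph.Path.map hf)).flatMap Gph.Path.edges =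
    (p.edges.flatMap Gph.Path.edges).map f₁
  rw [List.flatMap_map, List.map_flatMap]
  rfl

theorem _root_.DoubleCat.Gph.flat_flat {V E : Type u} (G : Gph V E) (l : List G.pathGph.Path) :
    (l.map G.flat).flatMap Gph.Path.edges =
      (l.flatMap Gph.Path.edges).flatMap Gph.Path.edges := by
  rw [List.flatMap_map, List.flatMap_assoc]; rfl

/-- The multiplication of `M̄`. -/
def pathMul (X : CatGraph.{u}) : X.pathObj.pathObj ⟶ X.pathObj where
  obj x := x
  hor f := f
  ver := X.v₀.flat
  sq := X.v₁.flat
  map_v₀ := X.v₀.flat_isHom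
  map_v₁ := X.v₁.flat_isHom
  map_h₀ := CatStr.IsFunctor.id _
  map_h₁ := by
    refine ⟨fun p => (flat_map X.hsrc p).symm, fun p => (flat_map X.htgt p).symm,
      fun p => flat_map X.hone p, fun p q h h' => Gph.Path.ext rfl ?_⟩
    exact X.flat_zip p.edges q.edges (congrArg Gph.Path.edges h) (congrArg Gph.Path.edges h')

end CatGraph

open CatGraph in
/-- The monad `M̄` on internal categories in graphs induced by the free category monad. -/
def Mbar : Monad CatGraph.{u} where
  obj := pathObj
  map := pathMap
  map_id X := CatGraph.Hom.ext rfl rfl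
    (funext fun p => Gph.Path.ext rfl (List.map_id _))
    (funext fun p => Gph.Path.ext rfl (List.map_id _))
  map_comp F G := CatGraph.Hom.ext rfl rfl
    (funext fun p => Gph.Path.ext rfl (List.map_map (f := F.ver) (g := G.ver)).symm)
    (funext fun p => Gph.Path.ext rfl (List.map_map (f := F.sq) (g := G.sq)).symm)
  η :=
    { app := pathUnit
      naturality := fun X Y F => CatGraph.Hom.ext rfl rfl
        (funext fun j => Gph.Path.ext (F.map_v₀.src j) rfl)
        (funext fun j => Gph.Path.ext (F.map_v₁.src j) rfl) }
  μ :=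
    { app := pathMul
      naturality := fun X Y F => CatGraph.Hom.ext rfl rfl
        (funext fun p => flat_map F.map_v₀ p) (funext fun p => flat_map F.map_v₁ p) }
  assoc X := CatGraph.Hom.ext rfl rfl
    (funext fun p => Gph.Path.ext rfl (X.v₀.flat_flat p.edges))
    (funext fun p => Gph.Path.ext rfl (X.v₁.flat_flat p.edges))
  left_unit X := CatGraph.Hom.ext rfl rfl
    (funext fun p => Gph.Path.ext rfl (List.append_nil _))
    (funext fun p => Gph.Path.ext rfl (List.append_nil _))
  right_unit X := CatGraph.Hom.ext rfl rfl
    (funext fun p => Gph.Path.ext rfl (by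
      change (p.edges.map X.v₀.single).flatMap Gph.Path.edges = p.edges
      rw [List.flatMap_map]
      exact List.flatMap_singleton' _))
    (funext fun p => Gph.Path.ext rfl (by
      change (p.edges.map X.v₁.single).flatMap Gph.Path.edges = p.edges
      rw [List.flatMap_map]
      exact List.flatMap_singleton' _))

namespace CatGraph.Trans

theorem zip_naturality {X Y : CatGraph.{u}} {F G : X ⟶ Y} (θ : Trans F G) (l : List X.Sq)
    (h : (l.map F.sq).map Y.h₁.tgt = ((l.map X.h₁.tgt).map θ.ve).map Y.h₁.src)
    (h' : ((l.map X.h₁.src).map θ.ve).map Y.h₁.tgt = (l.map G.sq).map Y.h₁.src) :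
    Y.h₁.zip (l.map F.sq) ((l.map X.h₁.tgt).map θ.ve) h =
      Y.h₁.zip ((l.map X.h₁.src).map θ.ve) (l.map G.sq) h' := by
  induction l with
  | nil => rfl
  | cons a l ih =>
    exact congrArg₂ List.cons (θ.naturality_ve a (List.cons.inj h).1 (List.cons.inj h').1)
      (ih (List.cons.inj h).2 (List.cons.inj h').2)

/-- `M̄` on 2-cells. -/
def path {X Y : CatGraph.{u}} {F G : X ⟶ Y} (θ : Trans F G) :
    Trans (Mbar.map F) (Mbar.map G) where
  ob := θ.ob
  ve := Gph.Path.map θ.isHom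
  isHom := θ.isHom.path
  src_ob := θ.src_ob
  tgt_ob := θ.tgt_ob
  src_ve p := by
    refine Gph.Path.ext (θ.src_ob _) ?_
    change (p.edges.map θ.ve).map Y.h₁.src = p.edges.map F.ver
    rw [List.map_map]
    exact congrArg (fun k => p.edges.map k) (funext θ.src_ve)
  tgt_ve p := by
    refine Gph.Path.ext (θ.tgt_ob _) ?_
    change (p.edges.map θ.ve).map Y.h₁.tgt = p.edges.map G.ver
    rw [List.map_map]
    exact congrArg (fun k => p.edges.map k) (funext θ.tgt_ve)
  naturality_ob := θ.naturality_ob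
  naturality_ve p h h' := by
    refine Gph.Path.ext (θ.naturality_ob _ _ _) ?_
    obtain ⟨f, l, hl⟩ := p
    replace h := congrArg Gph.Path.edges h
    replace h' := congrArg Gph.Path.edges h'
    change (l.map F.sq).map Y.h₁.tgt = ((l.map X.h₁.tgt).map θ.ve).map Y.h₁.src at h
    change ((l.map X.h₁.src).map θ.ve).map Y.h₁.tgt = (l.map G.sq).map Y.h₁.src at h'
    change Y.h₁.zip (l.map F.sq) ((l.map X.h₁.tgt).map θ.ve) h =
      Y.h₁.zip ((l.map X.h₁.src).map θ.ve) (l.map G.sq) h'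
    exact θ.zip_naturality l h h'

end CatGraph.Trans

namespace CatGraph.Trans

variable {W X Y Z : CatGraph.{u}} {F G H F' G' : X ⟶ Y}

/-- The identity 2-cell between two internal functors that are equal. -/
def ofEq (h : F = G) : Trans F G := (Trans.id F).copy rfl h

theorem comp_id (θ : Trans F G) : θ.comp (Trans.id G) = θ :=
  Trans.ext (funext fun x => Y.h₀.comp_one' (θ.tgt_ob x) _)
    (funext fun j => Y.h₁.comp_one' (θ.tgt_ve j) _)

theorem ofEq_comp (h : F = G) (h' : G = H) : (ofEq h).comp (ofEq h') = ofEq (h.trans h') := by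
  subst h; subst h'; exact comp_id _

theorem ofEq_copy (h : F = G) (hF : F = F') (hG : G = G') :
    (ofEq h).copy hF hG = ofEq (hF.symm.trans (h.trans hG)) := by
  subst h; subst hF; subst hG; rfl

theorem ofEq_whiskerLeft (h : F = G) (K : W ⟶ X) :
    (ofEq h).whiskerLeft K = ofEq (congrArg (K ≫ ·) h) := by
  subst h; rfl

theorem ofEq_whiskerRight (h : F = G) (K : Y ⟶ Z) :
    (ofEq h).whiskerRight K = ofEq (congrArg (· ≫ K) h) := by
  subst h
  exact Trans.ext (funext fun x => K.map_h₀.one _) (funext fun j => K.map_h₁.one _)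

theorem ofEq_path (h : F = G) : (ofEq h).path = ofEq (congrArg Mbar.map h) := by
  subst h
  refine Trans.ext rfl (funext fun p => Gph.Path.ext rfl ?_)
  exact (List.map_map (f := F.ver) (g := Y.h₁.one) (l := p.edges)).symm

theorem ofEq_isInvertible (h : F = G) : (ofEq h).IsInvertible := by
  subst h; exact ⟨ofEq rfl, ofEq_comp _ _, ofEq_comp _ _⟩

theorem IsInvertible.copy {θ : Trans F G} (h : θ.IsInvertible) (hF : F = F') (hG : G = G') :
    (θ.copy hF hG).IsInvertible := by
  subst hF; subst hG; exact h

theorem comp_whiskerRight (θ : Trans F G) (ψ : Trans G H) (K : Y ⟶ Z) :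
    (θ.comp ψ).whiskerRight K = (θ.whiskerRight K).comp (ψ.whiskerRight K) :=
  Trans.ext (funext fun _ => K.map_h₀.comp _ _ _ _) (funext fun _ => K.map_h₁.comp _ _ _ _)

theorem IsInvertible.whiskerRight {θ : Trans F G} (h : θ.IsInvertible) (K : Y ⟶ Z) :
    (θ.whiskerRight K).IsInvertible := by
  obtain ⟨ψ, h₁, h₂⟩ := h
  refine ⟨ψ.whiskerRight K, ?_, ?_⟩
  · rw [← comp_whiskerRight, h₁]; exact ofEq_whiskerRight rfl K
  · rw [← comp_whiskerRight, h₂]; exact ofEq_whiskerRight rfl K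

end CatGraph.Trans

/-! ### Pseudo morphisms and flexible algebras -/

open CatGraph

/-- A pseudo morphism of strict `M̄`-algebras: an internal functor `F` together with an invertible
2-cell `φ : b ∘ M̄ F ⇒ F ∘ a` compatible with the unit and the multiplication. -/
@[ext]
structure PseudoHom (A B : Mbar.{u}.Algebra) where
  hom : A.A ⟶ B.A
  cell : Trans (Mbar.map hom ≫ B.a) (A.a ≫ hom)
  isInvertible : cell.IsInvertible
  unit : (cell.whiskerLeft (W := A.A) (Mbar.η.app A.A)).copy
      (by rw [← Category.assoc, ← Mbar.unit_naturality, Category.assoc, B.unit, Category.comp_id])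
      (by rw [← Category.assoc, A.unit]; exact Category.id_comp _) = Trans.id hom
  mul : cell.whiskerLeft (W := Mbar.obj (Mbar.obj A.A)) (Mbar.μ.app A.A) =
    (((cell.path).whiskerRight B.a).comp ((cell.whiskerLeft (Mbar.map A.a)).copy
      (by rw [Functor.map_comp, Category.assoc]) rfl)).copy
      (by rw [Functor.map_comp, Category.assoc, ← B.assoc, ← Category.assoc, Mbar.mu_naturality,
        Category.assoc])
      (by rw [← Category.assoc, ← A.assoc, Category.assoc])

namespace PseudoHom

variable {A B C : Mbar.{u}.Algebra}

/-- A 2-cell between pseudo morphisms of strict algebras. -/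
@[ext]
structure TwoCell (P Q : PseudoHom A B) where
  trans : Trans P.hom Q.hom
  compat : P.cell.comp (trans.whiskerLeft A.a) = (trans.path.whiskerRight B.a).comp Q.cell

/-- A strict morphism, regarded as a pseudo morphism with identity 2-cell. -/
def ofStrict (F : A ⟶ B) : PseudoHom A B where
  hom := F.f
  cell := Trans.ofEq F.h
  isInvertible := Trans.ofEq_isInvertible _
  unit := by
    rw [Trans.ofEq_whiskerLeft, Trans.ofEq_copy]; rfl
  mul := by
    rw [Trans.ofEq_whiskerLeft, Trans.ofEq_whiskerLeft, Trans.ofEq_copy, Trans.ofEq_path,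
      Trans.ofEq_whiskerRight, Trans.ofEq_comp, Trans.ofEq_copy]

/-- Composite of a pseudo morphism with a strict morphism. -/
def compStrict (P : PseudoHom A B) (G : B ⟶ C) : PseudoHom A C where
  hom := P.hom ≫ G.f
  cell := (P.cell.whiskerRight G.f).copy
    (by rw [Category.assoc, ← G.h, Functor.map_comp, Category.assoc]) (Category.assoc _ _ _)
  isInvertible := (P.isInvertible.whiskerRight G.f).copy _ _
  unit := by
    refine Trans.ext (funext fun x => ?_) (funext fun j => ?_)
    · exact (congrArg G.f.hor (congrFun (congrArg Trans.ob P.unit) x)).trans (G.f.map_h₀.one _)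
    · exact (congrArg G.f.sq (congrFun (congrArg Trans.ve P.unit) j)).trans (G.f.map_h₁.one _)
  mul := by
    refine Trans.ext (funext fun x => ?_) (funext fun p => ?_)
    · refine (congrArg G.f.hor (congrFun (congrArg Trans.ob P.mul) x)).trans ?_
      exact (G.f.map_h₀.map_comp _ _ _).trans
        (C.A.h₀.comp_congr (congrFun (congrArg CatGraph.Hom.hor G.h) _).symm rfl _ _)
    · refine (congrArg G.f.sq (congrFun (congrArg Trans.ve P.mul) p)).trans ?_
      refine (G.f.map_h₁.map_comp _ _ _).trans (C.A.h₁.comp_congr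
        ((congrFun (congrArg CatGraph.Hom.sq G.h) _).symm.trans (congrArg C.a.sq ?_)) rfl _ _)
      exact Gph.Path.ext rfl (List.map_map (f := P.cell.ve) (g := G.f.sq) (l := p.edges))

/-- The pseudo morphism `p : A ⇝ A'` exhibits `A'` as the value at `A` of a left 2-adjoint to the
inclusion of strict algebras and strict morphisms into strict algebras and pseudo morphisms:
for each algebra `B`, composition with `p` is an isomorphism from the category of strict
morphisms `A' → B` to the category of pseudo morphisms `A ⇝ B`. -/
structure IsStrictClassifier {A A' : Mbar.{u}.Algebra} (p : PseudoHom A A') : Prop where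
  bijective_obj : ∀ (B : Mbar.{u}.Algebra) (P : PseudoHom A B),
    ∃! G : A' ⟶ B, p.compStrict G = P
  bijective_map : ∀ (B : Mbar.{u}.Algebra) (G G' : A' ⟶ B)
    (β : TwoCell (p.compStrict G) (p.compStrict G')),
    ∃! α : TwoCell (ofStrict G) (ofStrict G'), α.trans.whiskerLeft p.hom = β.trans

end PseudoHom

/-- A strict `M̄`-algebra `A` is flexible if the counit `q : A' → A` at `A` of the left 2-adjoint
`A ↦ A'` to the inclusion of strict algebras and strict morphisms into strict algebras and pseudo
morphisms has a section which is a strict morphism. The counit is the strict morphism whose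
composite with the universal pseudo morphism `p : A ⇝ A'` is the identity. -/
def IsFlexible (A : Mbar.{u}.Algebra) : Prop :=
  ∃ (A' : Mbar.{u}.Algebra) (p : PseudoHom A A'), p.IsStrictClassifier ∧
    ∃ q : A' ⟶ A, p.compStrict q = PseudoHom.ofStrict (𝟙 A) ∧ ∃ s : A ⟶ A', s ≫ q = 𝟙 A

/-! ### Double categories as `M̄`-algebras -/

namespace CatStr

variable {O A O' A' : Type u}

/-- The composite of a path of arrows. -/
def compPath (C : CatStr O A) : (v : O) → (l : List A) → C.IsPath v l →
    { a : A // C.src a = v ∧ C.tgt a = C.endpt v l }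
  | v, [], _ => ⟨C.one v, C.src_one v, C.tgt_one v⟩
  | _, a :: l, h =>
    ⟨C.comp a (C.compPath (C.tgt a) l h.2).1 (C.compPath (C.tgt a) l h.2).2.1.symm,
      (C.src_comp _ _ _).trans h.1, (C.tgt_comp _ _ _).trans (C.compPath (C.tgt a) l h.2).2.2⟩

theorem compPath_congr (C : CatStr O A) {v v' : O} {l l' : List A} (hv : v = v') (hl : l = l')
    (h : C.IsPath v l) (h' : C.IsPath v' l') :
    (C.compPath v l h).1 = (C.compPath v' l' h').1 := by
  subst hv; subst hl; rfl

theorem IsFunctor.isHom {C : CatStr O A} {D : CatStr O' A'} {f₀ : O → O'} {f₁ : A → A'}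
    (hf : IsFunctor C D f₀ f₁) : Gph.IsHom C.toGph D.toGph f₀ f₁ := ⟨hf.src, hf.tgt⟩

theorem IsFunctor.compPath {C : CatStr O A} {D : CatStr O' A'} {f₀ : O → O'} {f₁ : A → A'}
    (hf : IsFunctor C D f₀ f₁) (v : O) (l : List A) (h : C.IsPath v l)
    (h' : D.IsPath (f₀ v) (l.map f₁)) :
    f₁ (C.compPath v l h).1 = (D.compPath (f₀ v) (l.map f₁) h').1 := by
  induction l generalizing v with
  | nil => exact hf.one v
  | cons a l ih =>
    refine (hf.map_comp _ _ _).trans (D.comp_congr rfl ?_ _ _)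
    have k : D.IsPath (f₀ (C.tgt a)) (l.map f₁) := hf.isHom.isPath h.2
    exact (ih _ h.2 k).trans (D.compPath_congr (hf.tgt a).symm rfl _ _)

theorem compPath_append (C : CatStr O A) (v : O) (l l' : List A) (h : C.IsPath v (l ++ l'))
    (h₁ : C.IsPath v l) (h₂ : C.IsPath (C.endpt v l) l')
    (k : C.tgt (C.compPath v l h₁).1 = C.src (C.compPath _ l' h₂).1) :
    (C.compPath v (l ++ l') h).1 = C.comp (C.compPath v l h₁).1 (C.compPath _ l' h₂).1 k := by
  induction l generalizing v with
  | nil => exact (C.one_comp' (C.compPath v l' h₂).2.1 _).symm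
  | cons a l ih =>
    have e : C.tgt (C.compPath (C.tgt a) l h₁.2).1 =
        C.src (C.compPath (C.endpt (C.tgt a) l) l' h₂).1 := by
      rw [(C.compPath (C.tgt a) l h₁.2).2.2, (C.compPath (C.endpt (C.tgt a) l) l' h₂).2.1]
    exact (C.comp_congr rfl (ih _ h.2 h₁.2 h₂ e) _
      (by rw [C.src_comp, (C.compPath (C.tgt a) l h₁.2).2.1])).trans
      (C.assoc _ _ _ _ _ _ _).symm

theorem compPath_flat (C : CatStr O A) (v : O) (l : List C.Path) (h : C.pathGph.IsPath v l)
    (h₁ : C.IsPath v (l.flatMap Gph.Path.edges))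
    (h₂ : C.IsPath v (l.map fun p => (C.compPath p.start p.edges p.isPath).1)) :
    (C.compPath v (l.flatMap Gph.Path.edges) h₁).1 = (C.compPath v _ h₂).1 := by
  induction l generalizing v with
  | nil => rfl
  | cons p l ih =>
    obtain ⟨rfl, h⟩ := h
    have k := (C.isPath_append p.start p.edges (l.flatMap Gph.Path.edges)).1 h₁
    have e : C.tgt (C.compPath p.start p.edges k.1).1 =
        C.src (C.compPath _ (l.flatMap Gph.Path.edges) k.2).1 := by
      rw [(C.compPath p.start p.edges k.1).2.2, (C.compPath _ _ k.2).2.1]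
    refine (C.compPath_append p.start p.edges _ h₁ k.1 k.2 e).trans
      (C.comp_congr rfl ?_ _ _)
    have h₃ : C.IsPath (C.endpt p.start p.edges)
        (l.map fun p => (C.compPath p.start p.edges p.isPath).1) := by
      have := h₂.2
      rwa [(C.compPath p.start p.edges p.isPath).2.2] at this
    exact (ih _ h k.2 h₃).trans
      (C.compPath_congr (C.compPath p.start p.edges p.isPath).2.2.symm rfl _ _)

end CatStr

namespace DblCat

/-- The forgetful functor `Ū` on objects: forget vertical composition and identities. -/
def toCatGraph (X : DblCat.{u}) : CatGraph.{u} where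
  Obj := X.Obj
  Hor := X.Hor
  Ver := X.Ver
  Sq := X.Sq
  v₀ := X.v₀.toGph
  v₁ := X.v₁.toGph
  h₀ := X.h₀
  h₁ := X.h₁
  vsrc := X.vsrc
  vtgt := X.vtgt

theorem compPath_zip (X : DblCat.{u}) (f g : X.Hor) (l l' : List X.Sq)
    (h : X.h₀.tgt f = X.h₀.src g) (hz : l.map X.h₁.tgt = l'.map X.h₁.src)
    (hl : X.v₁.IsPath f l) (hl' : X.v₁.IsPath g l')
    (hp : X.v₁.IsPath (X.h₀.comp f g h) (X.h₁.zip l l' hz))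
    (k : X.h₁.tgt (X.v₁.compPath f l hl).1 = X.h₁.src (X.v₁.compPath g l' hl').1) :
    (X.v₁.compPath (X.h₀.comp f g h) (X.h₁.zip l l' hz) hp).1 =
      X.h₁.comp (X.v₁.compPath f l hl).1 (X.v₁.compPath g l' hl').1 k := by
  induction l generalizing l' f g with
  | nil => cases l' with
    | nil => exact (X.vone.map_comp f g h).trans (X.h₁.comp_congr rfl rfl _ _)
    | cons b l' => cases hz
  | cons a l ih => cases l' with
    | nil => cases hz
    | cons b l' =>
      have hab : X.h₁.tgt a = X.h₁.src b := (List.cons.inj hz).1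
      have hz' : l.map X.h₁.tgt = l'.map X.h₁.src := (List.cons.inj hz).2
      have t : X.v₁.tgt (X.h₁.comp a b hab) =
          X.h₀.comp (X.v₁.tgt a) (X.v₁.tgt b) (X.vtgt.tgt_eq_src hab) := X.vtgt.map_comp a b hab
      have hp' : X.v₁.IsPath (X.h₀.comp (X.v₁.tgt a) (X.v₁.tgt b) (X.vtgt.tgt_eq_src hab))
          (X.h₁.zip l l' hz') := X.toCatGraph.zip_isPath hl.2 hl'.2 _ _
      have k' : X.h₁.tgt (X.v₁.compPath (X.v₁.tgt a) l hl.2).1 =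
          X.h₁.src (X.v₁.compPath (X.v₁.tgt b) l' hl'.2).1 := by
        rw [X.htgt.compPath _ _ _ (X.htgt.isHom.isPath hl.2),
          X.hsrc.compPath _ _ _ (X.hsrc.isHom.isPath hl'.2)]
        exact X.v₀.compPath_congr (X.vtgt.tgt_eq_src hab) hz' _ _
      refine (X.v₁.comp_congr rfl ((X.v₁.compPath_congr t rfl _ hp').trans
        (ih _ _ _ (X.vtgt.tgt_eq_src hab) hz' hl.2 hl'.2 hp' k')) _ ?_).trans
        (X.interchange a b _ _ hab k' (X.v₁.compPath _ l hl.2).2.1.symm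
          (X.v₁.compPath _ l' hl'.2).2.1.symm _ _)
      rw [t, X.vsrc.map_comp]
      exact X.h₀.comp_congr (X.v₁.compPath _ l hl.2).2.1.symm
        (X.v₁.compPath _ l' hl'.2).2.1.symm _ _

/-- The action `M̄ Ū X → Ū X` composing vertical paths of vertical morphisms and of squares. -/
def action (X : DblCat.{u}) : Mbar.obj X.toCatGraph ⟶ X.toCatGraph where
  obj x := x
  hor f := f
  ver p := (X.v₀.compPath p.start p.edges p.isPath).1
  sq p := (X.v₁.compPath p.start p.edges p.isPath).1
  map_v₀ := ⟨fun p => (X.v₀.compPath p.start p.edges p.isPath).2.1,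
    fun p => (X.v₀.compPath p.start p.edges p.isPath).2.2⟩
  map_v₁ := ⟨fun p => (X.v₁.compPath p.start p.edges p.isPath).2.1,
    fun p => (X.v₁.compPath p.start p.edges p.isPath).2.2⟩
  map_h₀ := CatStr.IsFunctor.id _
  map_h₁ := ⟨fun _ => X.hsrc.compPath _ _ _ _, fun _ => X.htgt.compPath _ _ _ _,
    fun _ => (X.hone.compPath _ _ _ _).symm,
    fun p q _ h' => X.compPath_zip _ _ _ _ _ _ p.isPath q.isPath _ h'⟩

/-- The strict `M̄`-algebra given by a double category. -/
def toAlgebra (X : DblCat.{u}) : Mbar.{u}.Algebra where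
  A := X.toCatGraph
  a := X.action
  unit := CatGraph.Hom.ext rfl rfl
    (funext fun _ => X.v₀.comp_one _ _) (funext fun _ => X.v₁.comp_one _ _)
  assoc := CatGraph.Hom.ext rfl rfl
    (funext fun p => X.v₀.compPath_flat _ _ p.isPath _ _)
    (funext fun p => X.v₁.compPath_flat _ _ p.isPath _ _)

end DblCat

end DoubleCat

namespace DoubleCat

/-! ### Epimorphisms of `τ'`-sheaves as functors with a full section -/

namespace DblCat

/-! Cofibrancy and flexibility of `X` are each equivalent to freeness of the vertical category
`X.v₀`, and both equivalences come from one double functor, `pathProj : X.pathDbl ⟶ X`. Here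
`pathDbl` keeps the objects and horizontal morphisms of `X`, takes paths of vertical morphisms as
its vertical morphisms, and takes the squares of `X` between composites of paths as its squares.

Cofibrancy. A functor is `τ'`-epi exactly when it is full over some choice of preimages of the
objects (`CatStr.IsFunctor.isTEpi_iff`). An acyclic fibration is therefore fully faithful, and its
vertical functor admits such a choice (`hasFullSection_of_acyclicFibration`). If `X.v₀` is free, a
double functor out of `X` lifts through it: by the choice on objects, generator by generator on
vertical morphisms, and then uniquely on horizontal morphisms and squares. Conversely `pathProj` is
an acyclic fibration, so for cofibrant `X` it has a section, which decomposes vertical morphisms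
functorially into paths. Such a decomposition forces freeness (`isFree_of_section`): discard
identities and count lengths; the generators are the arrows that decompose into themselves alone.

Flexibility. `pathDbl` is a model of the classifier `X'`, with counit `pathProj`
(`pathUnit_isStrictClassifier`). Every square of `pathDbl` is its underlying cell conjugated by
invertible comparison squares, so a pseudo morphism out of `X` has exactly one strict extension;
2-cells extend by a cube argument. A strict section of the counit is thus a section of `pathProj`,
and the same criterion for freeness applies. -/

theorem isTEpi_iff_covering {J : GrothendieckTopology Cat.{u, u}} {E B : Cat.{u, u}} (p : E ⟶ B) :
    IsTEpi J p ↔ Sieve.generate (Presieve.singleton p) ∈ J B := by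
  unfold IsTEpi
  rw [← Sheaf.isLocallySurjective_iff_epi', Presheaf.isLocallySurjective_presheafToSheaf_map_iff]
  constructor
  · intro h
    -- Local surjectivity is tested on the generic element `𝟙 B`, whose image sieve consists of the
    -- functors that factor through `p`.
    have := h.imageSieve_mem (U := B) (ULift.up (𝟙 B))
    refine J.superset_covering ?_ this
    rintro Z f ⟨t, ht⟩
    refine ⟨E, t.down, p, ⟨⟩, ?_⟩
    have := congrArg ULift.down ht
    change t.down ≫ p = f ≫ 𝟙 B at this
    rw [this, Category.comp_id]
  · intro h
    refine ⟨fun {U} s => ?_⟩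
    -- The image sieve of an element `s` contains the pullback along `s` of the sieve generated by
    -- `p`.
    refine J.superset_covering ?_ (J.pullback_stable s.down h)
    rintro Z f ⟨W, g, _, ⟨⟩, hg⟩
    exact ⟨ULift.up g, congrArg ULift.up hg⟩

end DblCat

open DblCat

/-- The functor `(f₀, f₁)` is full on some full subcategory that it maps onto the objects. -/
def CatStr.HasFullSection {O A O' A' : Type u} (C : CatStr O A) (D : CatStr O' A')
    (f₀ : O → O') (f₁ : A → A') : Prop :=
  ∃ σ : O' → O, (∀ y, f₀ (σ y) = y) ∧
    ∀ b, ∃ a, C.src a = σ (D.src b) ∧ C.tgt a = σ (D.tgt b) ∧ f₁ a = b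

/-- A covering sieve generated by `p` contains a full functor `g ≫ p` that is surjective on objects;
the `g`-images of chosen preimages give `σ`, and fullness is needed only between these preimages.
Conversely, the full subcategory of `C` spanned by the values of `σ`, indexed by the objects of `D`,
maps fully and surjectively to `D`. -/
theorem CatStr.IsFunctor.isTEpi_iff {O A O' A' : Type u} {C : CatStr O A} {D : CatStr O' A'}
    {f₀ : O → O'} {f₁ : A → A'} (hf : IsFunctor C D f₀ f₁) :
    IsTEpi tauPrime hf.toCatHom ↔ HasFullSection C D f₀ f₁ := by
  rw [isTEpi_iff_covering]
  constructor
  · rintro ⟨Z, q, ⟨W, g, _, ⟨⟩, hg⟩, hs, hfull⟩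
    subst hg
    choose τ hτ using hs
    refine ⟨fun y => g.toFunctor.obj (τ y), hτ, fun b => ?_⟩
    obtain ⟨k, hk⟩ := hfull.map_surjective (X := τ (D.src b)) (Y := τ (D.tgt b))
      ⟨b, (hτ _).symm, (hτ _).symm⟩
    exact ⟨(g.toFunctor.map k).1, (g.toFunctor.map k).2.1, (g.toFunctor.map k).2.2,
      congrArg Subtype.val hk⟩
  · rintro ⟨σ, hσ, hfull⟩
    let τ : O' → C.El := σ
    let g : Cat.of (InducedCategory C.El τ) ⟶ C.toCat :=
      Functor.toCatHom (D := C.El) (inducedFunctor τ)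
    refine ⟨Cat.of (InducedCategory C.El τ), g ≫ hf.toCatHom, ⟨_, g, _, ⟨⟩, rfl⟩,
      fun y => ⟨(y : O'), hσ y⟩, ⟨?_⟩⟩
    rintro (x : O') (y : O') ⟨b, hb, hb'⟩
    obtain ⟨a, ha, ha', e⟩ := hfull b
    have hx : D.src b = x := hb.trans (hσ x)
    have hy : D.tgt b = y := hb'.trans (hσ y)
    exact ⟨InducedCategory.homMk (F := τ) (X := x) (Y := y)
      ⟨a, ha.trans (congrArg σ hx), ha'.trans (congrArg σ hy)⟩, Subtype.ext e⟩

/-! ### Free categories: recognition and mapping out -/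

namespace CatStr

variable {O A O' A' : Type u}

/-- A category is free on a set of arrows if every arrow is, in a unique way, the composite of a
path of arrows of that set. -/
def IsFree (C : CatStr O A) : Prop :=
  ∃ S : Set A, ∀ a, ∃! l : List A,
    (∀ b ∈ l, b ∈ S) ∧ ∃ h : C.IsPath (C.src a) l, (C.compPath _ l h).1 = a

/-- Such a `φ` is a functor from `C` to the free monoid of lists, so it turns composites into
concatenations. -/
theorem map_compPath_eq_flatMap (C : CatStr O A) {B : Type u} {φ : A → List B}
    (one : ∀ x, φ (C.one x) = []) (comp : ∀ a b h, φ (C.comp a b h) = φ a ++ φ b)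
    (v : O) (l : List A) (h : C.IsPath v l) : φ (C.compPath v l h).1 = l.flatMap φ := by
  induction l generalizing v with
  | nil => exact one v
  | cons a l ih => exact (comp _ _ _).trans (congrArg (φ a ++ ·) (ih _ h.2))

open Classical in
-- Identity edges do not affect a composite. Dropping them makes the decomposition of every
-- remaining edge nonempty, which the counting argument for freeness needs.
theorem exists_compPath_filter (C : CatStr O A) (v : O) (l : List A) (h : C.IsPath v l) :
    ∃ h' : C.IsPath v (l.filter fun a => a ≠ C.one (C.src a)),
      (C.compPath v _ h').1 = (C.compPath v l h).1 := by
  induction l generalizing v with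
  | nil => exact ⟨trivial, rfl⟩
  | cons a l ih =>
    obtain ⟨rfl, h⟩ := h
    by_cases ha : a = C.one (C.src a)
    · have ht : C.tgt a = C.src a := by
        conv_lhs => rw [ha]
        exact C.tgt_one _
      have key : ∃ h' : C.IsPath (C.src a) (l.filter fun a => a ≠ C.one (C.src a)),
          (C.compPath (C.src a) _ h').1 = (C.compPath (C.src a) (a :: l) ⟨rfl, h⟩).1 := by
        have h₀ : C.IsPath (C.src a) l := ht ▸ h
        obtain ⟨h', e⟩ := ih _ h₀
        refine ⟨h', e.trans ?_⟩
        refine (C.compPath_congr ht.symm rfl h₀ h).trans ?_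
        have hc : C.src (C.compPath _ l h).1 = C.src a := (C.compPath _ l h).2.1.trans ht
        exact (C.one_comp' hc ((C.tgt_one _).trans hc.symm)).symm.trans
          (C.comp_congr ha.symm rfl _ _)
      rw [List.filter_cons_of_neg (by simpa using ha)]
      exact key
    · obtain ⟨h', e⟩ := ih _ h
      have key : ∃ h' : C.IsPath (C.src a) (a :: l.filter fun a => a ≠ C.one (C.src a)),
          (C.compPath (C.src a) _ h').1 = (C.compPath (C.src a) (a :: l) ⟨rfl, h⟩).1 :=
        ⟨⟨rfl, h'⟩, C.comp_congr rfl e _ _⟩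
      rw [List.filter_cons_of_pos (by simpa using ha)]
      exact key

theorem _root_.List.length_le_length_flatMap {α β : Type*} {f : α → List β} {l : List α}
    (h : ∀ a ∈ l, f a ≠ []) : l.length ≤ (l.flatMap f).length := by
  induction l with
  | nil => exact Nat.zero_le _
  | cons a l ih =>
    have := ih fun b hb => h b (List.mem_cons_of_mem _ hb)
    have := List.length_pos_of_ne_nil (h a List.mem_cons_self)
    simp only [List.length_cons, List.flatMap_cons, List.length_append]
    lia

/-- Each entry contributes at least one element, so a total that does not exceed the number of
entries leaves exactly one for each. -/
theorem _root_.List.length_eq_one_of_length_flatMap_le {α β : Type*} {f : α → List β} {l : List α}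
    (h : ∀ a ∈ l, f a ≠ []) (hl : (l.flatMap f).length ≤ l.length) :
    ∀ a ∈ l, (f a).length = 1 := by
  induction l with
  | nil => simp
  | cons a l ih =>
    have h' : ∀ b ∈ l, f b ≠ [] := fun b hb => h b (List.mem_cons_of_mem _ hb)
    have h₁ := List.length_le_length_flatMap h'
    have h₂ := List.length_pos_of_ne_nil (h a List.mem_cons_self)
    simp only [List.length_cons, List.flatMap_cons, List.length_append] at hl
    intro b hb
    rcases List.mem_cons.1 hb with rfl | hb
    · lia
    · exact ih h' (by lia) b hb

open Classical in
/-- A category is free if its arrows can be functorially decomposed into paths. -/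
theorem isFree_of_section (C : CatStr O A) (s : A → List A) (one : ∀ x, s (C.one x) = [])
    (comp : ∀ a b h, s (C.comp a b h) = s a ++ s b)
    (hs : ∀ a, ∃ h : C.IsPath (C.src a) (s a), (C.compPath _ _ h).1 = a) : C.IsFree := by
  -- The decomposition `s` may contain identities; `r` removes them and stays multiplicative, since
  -- filtering commutes with concatenation.
  let r : A → List A := fun a => (s a).filter fun b => b ≠ C.one (C.src b)
  have r_one : ∀ x, r (C.one x) = [] := fun x => by simp only [r, one, List.filter_nil]
  have r_comp : ∀ a b h, r (C.comp a b h) = r a ++ r b := fun a b h => by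
    simp only [r, comp, List.filter_append]
  have hr : ∀ a, ∃ h : C.IsPath (C.src a) (r a), (C.compPath _ _ h).1 = a := fun a => by
    obtain ⟨h, e⟩ := hs a
    obtain ⟨h', e'⟩ := C.exists_compPath_filter _ _ h
    exact ⟨h', e'.trans e⟩
  -- Decomposing the edges of `r a` once more gives `r a` back, because `a` is their composite. No
  -- edge `b` has an empty decomposition, since it would then be an identity. By counting, `r b` has
  -- a single entry, and that entry is its composite `b`.
  have mem_r : ∀ a, ∀ b ∈ r a, r b = [b] := by
    intro a
    have e : (r a).flatMap r = r a := by
      obtain ⟨h, e⟩ := hr a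
      rw [← C.map_compPath_eq_flatMap r_one r_comp _ _ h, e]
    have ne : ∀ b ∈ r a, r b ≠ [] := by
      intro b hb hb'
      have hb₀ : b ≠ C.one (C.src b) := of_decide_eq_true (List.mem_filter.1 hb).2
      obtain ⟨h, e⟩ := hr b
      refine hb₀ (e.symm.trans ?_)
      exact C.compPath_congr rfl hb' h trivial
    intro b hb
    obtain ⟨c, hc⟩ := List.length_eq_one_iff.1
      (List.length_eq_one_of_length_flatMap_le ne (by rw [e]) b hb)
    obtain ⟨h, e'⟩ := hr b
    rw [hc]
    have h' : C.IsPath (C.src b) [c] := hc ▸ h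
    have : (C.compPath (C.src b) [c] h').1 = c := C.comp_one _ _
    rw [← this, C.compPath_congr rfl hc.symm h' h, e']
  refine ⟨{ a | r a = [a] }, fun a => ⟨r a, ⟨mem_r a, hr a⟩, ?_⟩⟩
  rintro l ⟨hl, h, e⟩
  -- A list of generators is fixed by `flatMap r`, hence equals `r` of its composite. This gives
  -- uniqueness.
  have key : ∀ l : List A, (∀ b ∈ l, r b = [b]) → l.flatMap r = l := by
    intro l hl
    induction l with
    | nil => rfl
    | cons b l ih =>
      rw [List.flatMap_cons, hl b List.mem_cons_self,
        ih fun c hc => hl c (List.mem_cons_of_mem _ hc)]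
      rfl
  change l = r a
  rw [← key l hl, ← C.map_compPath_eq_flatMap r_one r_comp _ _ h, e]

/-- A morphism of graphs from a free category to a category determines a functor that agrees with
it on generators. -/
theorem IsFree.exists_functor {C : CatStr O A} (hC : C.IsFree) {D : CatStr O' A'} {f₀ : O → O'}
    {g : A → A'} (hg : Gph.IsHom C.toGph D.toGph f₀ g) :
    ∃ f₁, IsFunctor C D f₀ f₁ ∧ ∀ a, ∃ (l : List A) (h : C.IsPath (C.src a) l),
      (C.compPath _ l h).1 = a ∧ f₁ a = (D.compPath _ (l.map g) (hg.isPath h)).1 := by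
  obtain ⟨S, hS⟩ := hC
  choose l hl hu using hS
  choose hlS hp he using hl
  -- Uniqueness makes the decomposition `l` multiplicative, and functoriality of the extension
  -- follows from this.
  have l_one : ∀ x, l (C.one x) = [] := fun x =>
    (hu (C.one x) [] ⟨nofun, trivial, congrArg C.one (C.src_one x)⟩).symm
  have l_comp : ∀ a b h, l (C.comp a b h) = l a ++ l b := by
    intro a b h
    have end_a : C.endpt (C.src a) (l a) = C.src b := by
      rw [← (C.compPath _ _ (hp a)).2.2, he, h]
    have hp' : C.IsPath (C.src (C.comp a b h)) (l a ++ l b) := by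
      rw [C.src_comp, C.isPath_append, end_a]
      exact ⟨hp a, hp b⟩
    refine (hu _ _ ⟨?_, hp', ?_⟩).symm
    · intro c hc
      rcases List.mem_append.1 hc with hc | hc
      · exact hlS a c hc
      · exact hlS b c hc
    · have hp'' : C.IsPath (C.src a) (l a ++ l b) := by rwa [C.src_comp] at hp'
      have hb' : C.IsPath (C.endpt (C.src a) (l a)) (l b) := by
        rw [end_a]
        exact hp b
      have eb : (C.compPath _ _ hb').1 = b := (C.compPath_congr end_a rfl hb' (hp b)).trans (he b)
      rw [C.compPath_congr (C.src_comp a b h) rfl hp' hp'',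
        C.compPath_append _ _ _ hp'' (hp a) hb' (by rw [he, eb, h])]
      exact C.comp_congr (he a) eb _ _
  have hq : ∀ a, D.IsPath (f₀ (C.src a)) ((l a).map g) := fun a => hg.isPath (hp a)
  refine ⟨fun a => (D.compPath _ _ (hq a)).1, ⟨fun a => (D.compPath _ _ (hq a)).2.1, fun a => ?_,
    fun x => ?_, fun a b h h' => ?_⟩, fun a => ⟨l a, hp a, he a, rfl⟩⟩
  · rw [(D.compPath _ _ (hq a)).2.2, hg.endpt, ← (C.compPath _ _ (hp a)).2.2, he]
  · exact D.compPath_congr (congrArg f₀ (C.src_one x)) (congrArg (List.map g) (l_one x)) _ trivial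
  · have end_a : D.endpt (f₀ (C.src a)) ((l a).map g) = f₀ (C.src b) := by
      rw [hg.endpt, ← (C.compPath _ _ (hp a)).2.2, he, h]
    have hb' : D.IsPath (D.endpt (f₀ (C.src a)) ((l a).map g)) ((l b).map g) := by
      rw [end_a]
      exact hq b
    have hab : D.IsPath (f₀ (C.src a)) ((l a).map g ++ (l b).map g) :=
      (D.isPath_append _ _ _).2 ⟨hq a, hb'⟩
    have eb := D.compPath_congr end_a rfl hb' (hq b)
    refine (D.compPath_congr (congrArg f₀ (C.src_comp a b h)) ?_ _ hab).trans
      ((D.compPath_append _ _ _ hab (hq a) hb' ?_).trans (D.comp_congr rfl eb _ _))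
    · rw [l_comp, List.map_append]
    · rw [eb]
      exact h'

/-- Functors out of a free category can be lifted along a functor that admits liftings of
arrows between the objects of a given lift on objects. -/
theorem IsFree.exists_lift {O'' A'' : Type u} {C : CatStr O A} (hC : C.IsFree) {D : CatStr O' A'}
    {E : CatStr O'' A''} {p₀ : O' → O''} {p₁ : A' → A''} (hp : IsFunctor D E p₀ p₁)
    {k₀ : O → O''} {k₁ : A → A''} (hk : IsFunctor C E k₀ k₁) (f₀ : O → O')
    (h₀ : ∀ x, p₀ (f₀ x) = k₀ x)
    (h : ∀ a, ∃ b, D.src b = f₀ (C.src a) ∧ D.tgt b = f₀ (C.tgt a) ∧ p₁ b = k₁ a) :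
    ∃ f₁, IsFunctor C D f₀ f₁ ∧ ∀ a, p₁ (f₁ a) = k₁ a := by
  choose g hs ht hpg using h
  -- The lifts `g` of arrows are chosen with no regard to composition. The functor `f₁` uses only
  -- their values on edges of decompositions, and it lies over `k₁` because `p₁` and `k₁` both
  -- preserve composites.
  obtain ⟨f₁, hf, hl⟩ := hC.exists_functor (D := D) ⟨hs, ht⟩
  refine ⟨f₁, hf, fun a => ?_⟩
  obtain ⟨l, hla, e, e'⟩ := hl a
  have hk' : E.IsPath (k₀ (C.src a)) (l.map k₁) := hk.isHom.isPath hla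
  have hlist : (l.map g).map p₁ = l.map k₁ := by
    rw [List.map_map]
    exact congrArg (List.map · l) (funext hpg)
  have hpath : E.IsPath (p₀ (f₀ (C.src a))) ((l.map g).map p₁) := by
    rw [h₀, hlist]
    exact hk'
  rw [e', hp.compPath _ _ _ hpath, E.compPath_congr (h₀ _) hlist hpath hk', ← hk.compPath _ _ hla,
    e]

end CatStr

/-! ### Comparison with the free category on a quiver -/

namespace CatStr

variable {O A : Type u}

section

variable {V : Type u} [Quiver.{u} V]

/-- The list of the values of the edges of a path under a prefunctor to a category presented by
sets. -/
def pathList (C : CatStr O A) (φ : V ⥤q C.El) {x : V} : {y : V} → Quiver.Path x y → List A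
  | _, .nil => []
  | _, .cons p f => pathList C φ p ++ [(φ.map f).1]

theorem pathList_comp (C : CatStr O A) (φ : V ⥤q C.El) {x y z : V} (p : Quiver.Path x y)
    (q : Quiver.Path y z) : C.pathList φ (p.comp q) = C.pathList φ p ++ C.pathList φ q := by
  induction q with
  | nil => exact (List.append_nil _).symm
  | cons q f ih => rw [Quiver.Path.comp_cons, pathList, pathList, ih, List.append_assoc]

/-- This links the two encodings of paths: evaluating a quiver path through the universal property
of `Paths` agrees with composing its list of edges. -/
theorem exists_compPath_pathList (C : CatStr O A) (φ : V ⥤q C.El) {x y : V}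
    (p : Quiver.Path x y) : ∃ h : C.IsPath (φ.obj x) (C.pathList φ p),
      (C.compPath _ _ h).1 = ((Paths.lift φ).map p).1 := by
  induction p with
  | nil => exact ⟨trivial, rfl⟩
  | @cons y z p f ih =>
    obtain ⟨h, e⟩ := ih
    have end_p : C.endpt (φ.obj x) (C.pathList φ p) = φ.obj y := by
      rw [← (C.compPath _ _ h).2.2, e]
      exact ((Paths.lift φ).map p).2.2
    have hf : C.IsPath (C.endpt (φ.obj x) (C.pathList φ p)) [(φ.map f).1] :=
      ⟨(φ.map f).2.1.trans end_p.symm, trivial⟩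
    have ef : (C.compPath _ _ hf).1 = (φ.map f).1 := C.comp_one _ _
    have hpf : C.IsPath (φ.obj x) (C.pathList φ p ++ [(φ.map f).1]) :=
      (C.isPath_append _ _ _).2 ⟨h, hf⟩
    refine ⟨hpf, (C.compPath_append _ _ _ hpf h hf ?_).trans (C.comp_congr e ef _ ?_)⟩
    · exact (C.compPath _ _ h).2.2.trans (C.compPath _ _ hf).2.1.symm
    · exact ((Paths.lift φ).map p).2.2.trans (φ.map f).2.1.symm

end

/-- The functor `F` turns an arrow into a quiver path, and `G`, which is determined by its values on
edges, turns that path into a list of arrows of `C`. The composite of the list is the original arrow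
since `F ⋙ G` is the identity. -/
theorem isFree_of_retract (C : CatStr O A) {V : Type u} [Quiver.{u} V] (F : C.El ⥤ Paths V)
    (G : Paths V ⥤ C.El) (h : F ⋙ G = 𝟭 C.El) : C.IsFree := by
  let φ : V ⥤q C.El := Paths.of V ⋙q G.toPrefunctor
  have hφ : Paths.lift φ = G := (Paths.lift_unique φ G rfl).symm
  let s : A → List A := fun a =>
    C.pathList φ (F.map (X := C.src a) (Y := C.tgt a) ⟨a, rfl, rfl⟩)
  have hs : ∀ {x y : C.El} (f : x ⟶ y), s f.1 = C.pathList φ (F.map f) := by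
    rintro x y ⟨a, rfl, rfl⟩
    rfl
  -- Comparing arrows as elements of `A`, not as morphisms between fixed objects, avoids transport
  -- along the equality of objects.
  have map_eq : ∀ (H : C.El ⥤ C.El), H = 𝟭 C.El → (∀ x, H.obj x = x) ∧
      ∀ {x y : C.El} (f : x ⟶ y), (H.map f).1 = f.1 := by
    rintro _ rfl
    exact ⟨fun _ => rfl, fun _ => rfl⟩
  obtain ⟨hobj, hmap⟩ := map_eq _ h
  refine C.isFree_of_section s (fun x => ?_) (fun a b hab => ?_) (fun a => ?_)
  · exact (hs (𝟙 (show C.El from x))).trans (congrArg (C.pathList φ) (F.map_id _))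
  · let fa : @Quiver.Hom C.El _ (C.src a) (C.tgt a) := ⟨a, rfl, rfl⟩
    let fb : @Quiver.Hom C.El _ (C.tgt a) (C.tgt b) := ⟨b, hab.symm, rfl⟩
    refine (hs (fa ≫ fb)).trans ?_
    refine (congrArg (C.pathList φ) (F.map_comp fa fb)).trans ?_
    exact (C.pathList_comp φ _ _).trans (congrArg₂ (· ++ ·) (hs fa).symm (hs fb).symm)
  · let fa : @Quiver.Hom C.El _ (C.src a) (C.tgt a) := ⟨a, rfl, rfl⟩
    obtain ⟨hp, e⟩ := C.exists_compPath_pathList φ (F.map fa)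
    have hx : φ.obj (F.obj (C.src a)) = C.src a := hobj _
    have e' : ((Paths.lift φ).map (F.map fa)).1 = a := by
      rw [hφ]
      exact hmap fa
    have hp' : C.IsPath (C.src a) (C.pathList φ (F.map fa)) :=
      Eq.subst (motive := fun v => C.IsPath v (C.pathList φ (F.map fa))) hx hp
    exact ⟨hp', (C.compPath_congr hx.symm rfl hp' hp).trans (e.trans e')⟩

/-- The quiver of the arrows of a set of arrows. -/
def genQuiv (C : CatStr O A) (S : Set A) : Quiv.{u, u} :=
  @Quiv.of O ⟨fun x y => { a : A // a ∈ S ∧ C.src a = x ∧ C.tgt a = y }⟩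

/-- The inclusion of the quiver of a set of arrows. -/
def genIncl (C : CatStr O A) (S : Set A) : C.genQuiv S ⥤q C.El where
  obj x := x
  map a := ⟨a.1, a.2.2⟩

/-- An edge is an arrow of `C`, so it determines its own source; the path can be reconstructed from
its last edge backwards. -/
theorem pathList_genIncl_injective (C : CatStr O A) (S : Set A) {x y : C.genQuiv S}
    (p q : Quiver.Path x y) (h : C.pathList (C.genIncl S) p = C.pathList (C.genIncl S) q) :
    p = q := by
  induction p with
  | nil =>
    generalize hy : x = y at q
    cases q with
    | nil => rfl
    | cons q g => exact absurd h.symm (by simp [pathList])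
  | @cons y z p f ih =>
    cases q with
    | nil => exact absurd h (by simp [pathList])
    | @cons y' _ q g =>
      obtain ⟨h₁, h₂⟩ := List.append_inj' h rfl
      have hfg : f.1 = g.1 := (List.cons.inj h₂).1
      obtain rfl : y = y' := f.2.2.1.symm.trans ((congrArg C.src hfg).trans g.2.2.1)
      rw [ih q h₁, Subtype.ext hfg]

theorem exists_pathList_genIncl (C : CatStr O A) (S : Set A) (l : List A) (hl : ∀ a ∈ l, a ∈ S)
    (x y : C.genQuiv S) (h : C.IsPath x l) (hy : C.endpt x l = y) :
    ∃ p : Quiver.Path x y, C.pathList (C.genIncl S) p = l := by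
  induction l generalizing x with
  | nil => exact ⟨hy ▸ .nil, by subst hy; rfl⟩
  | cons a l ih =>
    obtain ⟨p, hp⟩ := ih (fun b hb => hl b (List.mem_cons_of_mem _ hb)) (C.tgt a) h.2 hy
    let f : x ⟶ (C.tgt a : C.genQuiv S) := ⟨a, hl a List.mem_cons_self, h.1, rfl⟩
    exact ⟨f.toPath.comp p, (C.pathList_comp _ _ _).trans (congrArg (a :: ·) hp)⟩

/-- The canonical functor from the free category on the generating quiver is the identity on
objects. Existence of decompositions makes it full and uniqueness makes it faithful, so choosing
preimages of arrows gives a strict inverse. -/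
theorem IsFree.exists_iso {C : CatStr O A} (hC : C.IsFree) :
    ∃ Γ : Quiv.{u, u}, Nonempty (C.toCat ≅ Cat.free.obj Γ) := by
  obtain ⟨S, hS⟩ := hC
  let F : Paths (C.genQuiv S) ⥤ C.El := Paths.lift (C.genIncl S)
  have mem : ∀ {x y : C.genQuiv S} (p : Quiver.Path x y),
      ∀ a ∈ C.pathList (C.genIncl S) p, a ∈ S := by
    intro x y p
    induction p with
    | nil => exact nofun
    | cons p f ih =>
      intro a ha
      rcases List.mem_append.1 ha with ha | ha
      · exact ih a ha
      · rw [List.mem_singleton.1 ha]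
        exact f.2.1
  have faithful : ∀ {x y : C.genQuiv S} (p q : Quiver.Path x y), F.map p = F.map q → p = q := by
    intro x y p q h
    obtain ⟨hp, ep⟩ := C.exists_compPath_pathList (C.genIncl S) p
    obtain ⟨hq, eq⟩ := C.exists_compPath_pathList (C.genIncl S) q
    obtain ⟨l, _, hu⟩ := hS (F.map p).1
    have hx : C.src (F.map p).1 = x := (F.map p).2.1
    refine C.pathList_genIncl_injective S p q ((hu _ ⟨mem p, ?_⟩).trans (hu _ ⟨mem q, ?_⟩).symm)
    · rw [hx]
      exact ⟨hp, ep⟩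
    · rw [hx]
      exact ⟨hq, eq.trans (congrArg Subtype.val h.symm)⟩
  have full : ∀ {x y : C.El} (f : x ⟶ y),
      ∃ p : @Quiver.Path (C.genQuiv S) _ x y, F.map p = f := by
    rintro x y ⟨a, rfl, rfl⟩
    obtain ⟨l, ⟨hl, h, e⟩, _⟩ := hS a
    obtain ⟨p, hp⟩ := C.exists_pathList_genIncl S l hl (C.src a) (C.tgt a) h
      ((C.compPath _ _ h).2.2.symm.trans (congrArg C.tgt e))
    obtain ⟨h', e'⟩ := C.exists_compPath_pathList (C.genIncl S) p
    exact ⟨p, Subtype.ext (e'.symm.trans ((C.compPath_congr rfl hp h' h).trans e))⟩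
  choose g hg using @full
  let G : C.El ⥤ Paths (C.genQuiv S) :=
    { obj := fun x => x
      map := fun f => g f
      map_id := fun x => faithful _ _ ((hg _).trans (F.map_id _).symm)
      map_comp := fun f f' => faithful _ _ ((hg _).trans
        ((congrArg₂ (· ≫ ·) (hg f) (hg f')).symm.trans (F.map_comp (g f) (g f')).symm)) }
  refine ⟨C.genQuiv S, ⟨⟨Functor.toCatHom G, Functor.toCatHom F, ?_, ?_⟩⟩⟩
  · exact congrArg Functor.toCatHom
      (Functor.hext (F := G ⋙ F) (G := 𝟭 C.El) (fun _ => rfl) fun _ _ f => heq_of_eq (hg f))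
  · exact congrArg Functor.toCatHom (Functor.hext (F := F ⋙ G) (G := 𝟭 (Paths (C.genQuiv S)))
      (fun _ => rfl) fun _ _ p => heq_of_eq (faithful _ _ (hg (F.map p))))

theorem isFree_of_iso {C : CatStr O A} (Γ : Quiv.{u, u}) (e : C.toCat ≅ Cat.free.obj Γ) :
    C.IsFree :=
  C.isFree_of_retract (V := Γ) e.hom.toFunctor e.inv.toFunctor (congrArg Cat.Hom.toFunctor e.hom_inv_id)

end CatStr

/-! ### Lifting along acyclic fibrations, and restriction of vertical morphisms -/

namespace DblCat

/-- Over a fully faithful `F`, a horizontal morphism or square is determined by its horizontal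
source and target and its image. Only the vertical functor has to be lifted by hand: the rest is
forced, and each axiom holds because both of its sides have the same boundary and image. -/
theorem IsFullyFaithful.exists_lift {X A B : DblCat.{u}} {F : A ⟶ B} (hF : IsFullyFaithful F)
    (G : X ⟶ B) {f₀ : X.Obj → A.Obj} {f₁ : X.Ver → A.Ver} (hf : CatStr.IsFunctor X.v₀ A.v₀ f₀ f₁)
    (h₀ : ∀ x, F.obj (f₀ x) = G.obj x) (h₁ : ∀ j, F.ver (f₁ j) = G.ver j) :
    ∃ H : X ⟶ A, H ≫ F = G := by
  have eh := fun f : X.Hor => hF.hor (f₀ (X.h₀.src f)) (f₀ (X.h₀.tgt f)) (G.hor f)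
    ((G.map_h₀.src f).trans (h₀ _).symm) ((G.map_h₀.tgt f).trans (h₀ _).symm)
  choose g hg _ using eh
  have es := fun α : X.Sq => hF.sq (f₁ (X.h₁.src α)) (f₁ (X.h₁.tgt α)) (G.sq α)
    ((G.map_h₁.src α).trans (h₁ _).symm) ((G.map_h₁.tgt α).trans (h₁ _).symm)
  choose s hs _ using es
  have hor_ext : ∀ {f f' : A.Hor}, A.h₀.src f = A.h₀.src f' → A.h₀.tgt f = A.h₀.tgt f' →
      F.hor f = F.hor f' → f = f' := fun {f f'} e e' e'' =>
    (hF.hor _ _ _ (F.map_h₀.src f') (F.map_h₀.tgt f')).unique ⟨e, e', e''⟩ ⟨rfl, rfl, rfl⟩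
  have sq_ext : ∀ {α α' : A.Sq}, A.h₁.src α = A.h₁.src α' → A.h₁.tgt α = A.h₁.tgt α' →
      F.sq α = F.sq α' → α = α' := fun {α α'} e e' e'' =>
    (hF.sq _ _ _ (F.map_h₁.src α') (F.map_h₁.tgt α')).unique ⟨e, e', e''⟩ ⟨rfl, rfl, rfl⟩
  refine ⟨⟨f₀, g, f₁, s, hf, ⟨fun α => ?_, fun α => ?_, fun f => ?_, fun α β h h' => ?_⟩,
    ⟨fun f => (hg f).1, fun f => (hg f).2.1, fun x => ?_, fun a b h h' => ?_⟩,
    ⟨fun α => (hs α).1, fun α => (hs α).2.1, fun j => ?_, fun α β h h' => ?_⟩⟩,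
    Hom.ext (funext h₀) (funext fun f => (hg f).2.2) (funext h₁) (funext fun α => (hs α).2.2)⟩
  · refine hor_ext ?_ ?_ ?_
    · rw [← A.hsrc.src, (hs α).1, hf.src, (hg _).1, X.hsrc.src]
    · rw [← A.htgt.src, (hs α).2.1, hf.src, (hg _).2.1, X.htgt.src]
    · rw [← F.map_v₁.src, (hs α).2.2, (hg _).2.2, G.map_v₁.src]
  · refine hor_ext ?_ ?_ ?_
    · rw [← A.hsrc.tgt, (hs α).1, hf.tgt, (hg _).1, X.hsrc.tgt]
    · rw [← A.htgt.tgt, (hs α).2.1, hf.tgt, (hg _).2.1, X.htgt.tgt]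
    · rw [← F.map_v₁.tgt, (hs α).2.2, (hg _).2.2, G.map_v₁.tgt]
  · refine sq_ext ?_ ?_ ?_
    · rw [(hs _).1, A.hsrc.one, (hg _).1, X.hsrc.one, hf.one]
    · rw [(hs _).2.1, A.htgt.one, (hg _).2.1, X.htgt.one, hf.one]
    · rw [(hs _).2.2, F.map_v₁.one, (hg _).2.2, G.map_v₁.one]
  · refine sq_ext ?_ ?_ ?_
    · rw [(hs _).1, X.hsrc.map_comp α β h, A.hsrc.map_comp _ _ h', hf.map_comp]
      exact A.v₀.comp_congr (hs α).1.symm (hs β).1.symm _ _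
    · rw [(hs _).2.1, X.htgt.map_comp α β h, A.htgt.map_comp _ _ h', hf.map_comp]
      exact A.v₀.comp_congr (hs α).2.1.symm (hs β).2.1.symm _ _
    · rw [(hs _).2.2, F.map_v₁.map_comp _ _ h', G.map_v₁.map_comp]
      exact B.v₁.comp_congr (hs α).2.2.symm (hs β).2.2.symm _ _
  · refine hor_ext ?_ ?_ ?_
    · rw [(hg _).1, A.h₀.src_one, X.h₀.src_one]
    · rw [(hg _).2.1, A.h₀.tgt_one, X.h₀.tgt_one]
    · rw [(hg _).2.2, F.map_h₀.one, h₀, G.map_h₀.one]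
  · refine hor_ext ?_ ?_ ?_
    · rw [(hg _).1, A.h₀.src_comp, X.h₀.src_comp, (hg _).1]
    · rw [(hg _).2.1, A.h₀.tgt_comp, X.h₀.tgt_comp, (hg _).2.1]
    · rw [(hg _).2.2, F.map_h₀.map_comp _ _ h', G.map_h₀.map_comp]
      exact B.h₀.comp_congr (hg a).2.2.symm (hg b).2.2.symm _ _
  · refine sq_ext ?_ ?_ ?_
    · rw [(hs _).1, A.h₁.src_one, X.h₁.src_one]
    · rw [(hs _).2.1, A.h₁.tgt_one, X.h₁.tgt_one]
    · rw [(hs _).2.2, F.map_h₁.one, h₁, G.map_h₁.one]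
  · refine sq_ext ?_ ?_ ?_
    · rw [(hs _).1, A.h₁.src_comp, X.h₁.src_comp, (hs _).1]
    · rw [(hs _).2.1, A.h₁.tgt_comp, X.h₁.tgt_comp, (hs _).2.1]
    · rw [(hs _).2.2, F.map_h₁.map_comp _ _ h', G.map_h₁.map_comp]
      exact B.h₁.comp_congr (hs α).2.2.symm (hs β).2.2.symm _ _

/-- Essential surjectivity chooses, for an object `y`, an object `a` and a horizontal isomorphism `y
≅ F a`. The fibration property lifts it to a horizontal isomorphism into `a`, whose source lies
strictly over `y`. The same two steps with invertible squares lift vertical morphisms between the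
chosen objects. -/
theorem hasFullSection_of_acyclicFibration {X Y : DblCat.{u}} {F : X ⟶ Y}
    (hF : (fib tauPrime ⊓ we tauPrime) F) : CatStr.HasFullSection X.v₀ Y.v₀ F.obj F.ver := by
  obtain ⟨hfib, -, hwe⟩ := hF
  obtain ⟨τ, hτ, hτ'⟩ := (pathLift F).isTEpi_iff.1 hfib
  obtain ⟨σ, hσ, hσ'⟩ := (pathSrc F).isTEpi_iff.1 hwe
  refine ⟨fun y => X.h₀.src (τ (σ y)).1, fun y => ?_, fun j => ?_⟩
  · have := congrArg (fun p => Y.h₀.src p.1.2.1) (hτ (σ y))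
    exact ((F.map_h₀.src _).symm.trans this).trans (hσ y)
  · obtain ⟨p, hp, hp', e⟩ := hσ' j
    obtain ⟨α, hα, hα', e'⟩ := hτ' p
    refine ⟨X.h₁.src α.1, ?_, ?_, ?_⟩
    · exact (X.hsrc.src _).trans (congrArg (fun f => X.h₀.src f.1) (hα.trans (congrArg τ hp)))
    · exact (X.hsrc.tgt _).trans (congrArg (fun f => X.h₀.src f.1) (hα'.trans (congrArg τ hp')))
    · have := congrArg (fun p => Y.h₁.src p.1.2.1) e'
      exact ((F.map_h₁.src _).symm.trans this).trans e

/-- Freeness supplies the vertical part of a lift and full faithfulness the horizontal part. The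
triangle with the initial object commutes automatically. -/
theorem isCofibrant_of_isFree {X : DblCat.{u}} (hX : X.v₀.IsFree) :
    HomotopicalAlgebra.IsCofibrant X := by
  refine ⟨fun A B F hF => ⟨fun {_ G} _ => ?_⟩⟩
  obtain ⟨σ, hσ, hσ'⟩ := hasFullSection_of_acyclicFibration hF
  obtain ⟨f₁, hf, e⟩ := hX.exists_lift F.map_v₀ G.map_v₀ (fun x => σ (G.obj x))
    (fun x => hσ _) fun j => by
      obtain ⟨i, hi, hi', e⟩ := hσ' (G.ver j)
      exact ⟨i, by rw [hi, G.map_v₀.src], by rw [hi', G.map_v₀.tgt], e⟩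
  obtain ⟨H, hH⟩ := hF.2.1.exists_lift G hf (fun x => hσ _) e
  exact ⟨⟨⟨H, Limits.initialIsInitial.hom_ext _ _, hH⟩⟩⟩

section restrict

variable {X : DblCat.{u}} {V : Type u} {C : CatStr X.Obj V} {e : V → X.Ver}

/-- A square of `X` with a lift of its left and right sides along `e`. -/
@[ext]
structure ResSq (X : DblCat.{u}) {V : Type u} (e : V → X.Ver) : Type u where
  left : V
  right : V
  cell : X.Sq
  src_cell : X.h₁.src cell = e left
  tgt_cell : X.h₁.tgt cell = e right

theorem ResSq.src_left (he : CatStr.IsFunctor C X.v₀ (fun x => x) e)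
    (p : X.ResSq e) : C.src p.left = X.h₀.src (X.v₁.src p.cell) := by
  rw [← he.src, ← p.src_cell, X.hsrc.src]

theorem ResSq.tgt_left (he : CatStr.IsFunctor C X.v₀ (fun x => x) e)
    (p : X.ResSq e) : C.tgt p.left = X.h₀.src (X.v₁.tgt p.cell) := by
  rw [← he.tgt, ← p.src_cell, X.hsrc.tgt]

theorem ResSq.src_right (he : CatStr.IsFunctor C X.v₀ (fun x => x) e)
    (p : X.ResSq e) : C.src p.right = X.h₀.tgt (X.v₁.src p.cell) := by
  rw [← he.src, ← p.tgt_cell, X.htgt.src]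

theorem ResSq.tgt_right (he : CatStr.IsFunctor C X.v₀ (fun x => x) e)
    (p : X.ResSq e) : C.tgt p.right = X.h₀.tgt (X.v₁.tgt p.cell) := by
  rw [← he.tgt, ← p.tgt_cell, X.htgt.tgt]

variable (X)

/-- Vertical composition in `restrict`. -/
def resVer (he : CatStr.IsFunctor C X.v₀ (fun x => x) e) : CatStr X.Hor (X.ResSq e) where
  src p := X.v₁.src p.cell
  tgt p := X.v₁.tgt p.cell
  one f := ⟨C.one (X.h₀.src f), C.one (X.h₀.tgt f), X.v₁.one f,
    (X.hsrc.one f).trans (he.one _).symm, (X.htgt.one f).trans (he.one _).symm⟩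
  src_one f := X.v₁.src_one f
  tgt_one f := X.v₁.tgt_one f
  comp p q h := ⟨C.comp p.left q.left (by rw [p.tgt_left he, q.src_left he, h]),
    C.comp p.right q.right (by rw [p.tgt_right he, q.src_right he, h]), X.v₁.comp p.cell q.cell h,
    by
      rw [X.hsrc.map_comp _ _ h, he.map_comp]
      exact X.v₀.comp_congr p.src_cell q.src_cell _ _,
    by
      rw [X.htgt.map_comp _ _ h, he.map_comp]
      exact X.v₀.comp_congr p.tgt_cell q.tgt_cell _ _⟩
  src_comp _ _ _ := X.v₁.src_comp _ _ _
  tgt_comp _ _ _ := X.v₁.tgt_comp _ _ _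
  one_comp p h := ResSq.ext (C.one_comp' (p.src_left he) _) (C.one_comp' (p.src_right he) _)
    (X.v₁.one_comp _ _)
  comp_one p h := ResSq.ext (C.comp_one' (p.tgt_left he) _) (C.comp_one' (p.tgt_right he) _)
    (X.v₁.comp_one _ _)
  assoc _ _ _ _ _ _ _ := ResSq.ext (C.assoc _ _ _ _ _ _ _) (C.assoc _ _ _ _ _ _ _)
    (X.v₁.assoc _ _ _ _ _ _ _)

/-- Horizontal composition in `restrict`. -/
def resHor (X : DblCat.{u}) {V : Type u} (e : V → X.Ver) : CatStr V (X.ResSq e) where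
  src p := p.left
  tgt p := p.right
  one j := ⟨j, j, X.h₁.one (e j), X.h₁.src_one _, X.h₁.tgt_one _⟩
  src_one _ := rfl
  tgt_one _ := rfl
  comp p q h := ⟨p.left, q.right, X.h₁.comp p.cell q.cell (by rw [p.tgt_cell, q.src_cell, h]),
    (X.h₁.src_comp _ _ _).trans p.src_cell, (X.h₁.tgt_comp _ _ _).trans q.tgt_cell⟩
  src_comp _ _ _ := rfl
  tgt_comp _ _ _ := rfl
  one_comp p _ := ResSq.ext rfl rfl (X.h₁.one_comp' p.src_cell _)
  comp_one p _ := ResSq.ext rfl rfl (X.h₁.comp_one' p.tgt_cell _)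
  assoc _ _ _ _ _ _ _ := ResSq.ext rfl rfl (X.h₁.assoc _ _ _ _ _ _ _)

/-- The restriction of `X` along an identity on objects functor `e` from a category to its category
of vertical morphisms: the verticals are replaced by the arrows of that category. -/
def restrict (he : CatStr.IsFunctor C X.v₀ (fun x => x) e) : DblCat.{u} where
  Obj := X.Obj
  Hor := X.Hor
  Ver := V
  Sq := X.ResSq e
  v₀ := C
  v₁ := X.resVer he
  h₀ := X.h₀
  h₁ := X.resHor e
  hsrc := ⟨fun p => p.src_left he, fun p => p.tgt_left he, fun _ => rfl, fun _ _ _ _ => rfl⟩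
  htgt := ⟨fun p => p.src_right he, fun p => p.tgt_right he, fun _ => rfl, fun _ _ _ _ => rfl⟩
  hone := ⟨fun j => ((X.hone.src _).trans (congrArg X.h₀.one (he.src j))),
    fun j => ((X.hone.tgt _).trans (congrArg X.h₀.one (he.tgt j))),
    fun x => ResSq.ext (congrArg C.one (X.h₀.src_one x).symm)
      (congrArg C.one (X.h₀.tgt_one x).symm)
      ((congrArg X.h₁.one (he.one x)).trans (X.hone.one x)),
    fun i j h _ => ResSq.ext rfl rfl ((congrArg X.h₁.one (he.map_comp i j h)).trans
      (X.hone.map_comp _ _ _))⟩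
  vsrc := ⟨fun p => (p.src_left he).symm, fun p => (p.src_right he).symm,
    fun j => ((X.hone.src _).trans (congrArg X.h₀.one (he.src j))),
    fun _ _ _ _ => X.vsrc.comp _ _ _ _⟩
  vtgt := ⟨fun p => (p.tgt_left he).symm, fun p => (p.tgt_right he).symm,
    fun j => ((X.hone.tgt _).trans (congrArg X.h₀.one (he.tgt j))),
    fun _ _ _ _ => X.vtgt.comp _ _ _ _⟩
  vone := ⟨fun _ => rfl, fun _ => rfl,
    fun x => ResSq.ext (congrArg C.one (X.h₀.src_one x)) (congrArg C.one (X.h₀.tgt_one x))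
      ((X.vone.one x).trans (congrArg X.h₁.one (he.one x).symm)),
    fun f g h _ => ResSq.ext (congrArg C.one (X.h₀.src_comp f g h))
      (congrArg C.one (X.h₀.tgt_comp f g h)) (X.vone.map_comp f g h)⟩
  interchange _ _ _ _ _ _ _ _ _ _ := ResSq.ext rfl rfl (X.interchange _ _ _ _ _ _ _ _ _ _)

/-- The projection from a restriction. -/
def restrictProj (he : CatStr.IsFunctor C X.v₀ (fun x => x) e) : X.restrict he ⟶ X where
  obj x := x
  hor f := f
  ver := e
  sq := ResSq.cell
  map_v₀ := he
  map_v₁ := ⟨fun _ => rfl, fun _ => rfl, fun _ => rfl, fun _ _ _ _ => rfl⟩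
  map_h₀ := CatStr.IsFunctor.id _
  map_h₁ := ⟨ResSq.src_cell, ResSq.tgt_cell, fun _ => rfl, fun _ _ _ _ => rfl⟩

/-- Full faithfulness is built into the squares of the restriction. For the fibration condition, the
right side of an invertible square is already lifted, and fullness of `e` lifts its left side. For
essential surjectivity, horizontal identities suffice as the chosen isomorphisms. -/
theorem restrictProj_acyclicFibration (he : CatStr.IsFunctor C X.v₀ (fun x => x) e)
    (full : ∀ j, ∃ i, C.src i = X.v₀.src j ∧ C.tgt i = X.v₀.tgt j ∧ e i = j) :
    (fib tauPrime ⊓ we tauPrime) (X.restrictProj he) := by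
  refine ⟨(pathLift (X.restrictProj he)).isTEpi_iff.2
      ⟨fun p => p.1.2, fun p => ?_, fun p => ?_⟩,
    ⟨fun a a' f h h' => ⟨f, ⟨h, h', rfl⟩, fun _ h => h.2.2⟩,
      fun j k α h h' => ⟨⟨j, k, α, h, h'⟩, ⟨rfl, rfl, rfl⟩, ?_⟩⟩,
    (pathSrc (X.restrictProj he)).isTEpi_iff.2
      ⟨fun y => ⟨(y, ⟨X.h₀.one y, ?_⟩), (X.h₀.tgt_one y).symm⟩, fun y => X.h₀.src_one y,
        fun j => ?_⟩⟩
  · obtain ⟨⟨a, f⟩, h⟩ := p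
    exact Subtype.ext (Prod.ext h.symm rfl)
  · obtain ⟨⟨i, α, β, hαβ, hβα, e₁, e₂⟩, h⟩ := p
    change e i = X.h₁.tgt α at h
    obtain ⟨i', hs, ht, hi'⟩ := full (X.h₁.src α)
    -- The horizontal inverse must be lifted with the same two sides interchanged, so that the lifts
    -- stay mutually inverse.
    let α' : X.ResSq e := ⟨i', i, α, hi'.symm, h.symm⟩
    let β' : X.ResSq e := ⟨i, i', β, hαβ.symm.trans h.symm, hβα.trans hi'.symm⟩
    refine ⟨⟨α', β', rfl, rfl, ResSq.ext rfl rfl ?_, ResSq.ext rfl rfl ?_⟩, rfl, rfl,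
      Subtype.ext rfl⟩
    · exact e₁.trans (congrArg X.h₁.one hi'.symm)
    · exact e₂.trans (congrArg X.h₁.one h.symm)
  · rintro β ⟨rfl, rfl, rfl⟩
    rfl
  · exact ⟨X.h₀.one y, by rw [X.h₀.src_one, X.h₀.tgt_one], by rw [X.h₀.src_one, X.h₀.tgt_one],
      X.h₀.comp_one' (X.h₀.tgt_one y) _ |>.trans (by rw [X.h₀.src_one]),
      X.h₀.comp_one' (X.h₀.tgt_one y) _ |>.trans (by rw [X.h₀.tgt_one])⟩
  · obtain ⟨i, hs, ht, rfl⟩ := full j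
    refine ⟨⟨(i, ⟨X.h₁.one (e i), X.h₁.one (e i), ?_, ?_, ?_, ?_⟩), (X.h₁.tgt_one _).symm⟩,
      ?_, ?_, X.h₁.src_one _⟩
    · rw [X.h₁.src_one, X.h₁.tgt_one]
    · rw [X.h₁.src_one, X.h₁.tgt_one]
    · exact X.h₁.comp_one' (X.h₁.tgt_one _) _ |>.trans (by rw [X.h₁.src_one])
    · exact X.h₁.comp_one' (X.h₁.tgt_one _) _ |>.trans (by rw [X.h₁.tgt_one])
    · exact Subtype.ext (Prod.ext hs (Subtype.ext (X.hone.src _)))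
    · exact Subtype.ext (Prod.ext ht (Subtype.ext (X.hone.tgt _)))

end restrict

/-- An acyclic fibration onto a cofibrant object has a section. -/
theorem exists_section_of_isCofibrant {X Y : DblCat.{u}} (hX : HomotopicalAlgebra.IsCofibrant X)
    {F : Y ⟶ X} (hF : (fib tauPrime ⊓ we tauPrime) F) : ∃ s : X ⟶ Y, s ≫ F = 𝟙 X := by
  have := hX.mem F hF
  have sq : CommSq (Limits.initial.to Y) (Limits.initial.to X) F (𝟙 X) :=
    ⟨Limits.initialIsInitial.hom_ext _ _⟩
  exact ⟨sq.lift, sq.fac_right⟩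

end DblCat

/-! ### Paths as vertical morphisms, and the characterisation of cofibrant objects -/

/-- The free category on a graph. -/
def Gph.pathCategory {V E : Type u} (G : Gph V E) : CatStr V G.Path where
  toGph := G.pathGph
  one x := ⟨x, [], trivial⟩
  src_one _ := rfl
  tgt_one _ := rfl
  comp p q h := ⟨p.start, p.edges ++ q.edges, (G.isPath_append _ _ _).2
    ⟨p.isPath, (show G.endpt p.start p.edges = q.start from h) ▸ q.isPath⟩⟩
  src_comp _ _ _ := rfl
  tgt_comp _ q h := (G.endpt_append _ _ _).trans (congrArg (G.endpt · q.edges) h)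
  one_comp _ _ := rfl
  comp_one _ _ := Path.ext rfl (List.append_nil _)
  assoc _ _ _ _ _ _ _ := Path.ext rfl (List.append_assoc _ _ _)

namespace CatStr

variable {O A O' A' : Type u}

/-- The composite of a path in a category. -/
def eval (C : CatStr O A) (p : C.Path) : A := (C.compPath p.start p.edges p.isPath).1

theorem src_eval (C : CatStr O A) (p : C.Path) : C.src (C.eval p) = p.start :=
  (C.compPath _ _ p.isPath).2.1

theorem tgt_eval (C : CatStr O A) (p : C.Path) : C.tgt (C.eval p) = C.endpt p.start p.edges :=
  (C.compPath _ _ p.isPath).2.2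

theorem eval_single (C : CatStr O A) (a : A) : C.eval (C.single a) = a := C.comp_one _ _

/-- This is the counit of the adjunction between free categories and underlying graphs. -/
theorem eval_isFunctor (C : CatStr O A) :
    IsFunctor C.toGph.pathCategory C (fun x => x) C.eval where
  src := C.src_eval
  tgt := C.tgt_eval
  one _ := rfl
  comp p q h h' := by
    have e : C.endpt p.start p.edges = q.start := h
    have hq : C.IsPath (C.endpt p.start p.edges) q.edges := e ▸ q.isPath
    have eq := C.compPath_congr e rfl hq q.isPath
    exact (C.compPath_append _ _ _ _ p.isPath hq (by rw [eq]; exact h')).trans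
      (C.comp_congr rfl eq _ _)

theorem IsFunctor.eval {C : CatStr O A} {D : CatStr O' A'} {f₀ : O → O'} {f₁ : A → A'}
    (hf : IsFunctor C D f₀ f₁) (p : C.Path) :
    f₁ (C.eval p) = D.eval (p.map hf.isHom) := hf.compPath _ _ _ _

theorem eval_pathCategory_map_single {V E : Type u} (G : Gph V E) (p : G.Path) :
    G.pathCategory.eval (p.map G.single_isHom) = p := by
  obtain ⟨v, l, h⟩ := p
  induction l generalizing v with
  | nil => rfl
  | cons a l ih =>
    obtain ⟨rfl, h⟩ := h
    exact Gph.Path.ext rfl (congrArg (fun p : G.Path => a :: p.edges) (ih _ h))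

/-- The edge lists of a functorial section of `eval` are multiplicative decompositions. Cofibrancy
and flexibility both yield freeness through this criterion. -/
theorem isFree_of_path_section (C : CatStr O A) {f₀ : O → O} {f₁ : A → C.Path}
    (hf : IsFunctor C C.toGph.pathCategory f₀ f₁) (h : ∀ a, C.eval (f₁ a) = a) : C.IsFree := by
  refine C.isFree_of_section (fun a => (f₁ a).edges) (fun x => by rw [hf.one]; rfl)
    (fun a b k => by rw [hf.map_comp]; rfl) fun a => ?_
  have hs : C.src a = (f₁ a).start := by
    rw [← C.src_eval, h]
  rw [hs]
  exact ⟨(f₁ a).isPath, h a⟩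

end CatStr

namespace DblCat

/-- The double category with the paths of vertical morphisms of `X` as vertical morphisms and with
the squares of `X` between composites of paths as squares. -/
def pathDbl (X : DblCat.{u}) : DblCat.{u} := X.restrict X.v₀.eval_isFunctor

/-- The projection of `pathDbl`, composing paths. -/
def pathProj (X : DblCat.{u}) : X.pathDbl ⟶ X := X.restrictProj X.v₀.eval_isFunctor

theorem pathProj_acyclicFibration (X : DblCat.{u}) :
    (fib tauPrime ⊓ we tauPrime) X.pathProj :=
  X.restrictProj_acyclicFibration _ fun j => ⟨X.v₀.single j, rfl, rfl, X.v₀.eval_single j⟩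

/-- A section of the acyclic fibration `pathProj` is, on vertical morphisms, a functorial section of
`eval`. -/
theorem isCofibrant_iff_isFree (X : DblCat.{u}) :
    HomotopicalAlgebra.IsCofibrant X ↔ X.v₀.IsFree := by
  refine ⟨fun h => ?_, isCofibrant_of_isFree⟩
  obtain ⟨s, hs⟩ := exists_section_of_isCofibrant h X.pathProj_acyclicFibration
  exact X.v₀.isFree_of_path_section s.map_v₀ (congrFun (congrArg Hom.ver hs))

/-- A double functor is a strict morphism of algebras. -/
def toAlgebraMap {X Y : DblCat.{u}} (F : X ⟶ Y) : X.toAlgebra ⟶ Y.toAlgebra where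
  f := ⟨F.obj, F.hor, F.ver, F.sq, F.map_v₀.isHom, F.map_v₁.isHom, F.map_h₀, F.map_h₁⟩
  h := CatGraph.Hom.ext rfl rfl (funext fun p => (F.map_v₀.eval p).symm)
    (funext fun p => (F.map_v₁.eval p).symm)

end DblCat

/-! ### Algebras for `M̄` are double categories -/

namespace CatStr

variable {O A : Type u}

/-- The category structure on a graph given by an algebra structure for the free category monad. -/
def ofAction (G : Gph O A) (act : G.Path → A) (hact : Gph.IsHom G.pathGph G (fun x => x) act)
    (unit : ∀ a, act (G.single a) = a)
    (assoc : ∀ p : G.pathGph.Path, act (G.flat p) = act (p.map hact)) : CatStr O A :=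
  -- This is the associativity law at a path of two paths. The unit and associativity laws of the
  -- category all follow by writing a short path as a concatenation in different ways.
  have two : ∀ (p q : G.Path) (h : G.endpt p.start p.edges = q.start)
      (hp : G.IsPath p.start (p.edges ++ q.edges)) (hpq : G.IsPath p.start [act p, act q]),
      act ⟨p.start, p.edges ++ q.edges, hp⟩ = act ⟨p.start, [act p, act q], hpq⟩ := by
    intro p q h hp hpq
    have e : G.flat ⟨p.start, [p, q], rfl, h.symm, trivial⟩ = ⟨p.start, p.edges ++ q.edges, hp⟩ :=
      Gph.Path.ext rfl (congrArg (p.edges ++ ·) (List.append_nil q.edges))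
    exact (congrArg act e).symm.trans (assoc _)
  have congr : ∀ {v v' : O} {l l' : List A} (h : G.IsPath v l) (h' : G.IsPath v' l'), v = v' →
      l = l' → act ⟨v, l, h⟩ = act ⟨v', l', h'⟩ :=
    fun _ _ hv hl => congrArg act (Gph.Path.ext hv hl)
  { toGph := G
    one := fun x => act ⟨x, [], trivial⟩
    src_one := fun _ => hact.src _
    tgt_one := fun _ => hact.tgt _
    comp := fun f g h => act ⟨G.src f, [f, g], rfl, h.symm, trivial⟩
    src_comp := fun _ _ _ => hact.src _
    tgt_comp := fun _ _ _ => hact.tgt _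
    one_comp := fun f h => by
      have hp : G.IsPath (G.src f) [act ⟨G.src f, [], trivial⟩, act (G.single f)] :=
        ⟨hact.src _, (hact.src _).trans (hact.tgt ⟨G.src f, [], trivial⟩).symm, trivial⟩
      have e := two ⟨G.src f, [], trivial⟩ (G.single f) rfl ⟨rfl, trivial⟩ hp
      exact (congr _ hp (hact.src _) (congrArg (fun z => [_, z]) (unit f).symm)).trans
        (e.symm.trans (unit f))
    comp_one := fun f h => by
      have hp : G.IsPath (G.src f) [act (G.single f), act ⟨G.tgt f, [], trivial⟩] :=
        ⟨hact.src _, (hact.src _).trans (hact.tgt (G.single f)).symm, trivial⟩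
      have e := two (G.single f) ⟨G.tgt f, [], trivial⟩ rfl ⟨rfl, trivial⟩ hp
      exact (congr _ hp rfl (congrArg (fun z => [z, _]) (unit f).symm)).trans
        (e.symm.trans (unit f))
    assoc := fun f g k h₁ h₂ h₃ h₄ => by
      let p : G.Path := ⟨G.src f, [f, g], rfl, h₁.symm, trivial⟩
      let q : G.Path := ⟨G.src g, [g, k], rfl, h₃.symm, trivial⟩
      have hp : G.IsPath (G.src f) [act p, act (G.single k)] :=
        ⟨hact.src _, (hact.src _).trans (h₃.symm.trans (hact.tgt p).symm), trivial⟩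
      have hq : G.IsPath (G.src f) [act (G.single f), act q] :=
        ⟨hact.src _, (hact.src _).trans (h₁.symm.trans (hact.tgt (G.single f)).symm), trivial⟩
      have e₁ := two p (G.single k) h₃ ⟨rfl, h₁.symm, h₃.symm, trivial⟩ hp
      have e₂ := two (G.single f) q h₁ ⟨rfl, h₁.symm, h₃.symm, trivial⟩ hq
      exact (congr _ hp (hact.src _) (congrArg (fun z => [_, z]) (unit k).symm)).trans
        (e₁.symm.trans (e₂.trans (congr hq _ rfl (congrArg (fun z => [z, _]) (unit f))))) }

/-- A path `a :: l` is the flattening of the two paths `single a` and `l`, so the associativity law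
reduces the action on paths to iterated binary composition. -/
theorem eval_ofAction (G : Gph O A) (act : G.Path → A)
    (hact : Gph.IsHom G.pathGph G (fun x => x) act) (unit : ∀ a, act (G.single a) = a)
    (assoc : ∀ p : G.pathGph.Path, act (G.flat p) = act (p.map hact)) (p : G.Path) :
    (ofAction G act hact unit assoc).eval p = act p := by
  obtain ⟨v, l, h⟩ := p
  induction l generalizing v with
  | nil => rfl
  | cons a l ih =>
    obtain ⟨rfl, h⟩ := h
    have e := assoc ⟨G.src a, [G.single a, ⟨G.tgt a, l, h⟩], rfl, rfl, trivial⟩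
    have e' : G.flat ⟨G.src a, [G.single a, ⟨G.tgt a, l, h⟩], rfl, rfl, trivial⟩ =
        ⟨G.src a, a :: l, rfl, h⟩ :=
      Gph.Path.ext rfl (congrArg (a :: ·) (List.append_nil l))
    rw [e'] at e
    rw [e]
    refine congrArg act (Gph.Path.ext rfl ?_)
    change [a, (ofAction G act hact unit assoc).eval ⟨G.tgt a, l, h⟩] =
      [act (G.single a), act ⟨G.tgt a, l, h⟩]
    exact congrArg₂ (fun y z => [y, z]) (unit a).symm (ih (G.tgt a) h)

theorem isFunctor_ofAction {O' A' : Type u} {G : Gph O A} {act : G.Path → A}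
    {hact : Gph.IsHom G.pathGph G (fun x => x) act} {unit : ∀ a, act (G.single a) = a}
    {assoc : ∀ p : G.pathGph.Path, act (G.flat p) = act (p.map hact)}
    {H : Gph O' A'} {act' : H.Path → A'}
    {hact' : Gph.IsHom H.pathGph H (fun x => x) act'} {unit' : ∀ a, act' (H.single a) = a}
    {assoc' : ∀ p : H.pathGph.Path, act' (H.flat p) = act' (p.map hact')}
    {f₀ : O → O'} {f₁ : A → A'} (hf : Gph.IsHom G H f₀ f₁)
    (h : ∀ p : G.Path, f₁ (act p) = act' (p.map hf)) :
    IsFunctor (ofAction G act hact unit assoc) (ofAction H act' hact' unit' assoc') f₀ f₁ where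
  src := hf.src
  tgt := hf.tgt
  one _ := h _
  comp a _ _ _ := (h _).trans (congrArg act' (Gph.Path.ext (hf.src a).symm rfl))

end CatStr

namespace DblCat

theorem algebra_eq {A : CatGraph.{u}} {a a' : Mbar.{u}.obj A ⟶ A} (h : a = a')
    (unit : Mbar.η.app A ≫ a = 𝟙 A) (assoc : Mbar.μ.app A ≫ a = Mbar.map a ≫ a)
    (unit' : Mbar.η.app A ≫ a' = 𝟙 A) (assoc' : Mbar.μ.app A ≫ a' = Mbar.map a' ≫ a') :
    (⟨A, a, unit, assoc⟩ : Mbar.Algebra) = ⟨A, a', unit', assoc'⟩ := by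
  subst h
  rfl

/-- Every `M̄`-algebra is given by a double category. -/
theorem exists_toAlgebra_eq (B : Mbar.{u}.Algebra) : ∃ Z : DblCat.{u}, Z.toAlgebra = B := by
  obtain ⟨⟨Obj, Hor, Ver, Sq, v₀, v₁, h₀, h₁, vsrc, vtgt⟩, a, unit, assoc⟩ := B
  obtain ⟨obj, hor, ver, sq, a₀, a₁, b₀, b₁⟩ := a
  -- The monad leaves objects and horizontal morphisms unchanged, so the unit law forces the action
  -- to be the identity on them.
  obtain rfl : obj = fun x => x := congrArg CatGraph.Hom.obj unit
  obtain rfl : hor = fun x => x := congrArg CatGraph.Hom.hor unit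
  let B : CatGraph.{u} := ⟨Obj, Hor, Ver, Sq, v₀, v₁, h₀, h₁, vsrc, vtgt⟩
  have u₀ : ∀ j, ver (v₀.single j) = j := congrFun (congrArg CatGraph.Hom.ver unit)
  have u₁ : ∀ α, sq (v₁.single α) = α := congrFun (congrArg CatGraph.Hom.sq unit)
  have s₀ : ∀ p : v₀.pathGph.Path, ver (v₀.flat p) = ver (p.map a₀) :=
    congrFun (congrArg CatGraph.Hom.ver assoc)
  have s₁ : ∀ p : v₁.pathGph.Path, sq (v₁.flat p) = sq (p.map a₁) :=
    congrFun (congrArg CatGraph.Hom.sq assoc)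
  let Z : DblCat.{u} :=
    { Obj := Obj
      Hor := Hor
      Ver := Ver
      Sq := Sq
      v₀ := CatStr.ofAction v₀ ver a₀ u₀ s₀
      v₁ := CatStr.ofAction v₁ sq a₁ u₁ s₁
      h₀ := h₀
      h₁ := h₁
      hsrc := CatStr.isFunctor_ofAction B.hsrc b₁.src
      htgt := CatStr.isFunctor_ofAction B.htgt b₁.tgt
      hone := CatStr.isFunctor_ofAction B.hone fun p => (b₁.one p).symm
      vsrc := vsrc
      vtgt := vtgt
      -- Compatibility of vertical identities with horizontal structure is horizontal functoriality
      -- of the action at empty paths; interchange is the same at paths of length two.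
      vone := ⟨fun f => b₁.src ⟨f, [], trivial⟩, fun f => b₁.tgt ⟨f, [], trivial⟩,
        fun x => b₁.one ⟨x, [], trivial⟩, fun f g h h' =>
          b₁.comp ⟨f, [], trivial⟩ ⟨g, [], trivial⟩ (Gph.Path.ext h rfl) h'⟩
      interchange := fun α β γ δ hαβ hγδ hαγ hβδ h h' => by
        let p : v₁.Path := ⟨v₁.src α, [α, γ], rfl, hαγ.symm, trivial⟩
        let q : v₁.Path := ⟨v₁.src β, [β, δ], rfl, hβδ.symm, trivial⟩
        have hpq : B.pathCat.tgt p = B.pathCat.src q :=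
          Gph.Path.ext (vsrc.tgt_eq_src hαβ) (congrArg₂ (fun y z => [y, z]) hαβ hγδ)
        exact Eq.trans (b := sq (B.pathCat.comp p q hpq))
          (congrArg sq (Gph.Path.ext (vsrc.map_comp α β hαβ) rfl)) (b₁.comp p q hpq h') }
  have hZ : Z.action =
      CatGraph.Hom.mk (X := Mbar.obj B) (Y := B) (fun x => x) (fun x => x) ver sq a₀ a₁ b₀ b₁ :=
    CatGraph.Hom.ext rfl rfl (funext (CatStr.eval_ofAction v₀ ver a₀ u₀ s₀))
      (funext (CatStr.eval_ofAction v₁ sq a₁ u₁ s₁))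
  exact ⟨Z, algebra_eq hZ _ _ _ _⟩

end DblCat

/-! ### The pseudo morphism from `X` to `pathDbl` -/

theorem Gph.Path.map_map_comm {V E V₁ E₁ V₂ E₂ W F : Type u} {G : Gph V E} {G₁ : Gph V₁ E₁}
    {G₂ : Gph V₂ E₂} {H : Gph W F} {f₀ : V → V₁} {f₁ : E → E₁} {g₀ : V₁ → W} {g₁ : E₁ → F}
    {f₀' : V → V₂} {f₁' : E → E₂} {g₀' : V₂ → W} {g₁' : E₂ → F} (hf : IsHom G G₁ f₀ f₁)
    (hg : IsHom G₁ H g₀ g₁) (hf' : IsHom G G₂ f₀' f₁') (hg' : IsHom G₂ H g₀' g₁') (p : G.Path)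
    (h₀ : ∀ v, g₀ (f₀ v) = g₀' (f₀' v)) (h₁ : ∀ e, g₁ (f₁ e) = g₁' (f₁' e)) :
    (p.map hf).map hg = (p.map hf').map hg' := by
  refine Path.ext (h₀ _) ?_
  change (p.edges.map f₁).map g₁ = (p.edges.map f₁').map g₁'
  rw [List.map_map, List.map_map]
  exact congrArg (List.map · _) (funext h₁)

theorem Gph.Path.map_map_eq {V E V₁ E₁ W F : Type u} {G : Gph V E} {G₁ : Gph V₁ E₁}
    {H : Gph W F} {f₀ : V → V₁} {f₁ : E → E₁} {g₀ : V₁ → W} {g₁ : E₁ → F} {k₀ : V → W}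
    {k₁ : E → F} (hf : IsHom G G₁ f₀ f₁) (hg : IsHom G₁ H g₀ g₁) (hk : IsHom G H k₀ k₁)
    (p : G.Path) (h₀ : ∀ v, g₀ (f₀ v) = k₀ v) (h₁ : ∀ e, g₁ (f₁ e) = k₁ e) :
    (p.map hf).map hg = p.map hk := by
  refine Path.ext (h₀ _) ?_
  change (p.edges.map f₁).map g₁ = p.edges.map k₁
  rw [List.map_map]
  exact congrArg (List.map · _) (funext h₁)

namespace CatStr

variable {O A : Type u}

/-- The algebra structure of a free category is the multiplication of the monad. -/
theorem eval_pathCategory {V E : Type u} (G : Gph V E) (p : G.pathGph.Path) :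
    G.pathCategory.eval p = G.flat p := by
  obtain ⟨v, l, h⟩ := p
  induction l generalizing v with
  | nil => rfl
  | cons a l ih =>
    obtain ⟨rfl, h⟩ := h
    exact Gph.Path.ext rfl (congrArg (fun p : G.Path => a.edges ++ p.edges) (ih _ h))

theorem eval_flat (C : CatStr O A) (p : C.pathGph.Path) :
    C.eval (C.flat p) = C.eval (p.map C.eval_isFunctor.isHom) := by
  exact (congrArg C.eval (eval_pathCategory C.toGph p).symm).trans (C.eval_isFunctor.eval p)

end CatStr

namespace DblCat

variable (X : DblCat.{u})

/-- The inclusion of vertical morphisms in `pathDbl` as paths of length one. -/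
def pathUnitHom : CatGraph.Hom X.toCatGraph X.pathDbl.toCatGraph where
  obj x := x
  hor f := f
  ver := X.v₀.single
  sq α := ⟨X.v₀.single (X.h₁.src α), X.v₀.single (X.h₁.tgt α), α, (X.v₀.eval_single _).symm,
    (X.v₀.eval_single _).symm⟩
  map_v₀ := X.v₀.single_isHom
  map_v₁ := ⟨fun _ => rfl, fun _ => rfl⟩
  map_h₀ := CatStr.IsFunctor.id _
  map_h₁ := ⟨fun _ => rfl, fun _ => rfl,
    fun _ => ResSq.ext (congrArg X.v₀.single (X.h₁.src_one _))
      (congrArg X.v₀.single (X.h₁.tgt_one _)) (congrArg X.h₁.one (X.v₀.eval_single _).symm),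
    fun _ _ _ _ => ResSq.ext (congrArg X.v₀.single (X.h₁.src_comp _ _ _))
      (congrArg X.v₀.single (X.h₁.tgt_comp _ _ _)) rfl⟩

theorem eval_map_pathUnitHom_ver (p : X.v₀.Path) :
    X.pathDbl.v₀.eval (p.map X.pathUnitHom.map_v₀) = p :=
  CatStr.eval_pathCategory_map_single _ p

theorem eval_map_pathUnitHom_cell (p : X.v₁.Path) :
    (X.pathDbl.v₁.eval (p.map X.pathUnitHom.map_v₁)).cell = X.v₁.eval p := by
  refine (X.pathProj.map_v₁.eval _).trans (congrArg X.v₁.eval (Gph.Path.ext rfl ?_))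
  exact (List.map_map (l := p.edges)).trans (List.map_id _)

/-- Vertical composition in `pathDbl` concatenates the sides and does not compose them. This is why
`pathUnitHom` respects vertical composition only up to the comparison squares `pathSq`. -/
theorem eval_map_pathUnitHom_left (p : X.v₁.Path) :
    (X.pathDbl.v₁.eval (p.map X.pathUnitHom.map_v₁)).left = p.map X.hsrc.isHom := by
  refine (X.pathDbl.hsrc.eval _).trans ((congrArg X.pathDbl.v₀.eval ?_).trans
    (X.eval_map_pathUnitHom_ver (p.map X.hsrc.isHom)))
  exact Gph.Path.map_map_comm _ _ _ _ _ (fun _ => rfl) fun _ => rfl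

theorem eval_map_pathUnitHom_right (p : X.v₁.Path) :
    (X.pathDbl.v₁.eval (p.map X.pathUnitHom.map_v₁)).right = p.map X.htgt.isHom := by
  refine (X.pathDbl.htgt.eval _).trans ((congrArg X.pathDbl.v₀.eval ?_).trans
    (X.eval_map_pathUnitHom_ver (p.map X.htgt.isHom)))
  exact Gph.Path.map_map_comm _ _ _ _ _ (fun _ => rfl) fun _ => rfl

/-- The square of `pathDbl` from a path to its composite. -/
def pathSq (p : X.v₀.Path) : X.ResSq X.v₀.eval :=
  ⟨p, X.v₀.single (X.v₀.eval p), X.h₁.one (X.v₀.eval p), X.h₁.src_one _,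
    (X.h₁.tgt_one _).trans (X.v₀.eval_single _).symm⟩

/-- The square of `pathDbl` from the composite of a path to the path. -/
def pathSqInv (p : X.v₀.Path) : X.ResSq X.v₀.eval :=
  ⟨X.v₀.single (X.v₀.eval p), p, X.h₁.one (X.v₀.eval p),
    (X.h₁.src_one _).trans (X.v₀.eval_single _).symm, X.h₁.tgt_one _⟩

theorem one_eval_src (p : X.v₀.Path) : X.v₁.src (X.h₁.one (X.v₀.eval p)) = X.h₀.one p.start :=
  (X.hone.src _).trans (congrArg X.h₀.one (X.v₀.src_eval p))

theorem one_eval_tgt (p : X.v₀.Path) :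
    X.v₁.tgt (X.h₁.one (X.v₀.eval p)) = X.h₀.one (X.v₀.endpt p.start p.edges) :=
  (X.hone.tgt _).trans (congrArg X.h₀.one (X.v₀.tgt_eval p))

/-- The 2-cell of the pseudo morphism `pathUnit`. -/
def pathUnitCell : CatGraph.Trans (X := X.toCatGraph.pathObj) (Y := X.pathDbl.toCatGraph)
    (Mbar.map X.pathUnitHom ≫ X.pathDbl.action) (X.action ≫ X.pathUnitHom) where
  ob := X.h₀.one
  ve := X.pathSq
  isHom := ⟨X.one_eval_src, X.one_eval_tgt⟩
  src_ob := X.h₀.src_one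
  tgt_ob := X.h₀.tgt_one
  src_ve p := (X.eval_map_pathUnitHom_ver p).symm
  tgt_ve _ := rfl
  naturality_ob f _ _ := (X.h₀.comp_one _ _).trans (X.h₀.one_comp _ _).symm
  naturality_ve p h h' := by
    refine ResSq.ext (X.eval_map_pathUnitHom_left p)
      (congrArg X.v₀.single (X.htgt.eval p).symm) ?_
    have e := X.eval_map_pathUnitHom_cell p
    exact (X.h₁.comp_one' (x := X.v₀.eval (p.map X.htgt.isHom))
      ((congrArg X.h₁.tgt e).trans (X.htgt.eval p)) _).trans
      (e.trans (X.h₁.one_comp' (X.hsrc.eval p) _).symm)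

/-- The inverse of `pathUnitCell`. -/
def pathUnitCellInv : CatGraph.Trans (X := X.toCatGraph.pathObj) (Y := X.pathDbl.toCatGraph)
    (X.action ≫ X.pathUnitHom) (Mbar.map X.pathUnitHom ≫ X.pathDbl.action) where
  ob := X.h₀.one
  ve := X.pathSqInv
  isHom := ⟨X.one_eval_src, X.one_eval_tgt⟩
  src_ob := X.h₀.src_one
  tgt_ob := X.h₀.tgt_one
  src_ve _ := rfl
  tgt_ve p := (X.eval_map_pathUnitHom_ver p).symm
  naturality_ob f _ _ := (X.h₀.comp_one _ _).trans (X.h₀.one_comp _ _).symm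
  naturality_ve p h h' := by
    refine ResSq.ext (congrArg X.v₀.single (X.hsrc.eval p))
      (X.eval_map_pathUnitHom_right p).symm ?_
    have e := X.eval_map_pathUnitHom_cell p
    exact (X.h₁.comp_one' (x := X.v₀.eval (p.map X.htgt.isHom)) (X.htgt.eval p) _).trans
      (e.symm.trans (X.h₁.one_comp' ((congrArg X.h₁.src e).trans (X.hsrc.eval p)) _).symm)

/-- The pseudo morphism from `X` to `pathDbl` sending vertical morphisms to paths of length one. -/
def pathUnit : PseudoHom X.toAlgebra X.pathDbl.toAlgebra where
  hom := X.pathUnitHom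
  cell := X.pathUnitCell
  isInvertible := by
    refine ⟨X.pathUnitCellInv, CatGraph.Trans.ext (funext fun x => X.h₀.comp_one' (X.h₀.tgt_one x) _)
        (funext fun p => ResSq.ext (X.eval_map_pathUnitHom_ver p).symm
          (X.eval_map_pathUnitHom_ver p).symm ?_),
      CatGraph.Trans.ext (funext fun x => X.h₀.comp_one' (X.h₀.tgt_one x) _)
        (funext fun p => ResSq.ext rfl rfl ?_)⟩
    · exact (X.h₁.comp_one' (X.h₁.tgt_one _) _).trans
        (congrArg (fun q => X.h₁.one (X.v₀.eval q)) (X.eval_map_pathUnitHom_ver p).symm)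
    · exact (X.h₁.comp_one' (X.h₁.tgt_one _) _).trans
        (congrArg X.h₁.one (X.v₀.eval_single _).symm)
  unit := CatGraph.Trans.ext rfl (funext fun j => ResSq.ext rfl
    (congrArg X.v₀.single (X.v₀.eval_single j)) rfl)
  mul := by
    refine CatGraph.Trans.ext (funext fun x => (X.h₀.comp_one' (X.h₀.tgt_one x) _).symm)
      (funext fun Q => ?_)
    -- Composing the comparison squares vertically along `Q` gives a square whose left side is the
    -- concatenation of `Q` and whose cell is a vertical composite of horizontal identities, hence a
    -- horizontal identity.
    have hl : (X.pathDbl.v₁.eval (Gph.Path.map X.pathUnitCell.isHom Q)).left =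
        X.v₀.flat Q := by
      refine (X.pathDbl.hsrc.eval _).trans
        ((congrArg _ (Gph.Path.ext (X.h₀.src_one _) ?_)).trans (CatStr.eval_pathCategory _ Q))
      exact (List.map_map (l := Q.edges)).trans (List.map_id _)
    have hc : (X.pathDbl.v₁.eval (Gph.Path.map X.pathUnitCell.isHom Q)).cell =
        X.h₁.one (X.v₀.eval (X.v₀.flat Q)) := by
      refine Eq.trans ?_ (congrArg X.h₁.one (X.v₀.eval_flat Q).symm)
      refine Eq.trans ?_ (X.hone.eval (Q.map X.v₀.eval_isFunctor.isHom)).symm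
      refine (X.pathProj.map_v₁.eval _).trans (congrArg X.v₁.eval ?_)
      exact Gph.Path.map_map_comm _ _ _ _ _ (fun _ => rfl) fun _ => rfl
    refine ResSq.ext hl.symm (congrArg X.v₀.single (X.v₀.eval_flat Q)) ?_
    exact hc.symm.trans (X.h₁.comp_one' ((congrArg X.h₁.tgt hc).trans
      ((X.h₁.tgt_one _).trans (X.v₀.eval_flat Q))) _).symm

end DblCat

/-! ### Calculus of commuting squares in a category -/

namespace CatStr

variable {O A O' A' : Type u}

open Classical in
/-- Composition of arrows, with a junk value for arrows that are not composable. -/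
noncomputable def cmp (C : CatStr O A) (f g : A) : A :=
  if h : C.tgt f = C.src g then C.comp f g h else f

theorem cmp_eq (C : CatStr O A) {f g : A} (h : C.tgt f = C.src g) : C.cmp f g = C.comp f g h :=
  dif_pos h

theorem src_cmp (C : CatStr O A) {f g : A} (h : C.tgt f = C.src g) :
    C.src (C.cmp f g) = C.src f := by rw [cmp_eq C h, C.src_comp]

theorem tgt_cmp (C : CatStr O A) {f g : A} (h : C.tgt f = C.src g) :
    C.tgt (C.cmp f g) = C.tgt g := by rw [cmp_eq C h, C.tgt_comp]

theorem cmp_assoc (C : CatStr O A) {f g k : A} (h : C.tgt f = C.src g) (h' : C.tgt g = C.src k) :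
    C.cmp (C.cmp f g) k = C.cmp f (C.cmp g k) := by
  have h₁ : C.tgt (C.comp f g h) = C.src k := by rw [C.tgt_comp, h']
  have h₂ : C.tgt f = C.src (C.comp g k h') := by rw [C.src_comp, h]
  rw [cmp_eq C h, cmp_eq C h', cmp_eq C h₁, cmp_eq C h₂, C.assoc]

theorem cmp_one (C : CatStr O A) {f : A} {x : O} (h : C.tgt f = x) : C.cmp f (C.one x) = f := by
  rw [cmp_eq C (by rw [C.src_one, h]), C.comp_one' h]

theorem one_cmp (C : CatStr O A) {f : A} {x : O} (h : C.src f = x) : C.cmp (C.one x) f = f := by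
  rw [cmp_eq C (by rw [C.tgt_one, h]), C.one_comp' h]

theorem IsInv.cancel {C : CatStr O A} {f g k : A} (hk : C.IsInv k) (hf : C.tgt f = C.src k)
    (hg : C.tgt g = C.src k) (h : C.cmp f k = C.cmp g k) : f = g := by
  obtain ⟨k', h₁, h₂, e, -⟩ := hk
  rw [← C.cmp_eq] at e
  rw [← C.cmp_one hf, ← e, ← C.cmp_assoc hf h₁, h, C.cmp_assoc hg h₁, e, C.cmp_one hg]

theorem IsInv.exists_cmp_eq {C : CatStr O A} {a k : A} (hk : C.IsInv k) (ha : C.tgt a = C.tgt k) :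
    ∃ b, C.tgt b = C.src k ∧ C.cmp b k = a := by
  obtain ⟨k', h₁, h₂, -, e⟩ := hk
  rw [← C.cmp_eq] at e
  refine ⟨C.cmp a k', (C.tgt_cmp (ha.trans h₁)).trans h₂, ?_⟩
  rw [C.cmp_assoc (ha.trans h₁) h₂, e, C.cmp_one ha]

/-- The composites of `f` and `g` and of `h` and `k` are defined and equal. -/
def Sqr (C : CatStr O A) (f g h k : A) : Prop :=
  C.tgt f = C.src g ∧ C.tgt h = C.src k ∧ C.cmp f g = C.cmp h k

namespace Sqr

variable {C : CatStr O A} {D : CatStr O' A'} {f g h k f' g' h' k' : A}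

theorem src_eq (s : C.Sqr f g h k) : C.src f = C.src h := by
  rw [← C.src_cmp s.1, s.2.2, C.src_cmp s.2.1]

theorem symm (s : C.Sqr f g h k) : C.Sqr h k f g := ⟨s.2.1, s.1, s.2.2.symm⟩

theorem comp (s : C.Sqr f g h k) (t : C.Sqr f' g' g k') (hf : C.tgt f = C.src f')
    (hk : C.tgt k = C.src k') : C.Sqr (C.comp f f' hf) g' h (C.comp k k' hk) := by
  obtain ⟨s₁, s₂, s₃⟩ := s
  obtain ⟨t₁, t₂, t₃⟩ := t
  refine ⟨by rw [C.tgt_comp, t₁], by rw [C.src_comp, s₂], ?_⟩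
  rw [← C.cmp_eq, ← C.cmp_eq, C.cmp_assoc hf t₁, t₃, ← C.cmp_assoc s₁ t₂, s₃, C.cmp_assoc s₂ hk]

theorem comp' (s : C.Sqr f g h k) (t : C.Sqr k g' h' k') (hg : C.tgt g = C.src g')
    (hh : C.tgt h = C.src h') : C.Sqr f (C.comp g g' hg) (C.comp h h' hh) k' :=
  (s.symm.comp t.symm hh hg).symm

theorem unique (s : C.Sqr f g h k) (t : C.Sqr f' g h k) (hg : C.IsInv g) : f = f' :=
  hg.cancel s.1 t.1 (s.2.2.trans t.2.2.symm)

theorem map {f₀ : O → O'} {f₁ : A → A'} (s : C.Sqr f g h k) (hf : IsFunctor C D f₀ f₁) :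
    D.Sqr (f₁ f) (f₁ g) (f₁ h) (f₁ k) := by
  obtain ⟨s₁, s₂, s₃⟩ := s
  refine ⟨hf.tgt_eq_src s₁, hf.tgt_eq_src s₂, ?_⟩
  rw [D.cmp_eq (hf.tgt_eq_src s₁), D.cmp_eq (hf.tgt_eq_src s₂), ← hf.map_comp _ _ s₁,
    ← hf.map_comp _ _ s₂, ← C.cmp_eq, ← C.cmp_eq, s₃]

/-- If `g'` is invertible, the left face of a cube commutes as soon as the other five do. -/
theorem cube {x y z x' y' z' w w' u u' : A} (top : C.Sqr x y z w) (bot : C.Sqr x' y' z' w')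
    (right : C.Sqr w u' u w') (front : C.Sqr y u' k y') (back : C.Sqr z u h z') (hy : C.IsInv y') :
    C.Sqr x k h x' := by
  have hxk : C.tgt x = C.src k := top.1.trans front.src_eq
  have hhx : C.tgt h = C.src x' := by rw [bot.src_eq, back.2.1]
  refine ⟨hxk, hhx, hy.cancel ((C.tgt_cmp hxk).trans front.2.1) ((C.tgt_cmp hhx).trans bot.1) ?_⟩
  -- After composition with `y'`, one path around the left face is carried to the other across the
  -- front, top, right, back and bottom faces in turn; `y'` is then cancelled.
  rw [C.cmp_assoc hxk front.2.1, ← front.2.2, ← C.cmp_assoc top.1 front.1, top.2.2,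
    C.cmp_assoc top.2.1 right.1, right.2.2, ← C.cmp_assoc back.1 right.2.1, back.2.2,
    C.cmp_assoc back.2.1 bot.2.1, ← bot.2.2, C.cmp_assoc hhx bot.1]

end Sqr

theorem IsInv.exists_sqr {C : CatStr O A} {k f a : A} (hk : C.IsInv k) (hf : C.tgt f = C.src a)
    (ha : C.tgt a = C.tgt k) : ∃ b, C.Sqr b k f a := by
  obtain ⟨b, hb, e⟩ := hk.exists_cmp_eq (a := C.cmp f a) ((C.tgt_cmp hf).trans ha)
  exact ⟨b, hb, hf, e⟩

end CatStr

namespace DblCat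

/-- By interchange, commuting diagrams of horizontal composites paste vertically. -/
theorem sqr_comp {Z : DblCat.{u}} {f g h k f' g' h' k' : Z.Sq} (s : Z.h₁.Sqr f g h k)
    (s' : Z.h₁.Sqr f' g' h' k') (hf : Z.v₁.tgt f = Z.v₁.src f') (hg : Z.v₁.tgt g = Z.v₁.src g')
    (hh : Z.v₁.tgt h = Z.v₁.src h') (hk : Z.v₁.tgt k = Z.v₁.src k') :
    Z.h₁.Sqr (Z.v₁.comp f f' hf) (Z.v₁.comp g g' hg) (Z.v₁.comp h h' hh) (Z.v₁.comp k k' hk) := by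
  have comm : ∀ {a b a' b' : Z.Sq} (h : Z.h₁.tgt a = Z.h₁.src b) (h' : Z.h₁.tgt a' = Z.h₁.src b')
      (ha : Z.v₁.tgt a = Z.v₁.src a') (hb : Z.v₁.tgt b = Z.v₁.src b'),
      Z.h₁.tgt (Z.v₁.comp a a' ha) = Z.h₁.src (Z.v₁.comp b b' hb) := by
    intro a b a' b' h h' ha hb
    rw [Z.htgt.map_comp, Z.hsrc.map_comp]
    exact Z.v₀.comp_congr h h' _ _
  obtain ⟨s₁, s₂, s₃⟩ := s
  obtain ⟨t₁, t₂, t₃⟩ := s'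
  have c₁ := comm s₁ t₁ hf hg
  have c₂ := comm s₂ t₂ hh hk
  rw [Z.h₁.cmp_eq s₁, Z.h₁.cmp_eq s₂] at s₃
  rw [Z.h₁.cmp_eq t₁, Z.h₁.cmp_eq t₂] at t₃
  refine ⟨c₁, c₂, ?_⟩
  rw [Z.h₁.cmp_eq c₁, Z.h₁.cmp_eq c₂]
  have k₁ : Z.v₁.tgt (Z.h₁.comp f g s₁) = Z.v₁.src (Z.h₁.comp f' g' t₁) := by
    rw [Z.vtgt.map_comp, Z.vsrc.map_comp]
    exact Z.h₀.comp_congr hf hg _ _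
  have k₂ : Z.v₁.tgt (Z.h₁.comp h k s₂) = Z.v₁.src (Z.h₁.comp h' k' t₂) := by
    rw [← s₃, ← t₃, k₁]
  rw [← Z.interchange f g f' g' s₁ t₁ hf hg k₁ c₁, ← Z.interchange h k h' k' s₂ t₂ hh hk k₂ c₂]
  exact Z.v₁.comp_congr s₃ t₃ _ _

end DblCat

/-! ### Strict extension of pseudo morphisms along `pathUnit` -/

namespace PseudoHom

variable {X Z : DblCat.{u}} (P : PseudoHom X.toAlgebra Z.toAlgebra)

/-- The underlying internal functor of a pseudo morphism. -/
def fn : CatGraph.Hom X.toCatGraph Z.toCatGraph := P.hom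

/-- The comparison square of a pseudo morphism at a path. -/
def sqAt (p : X.v₀.Path) : Z.Sq := P.cell.ve p

/-- The unit law at an object. The comparison squares therefore have horizontal identities as top
and bottom, and only vertical composition is preserved weakly. -/
theorem cell_ob (x : X.Obj) : P.cell.ob x = Z.h₀.one (P.fn.obj x) :=
  congrFun (congrArg CatGraph.Trans.ob P.unit) x

theorem sqAt_single (j : X.Ver) : P.sqAt (X.v₀.single j) = Z.h₁.one (P.fn.ver j) :=
  congrFun (congrArg CatGraph.Trans.ve P.unit) j

theorem src_sqAt (p : X.v₀.Path) : Z.h₁.src (P.sqAt p) = Z.v₀.eval (p.map P.fn.map_v₀) :=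
  P.cell.src_ve p

theorem tgt_sqAt (p : X.v₀.Path) : Z.h₁.tgt (P.sqAt p) = P.fn.ver (X.v₀.eval p) :=
  P.cell.tgt_ve p

theorem vsrc_sqAt (p : X.v₀.Path) : Z.v₁.src (P.sqAt p) = Z.h₀.one (P.fn.obj p.start) :=
  (P.cell.isHom.src p).trans (P.cell_ob _)

theorem vtgt_sqAt (p : X.v₀.Path) :
    Z.v₁.tgt (P.sqAt p) = Z.h₀.one (P.fn.obj (X.v₀.endpt p.start p.edges)) :=
  (P.cell.isHom.tgt p).trans (P.cell_ob _)

theorem isInv_sqAt (p : X.v₀.Path) : Z.h₁.IsInv (P.sqAt p) := by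
  obtain ⟨ψ, h₁, h₂⟩ := P.isInvertible
  have e₁ := congrFun (congrArg CatGraph.Trans.ve h₁) p
  have e₂ := congrFun (congrArg CatGraph.Trans.ve h₂) p
  exact ⟨ψ.ve p, (P.cell.tgt_ve p).trans (ψ.src_ve p).symm,
    (ψ.tgt_ve p).trans (P.cell.src_ve p).symm, e₁.trans (congrArg Z.h₁.one (P.cell.src_ve p).symm),
    e₂.trans (congrArg Z.h₁.one (P.cell.tgt_ve p).symm)⟩

theorem sqAt_naturality (q : X.v₁.Path) :
    Z.h₁.Sqr (Z.v₁.eval (q.map P.fn.map_v₁)) (P.sqAt (q.map X.htgt.isHom))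
      (P.sqAt (q.map X.hsrc.isHom)) (P.fn.sq (X.v₁.eval q)) := by
  have h : Z.h₁.tgt (Z.v₁.eval (q.map P.fn.map_v₁)) =
      Z.h₁.src (P.sqAt (q.map X.htgt.isHom)) := by
    rw [P.src_sqAt, Z.htgt.eval]
    exact congrArg Z.v₀.eval (Gph.Path.map_map_comm _ _ _ _ _ P.fn.map_h₀.tgt P.fn.map_h₁.tgt)
  have h' : Z.h₁.tgt (P.sqAt (q.map X.hsrc.isHom)) = Z.h₁.src (P.fn.sq (X.v₁.eval q)) :=
    (P.tgt_sqAt _).trans ((congrArg P.fn.ver (X.hsrc.eval q).symm).trans (P.fn.map_h₁.src _).symm)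
  refine ⟨h, h', ?_⟩
  rw [Z.h₁.cmp_eq h, Z.h₁.cmp_eq h']
  exact P.cell.naturality_ve q h h'

/-- This is the multiplication law at the path consisting of the two paths `p` and `q`. -/
theorem exists_sqAt_append (p q : X.v₀.Path) (h : X.v₀.pathCategory.tgt p = X.v₀.pathCategory.src q)
    (hk : Z.v₁.tgt (P.sqAt p) = Z.v₁.src (P.sqAt q))
    (hpq : X.v₀.IsPath p.start [X.v₀.eval p, X.v₀.eval q]) :
    ∃ h', P.sqAt (X.v₀.pathCategory.comp p q h) =
      Z.h₁.comp (Z.v₁.comp (P.sqAt p) (P.sqAt q) hk) (P.sqAt ⟨p.start, _, hpq⟩) h' := by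
  let Q : X.v₀.pathGph.Path := ⟨p.start, [p, q], rfl, h.symm, trivial⟩
  have e := congrFun (congrArg CatGraph.Trans.ve P.mul) Q
  have e₁ : X.v₀.flat Q = X.v₀.pathCategory.comp p q h :=
    Gph.Path.ext rfl (congrArg (p.edges ++ ·) (List.append_nil q.edges))
  have e₂ : Z.v₁.eval (Q.map P.cell.isHom) = Z.v₁.comp (P.sqAt p) (P.sqAt q) hk :=
    Z.v₁.comp_congr rfl (Z.v₁.comp_one _ _) _ _
  have h₁ : Z.h₁.tgt (Z.v₁.eval (Q.map P.cell.isHom)) =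
      Z.h₁.src (P.sqAt ⟨p.start, _, hpq⟩) := by
    rw [Z.htgt.eval, P.src_sqAt]
    refine congrArg Z.v₀.eval (Gph.Path.ext (P.cell.tgt_ob _) ?_)
    exact congrArg₂ (fun y z => [y, z]) (P.tgt_sqAt p) (P.tgt_sqAt q)
  refine ⟨e₂ ▸ h₁, ?_⟩
  exact ((congrArg P.sqAt e₁).symm.trans e).trans (Z.h₁.comp_congr e₂ rfl h₁ _)

end PseudoHom

theorem Gph.IsHom.isFunctor_map {V E V' E' : Type u} {G : Gph V E} {H : Gph V' E'} {f₀ : V → V'}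
    {f₁ : E → E'} (hf : IsHom G H f₀ f₁) :
    CatStr.IsFunctor G.pathCategory H.pathCategory f₀ (Path.map hf) :=
  ⟨hf.path.src, hf.path.tgt, fun _ => rfl, fun _ _ _ _ => Path.ext rfl List.map_append⟩

theorem CatStr.Sqr.eq_of_one {O A : Type u} {C : CatStr O A} {f k : A} {x y : O}
    (s : C.Sqr f (C.one x) (C.one y) k) : f = k := by
  obtain ⟨s₁, s₂, s₃⟩ := s
  rwa [C.cmp_one (s₁.trans (C.src_one x)), C.one_cmp ((C.tgt_one y).symm.trans s₂).symm] at s₃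

theorem CatStr.Sqr.refl_one {O A : Type u} (C : CatStr O A) {f : A} {x y : O} (hx : C.src f = x)
    (hy : C.tgt f = y) : C.Sqr f (C.one y) (C.one x) f :=
  ⟨hy.trans (C.src_one y).symm, (C.tgt_one x).trans hx.symm, (C.cmp_one hy).trans
    (C.one_cmp hx).symm⟩

theorem CatStr.Sqr.congr {O A : Type u} {C : CatStr O A} {f g h k f' g' h' k' : A}
    (s : C.Sqr f g h k) (hf : f = f') (hg : g = g') (hh : h = h') (hk : k = k') :
    C.Sqr f' g' h' k' := by
  subst hf hg hh hk
  exact s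

theorem CatStr.eval_pair {O A : Type u} (C : CatStr O A) {v : O} {a b : A}
    (h : C.IsPath v [a, b]) (hab : C.tgt a = C.src b) : C.eval ⟨v, [a, b], h⟩ = C.comp a b hab :=
  C.comp_congr rfl (C.comp_one _ _) _ _

namespace PseudoHom

variable {X Z : DblCat.{u}} (P : PseudoHom X.toAlgebra Z.toAlgebra)

/-- Naturality of the comparison at a path of two squares. The sides are free variables so that the
left and right sides of lifted squares, which agree with those of their cells only up to equality,
can be substituted. -/
theorem sqAt_naturality_pair (α β : X.Sq) (h : X.v₁.tgt α = X.v₁.src β)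
    (hF : Z.v₁.tgt (P.fn.sq α) = Z.v₁.src (P.fn.sq β)) {x y : X.Obj} {i j i' j' : X.Ver}
    (hx : X.h₀.src (X.v₁.src α) = x) (hy : X.h₀.tgt (X.v₁.src α) = y) (hi : X.h₁.src α = i)
    (hj : X.h₁.tgt α = j) (hi' : X.h₁.src β = i') (hj' : X.h₁.tgt β = j')
    (hs : X.v₀.IsPath x [i, i']) (ht : X.v₀.IsPath y [j, j']) :
    Z.h₁.Sqr (Z.v₁.comp (P.fn.sq α) (P.fn.sq β) hF) (P.sqAt ⟨y, [j, j'], ht⟩)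
      (P.sqAt ⟨x, [i, i'], hs⟩) (P.fn.sq (X.v₁.comp α β h)) := by
  subst hx hy hi hj hi' hj'
  exact (P.sqAt_naturality ⟨X.v₁.src α, [α, β], rfl, h.symm, trivial⟩).congr
    (Z.v₁.eval_pair _ hF) rfl rfl (congrArg P.fn.sq (X.v₁.eval_pair _ h))

/-- The square `γ` corresponds to the square `p` of `pathDbl` under a pseudo morphism. -/
def IsExt (p : X.ResSq X.v₀.eval) (γ : Z.Sq) : Prop :=
  Z.h₁.Sqr γ (P.sqAt p.right) (P.sqAt p.left) (P.fn.sq p.cell)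

variable {P}

/-- The comparison square on the right is invertible, so conjugating the image of the cell gives a
solution. In `pathDbl` every square is such a conjugate (`IsExt.self`), which leaves a strict
extension no other choice. -/
theorem exists_isExt (P : PseudoHom X.toAlgebra Z.toAlgebra) (p : X.ResSq X.v₀.eval) :
    ∃ γ, P.IsExt p γ :=
  (P.isInv_sqAt p.right).exists_sqr
    ((P.tgt_sqAt _).trans ((congrArg P.fn.ver p.src_cell).symm.trans (P.fn.map_h₁.src _).symm))
    ((P.fn.map_h₁.tgt _).trans ((congrArg P.fn.ver p.tgt_cell).trans (P.tgt_sqAt _).symm))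

namespace IsExt

variable {p q : X.ResSq X.v₀.eval} {γ δ : Z.Sq}

theorem unique (h : P.IsExt p γ) (h' : P.IsExt p δ) : γ = δ :=
  CatStr.Sqr.unique h h' (P.isInv_sqAt _)

/-- Taking tops of the defining equation turns both comparison squares into horizontal identities.
-/
theorem vsrc (h : P.IsExt p γ) : Z.v₁.src γ = P.fn.hor (X.v₁.src p.cell) := by
  have := h.map Z.vsrc
  rw [P.vsrc_sqAt, P.vsrc_sqAt] at this
  exact this.eq_of_one.trans (P.fn.map_v₁.src _)

theorem vtgt (h : P.IsExt p γ) : Z.v₁.tgt γ = P.fn.hor (X.v₁.tgt p.cell) := by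
  have := h.map Z.vtgt
  rw [P.vtgt_sqAt, P.vtgt_sqAt] at this
  exact this.eq_of_one.trans (P.fn.map_v₁.tgt _)

theorem src (h : P.IsExt p γ) : Z.h₁.src γ = Z.v₀.eval (p.left.map P.fn.map_v₀) :=
  h.src_eq.trans (P.src_sqAt _)

theorem tgt (h : P.IsExt p γ) : Z.h₁.tgt γ = Z.v₀.eval (p.right.map P.fn.map_v₀) :=
  h.1.trans (P.src_sqAt _)

theorem hone (l : X.v₀.Path) :
    P.IsExt (X.pathDbl.h₁.one l) (Z.h₁.one (Z.v₀.eval (l.map P.fn.map_v₀))) := by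
  have h : Z.h₁.tgt (P.sqAt l) = Z.h₁.src (Z.h₁.one (P.fn.ver (X.v₀.eval l))) :=
    (P.tgt_sqAt l).trans (Z.h₁.src_one _).symm
  have e : P.fn.sq (X.h₁.one (X.v₀.eval l)) = Z.h₁.one (P.fn.ver (X.v₀.eval l)) :=
    P.fn.map_h₁.one _
  refine ⟨(Z.h₁.tgt_one _).trans (P.src_sqAt l).symm, h.trans (congrArg Z.h₁.src e.symm), ?_⟩
  exact (Z.h₁.one_cmp (P.src_sqAt l)).trans ((Z.h₁.cmp_one (P.tgt_sqAt l)).symm.trans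
    (congrArg (Z.h₁.cmp (P.sqAt l)) e.symm))

/-- The two defining equations paste along the comparison square of the common side. -/
theorem hcomp (h : P.IsExt p γ) (h' : P.IsExt q δ) (hpq : p.right = q.left)
    (hγδ : Z.h₁.tgt γ = Z.h₁.src δ) :
    P.IsExt (X.pathDbl.h₁.comp p q hpq) (Z.h₁.comp γ δ hγδ) := by
  obtain ⟨l, m, α, hl, hm⟩ := p
  obtain ⟨m', n, β, hm', hn⟩ := q
  obtain rfl : m = m' := hpq
  have hαβ : X.h₁.tgt α = X.h₁.src β := hm.trans hm'.symm
  have := CatStr.Sqr.comp h h' hγδ (P.fn.map_h₁.tgt_eq_src hαβ)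
  have e : P.fn.sq (X.h₁.comp α β hαβ) = _ := P.fn.map_h₁.map_comp α β hαβ
  change Z.h₁.Sqr _ (P.sqAt n) (P.sqAt l) (P.fn.sq (X.h₁.comp α β hαβ))
  rw [e]
  exact this

theorem vone (P : PseudoHom X.toAlgebra Z.toAlgebra) (f : X.Hor) :
    P.IsExt (X.pathDbl.v₁.one f) (Z.v₁.one (P.fn.hor f)) :=
  P.sqAt_naturality ⟨f, [], trivial⟩

/-- Stacking the two defining equations conjugates by vertical composites of comparison squares.
Naturality at the pair of cells and the multiplication law for concatenated sides then supply the
comparison squares of the whole paths. -/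
theorem vcomp (h : P.IsExt p γ) (h' : P.IsExt q δ) (hpq : X.v₁.tgt p.cell = X.v₁.src q.cell)
    (hγδ : Z.v₁.tgt γ = Z.v₁.src δ) :
    P.IsExt (X.pathDbl.v₁.comp p q hpq) (Z.v₁.comp γ δ hγδ) := by
  have hF : Z.v₁.tgt (P.fn.sq p.cell) = Z.v₁.src (P.fn.sq q.cell) :=
    (P.fn.map_v₁.tgt _).trans ((congrArg P.fn.hor hpq).trans (P.fn.map_v₁.src _).symm)
  have he := X.v₀.eval_isFunctor
  have hl : X.v₀.pathCategory.tgt p.left = X.v₀.pathCategory.src q.left := by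
    rw [p.tgt_left he, q.src_left he, hpq]
  have hr : X.v₀.pathCategory.tgt p.right = X.v₀.pathCategory.src q.right := by
    rw [p.tgt_right he, q.src_right he, hpq]
  have kl : Z.v₁.tgt (P.sqAt p.left) = Z.v₁.src (P.sqAt q.left) := by
    rw [P.vtgt_sqAt, P.vsrc_sqAt]
    exact congrArg (fun x => Z.h₀.one (P.fn.obj x)) hl
  have kr : Z.v₁.tgt (P.sqAt p.right) = Z.v₁.src (P.sqAt q.right) := by
    rw [P.vtgt_sqAt, P.vsrc_sqAt]
    exact congrArg (fun x => Z.h₀.one (P.fn.obj x)) hr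
  have pair : ∀ {l m : X.v₀.Path}, X.v₀.pathCategory.tgt l = X.v₀.pathCategory.src m →
      X.v₀.IsPath l.start [X.v₀.eval l, X.v₀.eval m] := fun {l m} h =>
    ⟨X.v₀.src_eval l, (X.v₀.src_eval m).trans (h.symm.trans (X.v₀.tgt_eval l).symm), trivial⟩
  obtain ⟨al, el⟩ := P.exists_sqAt_append p.left q.left hl kl (pair hl)
  obtain ⟨ar, er⟩ := P.exists_sqAt_append p.right q.right hr kr (pair hr)
  have s := DblCat.sqr_comp h h' hγδ kr kl hF
  have t := P.sqAt_naturality_pair p.cell q.cell hpq hF (p.src_left he).symm (p.src_right he).symm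
    p.src_cell p.tgt_cell q.src_cell q.tgt_cell (pair hl) (pair hr)
  exact (s.comp' t ar al).congr rfl er.symm el.symm rfl

theorem pathUnitHom (P : PseudoHom X.toAlgebra Z.toAlgebra) (α : X.Sq) :
    P.IsExt (X.pathUnitHom.sq α) (P.fn.sq α) := by
  have h₁ : P.sqAt (X.v₀.single (X.h₁.tgt α)) = _ := P.sqAt_single _
  have h₂ : P.sqAt (X.v₀.single (X.h₁.src α)) = _ := P.sqAt_single _
  exact (CatStr.Sqr.refl_one Z.h₁ (P.fn.map_h₁.src α) (P.fn.map_h₁.tgt α)).congr rfl h₁.symm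
    h₂.symm rfl

theorem pathSq (P : PseudoHom X.toAlgebra Z.toAlgebra) (p : X.v₀.Path) :
    P.IsExt (X.pathSq p) (P.sqAt p) := by
  have h : P.sqAt (X.v₀.single (X.v₀.eval p)) = _ := P.sqAt_single _
  refine CatStr.Sqr.congr (f := P.sqAt p) (g := Z.h₁.one (P.fn.ver (X.v₀.eval p)))
    (h := P.sqAt p) (k := Z.h₁.one (P.fn.ver (X.v₀.eval p))) ⟨?_, ?_, rfl⟩ rfl h.symm rfl
    (P.fn.map_h₁.one _).symm
  · exact (P.tgt_sqAt p).trans (Z.h₁.src_one _).symm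
  · exact (P.tgt_sqAt p).trans (Z.h₁.src_one _).symm

/-- In `pathDbl`, every square is conjugate to a square between paths of length one. -/
theorem self (p : X.ResSq X.v₀.eval) : X.pathUnit.IsExt p p := by
  have h₁ : X.pathDbl.h₁.tgt p = X.pathDbl.h₁.src (X.pathSq p.right) := rfl
  have h₂ : X.pathDbl.h₁.tgt (X.pathSq p.left) = X.pathDbl.h₁.src (X.pathUnitHom.sq p.cell) :=
    congrArg X.v₀.single p.src_cell.symm
  refine ⟨h₁, h₂, (X.pathDbl.h₁.cmp_eq h₁).trans (Eq.trans ?_ (X.pathDbl.h₁.cmp_eq h₂).symm)⟩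
  exact DblCat.ResSq.ext rfl (congrArg X.v₀.single p.tgt_cell.symm)
    ((X.h₁.comp_one' p.tgt_cell _).trans (X.h₁.one_comp' p.src_cell _).symm)

end IsExt

theorem ext_of_eq {A B : Mbar.{u}.Algebra} {P Q : PseudoHom A B} (h : P.hom = Q.hom)
    (ho : P.cell.ob = Q.cell.ob) (hv : P.cell.ve = Q.cell.ve) : P = Q := by
  obtain ⟨F, φ, _, _, _⟩ := P
  obtain ⟨G, ψ, _, _, _⟩ := Q
  obtain rfl : F = G := h
  obtain rfl : φ = ψ := CatGraph.Trans.ext ho hv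
  rfl

/-- Every pseudo morphism extends along `pathUnit` to a double functor. -/
theorem exists_extension (P : PseudoHom X.toAlgebra Z.toAlgebra) :
    ∃ G : X.pathDbl ⟶ Z, X.pathUnit.compStrict (DblCat.toAlgebraMap G) = P := by
  choose g hg using P.exists_isExt
  -- Each remaining axiom equates two squares that correspond to the same square of `pathDbl`, so it
  -- follows from `IsExt.unique`.
  let G : X.pathDbl ⟶ Z := DblCat.Hom.mk (X := X.pathDbl) P.fn.obj P.fn.hor
    (fun l => Z.v₀.eval (l.map P.fn.map_v₀)) g
    (P.fn.map_v₀.isFunctor_map.comp' Z.v₀.eval_isFunctor)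
    ⟨fun p => (hg p).vsrc, fun p => (hg p).vtgt, fun f => (hg _).unique (IsExt.vone P f),
      fun p q h h' => (hg _).unique ((hg p).vcomp (hg q) h h')⟩
    P.fn.map_h₀
    ⟨fun p => (hg p).src, fun p => (hg p).tgt, fun l => (hg _).unique (IsExt.hone l),
      fun p q h h' => (hg _).unique ((hg p).hcomp (hg q) h h')⟩
  refine ⟨G, ext_of_eq (CatGraph.Hom.ext rfl rfl (funext fun j => Z.v₀.eval_single _)
    (funext fun α => (hg _).unique (IsExt.pathUnitHom P α))) (funext fun x => ?_)
    (funext fun p => (hg _).unique (IsExt.pathSq P p))⟩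
  exact (P.fn.map_h₀.one x).trans (P.cell_ob x).symm

/-- In `pathDbl` a path is the vertical composite of its edges, each taken as a path of length one,
and strict morphisms preserve such composites. -/
theorem strict_ver (H : X.pathDbl.toAlgebra ⟶ Z.toAlgebra) (l : X.v₀.Path) :
    H.f.ver l = Z.v₀.eval (l.map (X.pathUnit.compStrict H).fn.map_v₀) := by
  have e := congrFun (congrArg CatGraph.Hom.ver H.h) (l.map X.pathUnitHom.map_v₀)
  refine (congrArg H.f.ver (X.eval_map_pathUnitHom_ver l).symm).trans (e.symm.trans ?_)
  exact congrArg Z.v₀.eval (Gph.Path.map_map_eq _ H.f.map_v₀ _ _ (fun _ => rfl) fun _ => rfl)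

/-- A strict morphism preserves the presentation of a square as a conjugate of its cell, so its
value there is determined by its restriction along `pathUnit`. -/
theorem strict_isExt (H : X.pathDbl.toAlgebra ⟶ Z.toAlgebra) (p : X.ResSq X.v₀.eval) :
    (X.pathUnit.compStrict H).IsExt p (H.f.sq p) :=
  (IsExt.self p).map H.f.map_h₁

/-- The extension along `pathUnit` of a pseudo morphism is unique. -/
theorem eq_of_compStrict_eq {G G' : X.pathDbl.toAlgebra ⟶ Z.toAlgebra}
    (h : X.pathUnit.compStrict G = X.pathUnit.compStrict G') : G = G' := by
  have hfn : (X.pathUnit.compStrict G).fn = (X.pathUnit.compStrict G').fn := congrArg fn h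
  refine Monad.Algebra.Hom.ext (CatGraph.Hom.ext ?_ ?_ (funext fun l => ?_) (funext fun p => ?_))
  · have e := congrArg CatGraph.Hom.obj hfn
    exact e
  · have e := congrArg CatGraph.Hom.hor hfn
    exact e
  · have e : ∀ {F F' : CatGraph.Hom X.toCatGraph Z.toCatGraph}, F = F' →
        Z.v₀.eval (Gph.Path.map F.map_v₀ l) = Z.v₀.eval (Gph.Path.map F'.map_v₀ l) := by
      rintro _ _ rfl
      rfl
    exact (strict_ver G l).trans ((e hfn).trans (strict_ver G' l).symm)
  · refine (strict_isExt G p).unique ?_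
    rw [h]
    exact strict_isExt G' p

end PseudoHom

/-! ### Extension of 2-cells and the universal property of `pathUnit` -/

namespace PseudoHom

variable {X Z : DblCat.{u}} {G G' : X.pathDbl.toAlgebra ⟶ Z.toAlgebra}

namespace TwoCell

variable (β : TwoCell (X.pathUnit.compStrict G) (X.pathUnit.compStrict G'))

/-- The vertical composites of the components of a 2-cell along a path. -/
def pathVe (l : X.v₀.Path) : Z.Sq := Z.v₁.eval (l.map β.trans.isHom)

theorem src_pathVe (l : X.v₀.Path) : Z.h₁.src (β.pathVe l) = G.f.ver l :=
  (Z.hsrc.eval _).trans ((congrArg Z.v₀.eval (Gph.Path.map_map_eq β.trans.isHom Z.hsrc.isHom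
    (X.pathUnit.compStrict G).fn.map_v₀ l β.trans.src_ob β.trans.src_ve)).trans
    (strict_ver G l).symm)

theorem tgt_pathVe (l : X.v₀.Path) : Z.h₁.tgt (β.pathVe l) = G'.f.ver l :=
  (Z.htgt.eval _).trans ((congrArg Z.v₀.eval (Gph.Path.map_map_eq β.trans.isHom Z.htgt.isHom
    (X.pathUnit.compStrict G').fn.map_v₀ l β.trans.tgt_ob β.trans.tgt_ve)).trans
    (strict_ver G' l).symm)

/-- This is the compatibility law of a 2-cell with the two pseudo structures, evaluated at a path.
-/
theorem sqr_pathVe (l : X.v₀.Path) :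
    Z.h₁.Sqr ((X.pathUnit.compStrict G).sqAt l) (β.trans.ve (X.v₀.eval l)) (β.pathVe l)
      ((X.pathUnit.compStrict G').sqAt l) := by
  have e := congrFun (congrArg CatGraph.Trans.ve β.compat) l
  have h₁ := ((X.pathUnit.compStrict G).tgt_sqAt l).trans (β.trans.src_ve (X.v₀.eval l)).symm
  have h₂ : Z.h₁.tgt (β.pathVe l) = Z.h₁.src ((X.pathUnit.compStrict G').sqAt l) :=
    (β.tgt_pathVe l).trans ((strict_ver G' l).trans ((X.pathUnit.compStrict G').src_sqAt l).symm)
  exact ⟨h₁, h₂, (Z.h₁.cmp_eq h₁).trans (Eq.trans e (Z.h₁.cmp_eq h₂).symm)⟩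

theorem sqr_naturality (α : X.Sq) :
    Z.h₁.Sqr ((X.pathUnit.compStrict G).fn.sq α) (β.trans.ve (X.h₁.tgt α))
      (β.trans.ve (X.h₁.src α)) ((X.pathUnit.compStrict G').fn.sq α) := by
  have h₁ : Z.h₁.tgt ((X.pathUnit.compStrict G).fn.sq α) = Z.h₁.src (β.trans.ve (X.h₁.tgt α)) :=
    ((X.pathUnit.compStrict G).fn.map_h₁.tgt α).trans (β.trans.src_ve (X.h₁.tgt α)).symm
  have h₂ : Z.h₁.tgt (β.trans.ve (X.h₁.src α)) = Z.h₁.src ((X.pathUnit.compStrict G').fn.sq α) :=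
    (β.trans.tgt_ve (X.h₁.src α)).trans ((X.pathUnit.compStrict G').fn.map_h₁.src α).symm
  exact ⟨h₁, h₂, (Z.h₁.cmp_eq h₁).trans
    ((β.trans.naturality_ve α h₁ h₂).trans (Z.h₁.cmp_eq h₂).symm)⟩

/-- Naturality at the cell is transferred to `p` by a cube: its top and bottom present the values of
`G` and `G'` as conjugates, and its front and back are compatibility with the comparison squares of
the two sides. -/
theorem sqr_pathVe_naturality (p : X.ResSq X.v₀.eval) :
    Z.h₁.Sqr (G.f.sq p) (β.pathVe p.right) (β.pathVe p.left) (G'.f.sq p) :=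
  CatStr.Sqr.cube (strict_isExt G p) (strict_isExt G' p) (β.sqr_naturality p.cell)
    ((β.sqr_pathVe p.right).congr rfl (congrArg β.trans.ve p.tgt_cell.symm) rfl rfl)
    ((β.sqr_pathVe p.left).congr rfl (congrArg β.trans.ve p.src_cell.symm) rfl rfl)
    ((X.pathUnit.compStrict G').isInv_sqAt _)

/-- The extension of a 2-cell along `pathUnit`. -/
def extendTrans : CatGraph.Trans G.f G'.f where
  ob := β.trans.ob
  ve := β.pathVe
  isHom := ⟨fun l => Z.v₁.src_eval (l.map β.trans.isHom), fun l =>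
    (Z.v₁.tgt_eval (l.map β.trans.isHom)).trans (β.trans.isHom.endpt l.start l.edges)⟩
  src_ob := β.trans.src_ob
  tgt_ob := β.trans.tgt_ob
  src_ve := β.src_pathVe
  tgt_ve := β.tgt_pathVe
  naturality_ob := β.trans.naturality_ob
  naturality_ve p h h' := by
    obtain ⟨h₁, h₂, e⟩ := β.sqr_pathVe_naturality p
    exact (Z.h₁.cmp_eq h₁).symm.trans (e.trans (Z.h₁.cmp_eq h₂))

theorem pathVe_flat (Q : X.v₀.pathGph.Path) :
    β.pathVe (X.v₀.flat Q) = Z.v₁.eval (Q.map β.extendTrans.isHom) := by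
  refine (congrArg Z.v₁.eval (CatGraph.flat_map β.trans.isHom Q).symm).trans
    ((Z.v₁.eval_flat _).trans (congrArg Z.v₁.eval ?_))
  exact Gph.Path.map_map_eq β.trans.isHom.path Z.v₁.eval_isFunctor.isHom β.extendTrans.isHom Q
    (fun _ => rfl) fun _ => rfl

/-- The extension of a 2-cell of pseudo morphisms along `pathUnit`. -/
def extend : TwoCell (ofStrict G) (ofStrict G') where
  trans := β.extendTrans
  compat := by
    refine CatGraph.Trans.ext (funext fun x => ?_) (funext fun Q => ?_)
    · exact (Z.h₀.one_comp' (β.trans.src_ob x) _).trans (Z.h₀.comp_one' (β.trans.tgt_ob x) _).symm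
    · have e₀ : X.pathDbl.v₀.eval Q = X.v₀.flat Q := CatStr.eval_pathCategory _ Q
      have e := (congrArg β.pathVe e₀).trans (β.pathVe_flat Q)
      refine (Z.h₁.one_comp' ?_ _).trans (e.trans (Z.h₁.comp_one' ?_ _).symm)
      · exact (β.src_pathVe _).trans (congrFun (congrArg CatGraph.Hom.ver G.h) Q).symm
      · exact (congrArg Z.h₁.tgt e).symm.trans ((β.tgt_pathVe _).trans
          (congrFun (congrArg CatGraph.Hom.ver G'.h) Q).symm)

end TwoCell

/-- Between strict morphisms the compatibility law has identity structure cells, so the components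
of a 2-cell respect vertical composition. -/
theorem ve_eval_of_strict {α : TwoCell (ofStrict G) (ofStrict G')} (Q : X.v₀.pathGph.Path) :
    α.trans.ve (X.pathDbl.v₀.eval Q) = Z.v₁.eval (Q.map α.trans.isHom) := by
  have e := congrFun (congrArg CatGraph.Trans.ve α.compat) Q
  have hs : Z.h₁.src (α.trans.ve (X.pathDbl.v₀.eval Q)) = (Mbar.map G.f ≫ Z.action).ver Q :=
    (α.trans.src_ve _).trans (congrFun (congrArg CatGraph.Hom.ver G.h) Q).symm
  have ht : Z.h₁.tgt (Z.v₁.eval (Q.map α.trans.isHom)) = (Mbar.map G'.f ≫ Z.action).ver Q :=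
    (Z.htgt.eval _).trans (congrArg Z.v₀.eval (Gph.Path.map_map_eq α.trans.isHom Z.htgt.isHom
      G'.f.map_v₀ Q α.trans.tgt_ob α.trans.tgt_ve))
  exact (Z.h₁.one_comp' hs ((Z.h₁.tgt_one _).trans hs.symm)).symm.trans
    (Eq.trans e (Z.h₁.comp_one' ht (ht.trans (Z.h₁.src_one _).symm)))

/-- A path is the composite of its edges, so a 2-cell between strict morphisms is determined by its
components at paths of length one. -/
theorem ve_eq_of_strict {α : TwoCell (ofStrict G) (ofStrict G')}
    {β : TwoCell (X.pathUnit.compStrict G) (X.pathUnit.compStrict G')}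
    (h : α.trans.whiskerLeft X.pathUnit.hom = β.trans) (l : X.v₀.Path) :
    α.trans.ve l = β.pathVe l := by
  refine (congrArg α.trans.ve (X.eval_map_pathUnitHom_ver l).symm).trans
    ((ve_eval_of_strict _).trans (congrArg Z.v₁.eval ?_))
  refine Gph.Path.map_map_eq X.pathUnitHom.map_v₀ α.trans.isHom β.trans.isHom l (fun x => ?_)
    fun j => ?_
  · exact congrFun (congrArg CatGraph.Trans.ob h) x
  · exact congrFun (congrArg CatGraph.Trans.ve h) j

/-- An arbitrary algebra may be replaced by a double category, in which the vertical composites that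
define the extensions are available. -/
theorem pathUnit_isStrictClassifier (X : DblCat.{u}) : X.pathUnit.IsStrictClassifier where
  bijective_obj B P := by
    obtain ⟨Z, rfl⟩ := DblCat.exists_toAlgebra_eq B
    obtain ⟨G, hG⟩ := exists_extension P
    exact ⟨_, hG, fun G' hG' => eq_of_compStrict_eq (hG'.trans hG.symm)⟩
  bijective_map B G G' β := by
    obtain ⟨Z, rfl⟩ := DblCat.exists_toAlgebra_eq B
    refine ⟨β.extend, CatGraph.Trans.ext rfl (funext fun j => Z.v₁.eval_single _),
      fun α hα => TwoCell.ext (CatGraph.Trans.ext ?_ (funext fun l => ve_eq_of_strict hα l))⟩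
    have e := congrArg CatGraph.Trans.ob hα
    exact e

theorem pathUnit_compStrict_pathProj (X : DblCat.{u}) :
    X.pathUnit.compStrict (DblCat.toAlgebraMap X.pathProj) = ofStrict (𝟙 X.toAlgebra) := by
  refine ext_of_eq (CatGraph.Hom.ext rfl rfl (funext X.v₀.eval_single) rfl) rfl
    (funext fun p => congrArg X.h₁.one (congrArg X.v₀.eval ?_))
  exact Gph.Path.ext rfl (List.map_id _).symm

theorem compStrict_comp {A B C D : Mbar.{u}.Algebra} (P : PseudoHom A B) (F : B ⟶ C) (G : C ⟶ D) :
    P.compStrict (F ≫ G) = (P.compStrict F).compStrict G := ext_of_eq rfl rfl rfl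

end PseudoHom

/-! ### Flexible double categories -/

namespace DblCat

/-- Compatibility with the actions at empty paths gives identities, and at paths of length two gives
composites. -/
theorem isFunctor_of_algebraHom {X Z : DblCat.{u}} (T : X.toAlgebra ⟶ Z.toAlgebra) :
    CatStr.IsFunctor X.v₀ Z.v₀ T.f.obj T.f.ver where
  src := T.f.map_v₀.src
  tgt := T.f.map_v₀.tgt
  one x := (congrFun (congrArg CatGraph.Hom.ver T.h)
    (Gph.Path.mk (G := X.v₀.toGph) x [] trivial)).symm
  comp a b h h' := by
    have hp : X.v₀.IsPath (X.v₀.src a) [a, b] := ⟨rfl, h.symm, trivial⟩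
    let p : X.v₀.Path := ⟨X.v₀.src a, [a, b], hp⟩
    have e := congrFun (congrArg CatGraph.Hom.ver T.h) p
    exact (congrArg T.f.ver (X.v₀.eval_pair hp h)).symm.trans
      (e.symm.trans (Z.v₀.eval_pair (p.map T.f.map_v₀).isPath h'))

/-- Any classifier `A'` maps strictly to `pathDbl` over `X`, so a strict section of its counit
becomes a section of `pathProj` and decomposes vertical morphisms into paths. In the other direction
`pathDbl` itself serves as the classifier, and cofibrancy provides the section. -/
theorem isFlexible_iff_isFree (X : DblCat.{u}) : IsFlexible X.toAlgebra ↔ X.v₀.IsFree := by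
  constructor
  · rintro ⟨A', p, hp, q, hq, s, hs⟩
    obtain ⟨G, hG, -⟩ := hp.bijective_obj _ X.pathUnit
    -- Both strict morphisms restrict along `p` to the identity of `X`, so the universal property
    -- identifies them.
    have hGq : G ≫ toAlgebraMap X.pathProj = q := by
      refine (hp.bijective_obj _ _).unique ?_ hq
      rw [PseudoHom.compStrict_comp, hG, PseudoHom.pathUnit_compStrict_pathProj]
    have hT : (s ≫ G) ≫ toAlgebraMap X.pathProj = 𝟙 X.toAlgebra := by
      rw [Category.assoc, hGq, hs]
    exact X.v₀.isFree_of_path_section (isFunctor_of_algebraHom (s ≫ G))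
      (congrFun (congrArg (fun T : X.toAlgebra ⟶ X.toAlgebra => T.f.ver) hT))
  · intro h
    obtain ⟨s, hs⟩ := exists_section_of_isCofibrant (isCofibrant_of_isFree h)
      X.pathProj_acyclicFibration
    refine ⟨X.pathDbl.toAlgebra, X.pathUnit, PseudoHom.pathUnit_isStrictClassifier X,
      toAlgebraMap X.pathProj, PseudoHom.pathUnit_compStrict_pathProj X, toAlgebraMap s, ?_⟩
    exact congrArg (fun F : X ⟶ X => toAlgebraMap F) hs

theorem isFree_iff_exists_iso (X : DblCat.{u}) :
    X.v₀.IsFree ↔ ∃ Γ : Quiv.{u, u}, Nonempty (X.objCat ≅ Cat.free.obj Γ) :=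
  ⟨fun h => h.exists_iso, fun ⟨Γ, ⟨e⟩⟩ => CatStr.isFree_of_iso Γ e⟩

end DblCat

end DoubleCat

/-- The cofibrant objects of the `τ'`-model structure on double categories are exactly the
flexible double categories (flexible `M̄`-algebras), and a double category `X` is flexible if and
only if `X₀` is isomorphic to the free category on a directed graph. -/
theorem mainTheorem8 :
    (∀ X : DoubleCat.DblCat.{u},
      HomotopicalAlgebra.IsCofibrant X ↔ DoubleCat.IsFlexible X.toAlgebra) ∧
    (∀ X : DoubleCat.DblCat.{u},
      DoubleCat.IsFlexible X.toAlgebra ↔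
        ∃ Γ : Quiv.{u, u}, Nonempty (X.objCat ≅ Cat.free.obj Γ)) :=
  ⟨fun X => X.isCofibrant_iff_isFree.trans X.isFlexible_iff_isFree.symm,
    fun X => X.isFlexible_iff_isFree.trans X.isFree_iff_exists_iso⟩
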